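/- **Setting.** Let $K=\mathbb{Q}(q,t)$ and let $\lambda$ be a Young diagram with $n=|\lambda|$ boxes (English notation); the content of a box is $c(\square)=\text{column}-\text{row}$. *Algebras.* $\mathcal{H}_n$ is the $K$-algebra generated by $T_1,\dots,T_{n-1}$ with $(T_i-1)(T_i+t)=0$, $T_iT_{i+1}T_i=T_{i+1}T_iT_{i+1}$, and $T_iT_j=T_jT_i$ for $|i-j|>1$. Put $\bar\theta_1=1$, $\bar\theta_{i+1}=tT_i^{-1}\bar\theta_iT_i^{-1}$, $\bar\varphi_i=(tT_i^{-1})\bar\theta_i-\bar\theta_i(tT_i^{-1})$. The positive affine Hecke algebra $\mathcal{A}_n$ is generated by $T_1,\dots,T_{n-1},\theta_1,\dots,\theta_n$ with the relations of $\mathcal{H}_n$ together with $\theta_i\theta_j=\theta_j\theta_i$, $\theta_{i+1}=tT_i^{-1}\theta_iT_i^{-1}$, and $T_i\theta_j=\theta_jT_i$ for $j\notin\{i,i+1\}$; put $\pi_n=t^{n-1}\theta_1T_1^{-1}\cdots T_{n-1}^{-1}$ (and $\pi_0=1$). Let $\rho_n:\mathcal{A}_n\to\mathcal{H}_n$ be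 the homomorphism $T_i\mapsto T_i$, $\theta_i\mapsto\bar\theta_i$. The positive double affine Hecke algebra $\mathcal{D}_n$ is generated by the $T_i,\theta_i$ and $X_1,\dots,X_n$ with the relations of $\mathcal{A}_n$ together with $X_iX_j=X_jX_i$, $X_{i+1}=tT_i^{-1}X_iT_i^{-1}$, $T_iX_j=X_jT_i$ for $j\notin\{i,i+1\}$, $\pi_nX_i=X_{i+1}\pi_n$ for $1\le i\le n-1$, and $\pi_nX_n=qX_1\pi_n$. *Tableaux.* $\mathrm{RYT}(\lambda)$ is the set of labellings $T:\lambda\to\mathbb{Z}_{\ge0}$ weakly decreasing along rows and columns. $\mathrm{PSYT}(\lambda)$ is the set of labellings $\tau$ of $\lambda$ by formal products $jq^b$ ($1\le j\le n$, $b\ge0$), with each $j$ occurring in exactly one box, strictly increasing along rows and columns for the order $jq^m<kq^\ell$ iff $m>\ell$, or $m=\ell$ and $j<k$. $\mathrm{SYT}(\lambda)\subset\mathrm{PSYT}(\lambda)$ is the set of standard Young tableaux (all exponents $0$). If $\tau(\square)=iq^b$, put $w_\tau(i)=b$, $c_\tau(i)=c(\square)$, and $\mathfrak{p}_\lambda(\tau)(\square)=b$,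 so $\mathfrak{p}_\lambda:\mathrm{PSYT}(\lambda)\to\mathrm{RYT}(\lambda)$. Let $s_i(\tau)$ be $\tau$ with the numbers $i$ and $i+1$ exchanged (exponents stay in their boxes), defined if this lies in $\mathrm{PSYT}(\lambda)$. Write $s_i(\tau)>\tau$ if $s_i(\tau)$ is defined and either $w_\tau(i)<w_\tau(i+1)$, or $w_\tau(i)=w_\tau(i+1)$ and $c_\tau(i)-c_\tau(i+1)>1$. Let $\Psi(\tau)\in\mathrm{PSYT}(\lambda)$ be obtained by replacing $kq^a$ by $(k-1)q^a$ for $k\ge2$ and $1q^a$ by $nq^{a+1}$. *Modules.* Write $\lambda$ also for the $\mathcal{H}_n$-module generated by $\tau\in\mathrm{SYT}(\lambda)$ subject to: $\bar\theta_i\tau=t^{c_\tau(i)}\tau$; $\bar\varphi_i\tau=(t^{c_\tau(i)}-t^{c_\tau(i+1)})s_i(\tau)$ if $s_i(\tau)>\tau$; $T_i\tau=\tau$ if $i,i+1$ are in the same row of $\tau$; $T_i\tau=-t\tau$ if they are in the same column. Let $V_\lambda=\mathrm{Ind}_{\mathcal{A}_n}^{\mathcal{D}_n}\rho_n^*(\lambda)=\mathcal{D}_n\otimes_{\mathcal{A}_n}\rho_n^*(\lambda)$.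 **Statement.** The element $\pi_n$ acts bijectively on $V_\lambda$, and $V_\lambda$ has a $K$-basis $\{F_\tau:\tau\in\mathrm{PSYT}(\lambda)\}$ with the following properties: 1. $\theta_iF_\tau=q^{w_\tau(i)}t^{c_\tau(i)}F_\tau$ for $1\le i\le n$, and the weights $(q^{w_\tau(i)}t^{c_\tau(i)})_{1\le i\le n}$ are distinct for distinct $\tau$; 2. $F_\tau=1\otimes\tau$ if $\tau\in\mathrm{SYT}(\lambda)$; 3. if $s_i(\tau)>\tau$, then $\displaystyle F_{s_i(\tau)}=\Bigl(tT_i^{-1}+\frac{(t-1)q^{w_\tau(i+1)}t^{c_\tau(i+1)}}{q^{w_\tau(i)}t^{c_\tau(i)}-q^{w_\tau(i+1)}t^{c_\tau(i+1)}}\Bigr)F_\tau$; 4. $F_{\Psi(\tau)}=q^{w_\tau(1)}X_n\pi_n^{-1}F_\tau$ (for $n\ge1$). For every basis $(F_\tau)$ of $V_\lambda$ with these properties, and for $T\in\mathrm{RYT}(\lambda)$, the span $U_T=\mathrm{span}_K\{F_\tau:\mathfrak{p}_\lambda(\tau)=T\}$ is an $\mathcal{A}_n$-submodule of $V_\lambda$;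 moreover $$\mathrm{Res}^{\mathcal{D}_n}_{\mathcal{A}_n}V_\lambda=\bigoplus_{T\in\mathrm{RYT}(\lambda)}U_T,$$ and each $U_T$ is an irreducible $\mathcal{A}_n$-module. -/

import Mathlib

open scoped TensorProduct

noncomputable section

namespace MackeyDAHA

/-! ## The ground field and the algebras -/

/-- The field `ℚ(q,t)` of rational functions in two variables. -/
def Kqt : Type := FractionRing (MvPolynomial (Fin 2) ℚ)

instance : Field Kqt := inferInstanceAs (Field (FractionRing (MvPolynomial (Fin 2) ℚ)))

instance : Algebra (MvPolynomial (Fin 2) ℚ) Kqt :=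
  inferInstanceAs (Algebra (MvPolynomial (Fin 2) ℚ) (FractionRing (MvPolynomial (Fin 2) ℚ)))

instance : IsFractionRing (MvPolynomial (Fin 2) ℚ) Kqt :=
  inferInstanceAs
    (IsFractionRing (MvPolynomial (Fin 2) ℚ) (FractionRing (MvPolynomial (Fin 2) ℚ)))

/-- The indeterminate `q`. -/
def q : Kqt := algebraMap (MvPolynomial (Fin 2) ℚ) Kqt (MvPolynomial.X 0)

/-- The indeterminate `t`. -/
def t : Kqt := algebraMap (MvPolynomial (Fin 2) ℚ) Kqt (MvPolynomial.X 1)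

theorem t_ne_zero : t ≠ 0 := by
  unfold t
  rw [Ne, IsFractionRing.to_map_eq_zero_iff]
  exact MvPolynomial.X_ne_zero 1

/-- The position `i`, as an element of `{0, …, n-1}`, for `i` indexing a generator `T_i`.
All indices are shifted by one: `i : Fin (n - 1)` stands for `i + 1 ∈ {1, …, n-1}`. -/
def lo {n : ℕ} (i : Fin (n - 1)) : Fin n := ⟨i.1, by omega⟩

/-- The position `i + 1`, for `i` indexing a generator `T_i`. -/
def hi {n : ℕ} (i : Fin (n - 1)) : Fin n := ⟨i.1 + 1, by omega⟩

section Relations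

variable {R : Type*} [Ring R] [Algebra Kqt R]

/-- The inverse of a solution `x` of `(x - 1)(x + t) = 0`; see `mul_tinv` and `tinv_mul`. -/
def tinv (x : R) : R := t⁻¹ • (x + algebraMap Kqt R (t - 1))

theorem mul_tinv {x : R} (h : (x - 1) * (x + algebraMap Kqt R t) = 0) : x * tinv x = 1 := by
  have h1 : x * (x + algebraMap Kqt R (t - 1)) = algebraMap Kqt R t := by
    have h2 : x * (x + algebraMap Kqt R (t - 1)) - algebraMap Kqt R t
        = (x - 1) * (x + algebraMap Kqt R t) := by
      simp only [map_sub, map_one]; noncomm_ring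
    rw [h] at h2
    exact sub_eq_zero.mp h2
  rw [tinv, mul_smul_comm, h1, Algebra.algebraMap_eq_smul_one, smul_smul,
    inv_mul_cancel₀ t_ne_zero, one_smul]

theorem commute_tinv {x y : R} (h : Commute y x) : Commute y (tinv x) := by
  unfold tinv
  exact (h.add_right (Algebra.commutes _ _).symm).smul_right _

theorem tinv_mul {x : R} (h : (x - 1) * (x + algebraMap Kqt R t) = 0) : tinv x * x = 1 := by
  rw [← (commute_tinv (Commute.refl x)).eq, mul_tinv h]

theorem map_tinv {S : Type*} [Ring S] [Algebra Kqt S] (f : R →ₐ[Kqt] S) (x : R) :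
    f (tinv x) = tinv (f x) := by
  simp [tinv]

/-- The defining relations of the finite Hecke algebra. -/
inductive HeckeRel {n : ℕ} (T : Fin (n - 1) → R) : R → R → Prop
  | quad (i : Fin (n - 1)) : HeckeRel T ((T i - 1) * (T i + algebraMap Kqt R t)) 0
  | braid (i j : Fin (n - 1)) (h : i.1 + 1 = j.1) :
      HeckeRel T (T i * T j * T i) (T j * T i * T j)
  | far (i j : Fin (n - 1)) (h : i.1 + 1 < j.1 ∨ j.1 + 1 < i.1) : HeckeRel T (T i * T j) (T j * T i)

/-- The defining relations of the positive affine Hecke algebra. -/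
inductive AffRel {n : ℕ} (T : Fin (n - 1) → R) (θ : Fin n → R) : R → R → Prop
  | hecke {x y : R} (h : HeckeRel T x y) : AffRel T θ x y
  | comm (i j : Fin n) : AffRel T θ (θ i * θ j) (θ j * θ i)
  | step (i : Fin (n - 1)) :
      AffRel T θ (θ (hi i)) (t • (tinv (T i) * θ (lo i) * tinv (T i)))
  | far (i : Fin (n - 1)) (j : Fin n) (h₁ : j ≠ lo i) (h₂ : j ≠ hi i) :
      AffRel T θ (T i * θ j) (θ j * T i)

/-- `π_n = t^(n-1) θ_1 T_1⁻¹ ⋯ T_(n-1)⁻¹` (and `1` if `n = 0`). -/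
def piElt {n : ℕ} (T : Fin (n - 1) → R) (θ : Fin n → R) : R :=
  if h : 0 < n then t ^ (n - 1) • (θ ⟨0, h⟩ * (List.ofFn fun i => tinv (T i)).prod) else 1

/-- The defining relations of the positive double affine Hecke algebra. -/
inductive DahaRel {n : ℕ} (T : Fin (n - 1) → R) (θ X : Fin n → R) : R → R → Prop
  | aff {x y : R} (h : AffRel T θ x y) : DahaRel T θ X x y
  | comm (i j : Fin n) : DahaRel T θ X (X i * X j) (X j * X i)
  | step (i : Fin (n - 1)) :
      DahaRel T θ X (X (hi i)) (t • (tinv (T i) * X (lo i) * tinv (T i)))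
  | far (i : Fin (n - 1)) (j : Fin n) (h₁ : j ≠ lo i) (h₂ : j ≠ hi i) :
      DahaRel T θ X (T i * X j) (X j * T i)
  | pi (i : Fin (n - 1)) : DahaRel T θ X (piElt T θ * X (lo i)) (X (hi i) * piElt T θ)
  | pi_last (i j : Fin n) (h₁ : i.1 = 0) (h₂ : j.1 + 1 = n) :
      DahaRel T θ X (piElt T θ * X j) (q • (X i * piElt T θ))

theorem HeckeRel.map {S : Type*} [Ring S] [Algebra Kqt S] (f : R →ₐ[Kqt] S) {n : ℕ}
    {T : Fin (n - 1) → R} {x y : R} (h : HeckeRel T x y) :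
    HeckeRel (fun i => f (T i)) (f x) (f y) := by
  cases h with
  | quad i => simpa using HeckeRel.quad (T := fun i => f (T i)) i
  | braid i j h => simpa using HeckeRel.braid (T := fun i => f (T i)) i j h
  | far i j h => simpa using HeckeRel.far (T := fun i => f (T i)) i j h

theorem AffRel.map {S : Type*} [Ring S] [Algebra Kqt S] (f : R →ₐ[Kqt] S) {n : ℕ}
    {T : Fin (n - 1) → R} {θ : Fin n → R} {x y : R} (h : AffRel T θ x y) :
    AffRel (fun i => f (T i)) (fun i => f (θ i)) (f x) (f y) := by
  cases h with
  | hecke h => exact .hecke (h.map f)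
  | comm i j => simpa using AffRel.comm (T := fun i => f (T i)) (θ := fun i => f (θ i)) i j
  | step i =>
    simpa [map_tinv] using AffRel.step (T := fun i => f (T i)) (θ := fun i => f (θ i)) i
  | far i j h₁ h₂ =>
    simpa using AffRel.far (T := fun i => f (T i)) (θ := fun i => f (θ i)) i j h₁ h₂

/-- `θ̄_1 = 1` and `θ̄_(k+1) = t T_k⁻¹ θ̄_k T_k⁻¹`, with indices shifted by one
(the value beyond `n` is not used). -/
def thetaBarAux {n : ℕ} (T : Fin (n - 1) → R) : ℕ → R
  | 0 => 1
  | k + 1 => if h : k < n - 1 then t • (tinv (T ⟨k, h⟩) * thetaBarAux T k * tinv (T ⟨k, h⟩)) else 1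

/-- Any `T` satisfying the Hecke relations: `θ̄_(k+1)` commutes with `T_j` for `j > k + 1`. -/
theorem thetaBarAux_commute_above {n : ℕ} {T : Fin (n - 1) → R}
    (H : ∀ x y, HeckeRel T x y → x = y) (k : ℕ) (j : Fin (n - 1)) (hk : k < j.1) :
    Commute (T j) (thetaBarAux T k) := by
  induction k with
  | zero => exact Commute.one_right _
  | succ k ih =>
    rw [thetaBarAux]
    split_ifs with h
    · have h1 : Commute (T j) (tinv (T ⟨k, h⟩)) :=
        commute_tinv (H _ _ (.far j ⟨k, h⟩ (Or.inr hk)))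
      exact ((h1.mul_right (ih (by omega))).mul_right h1).smul_right _
    · exact Commute.one_right _

theorem braid_tinv {n : ℕ} {T : Fin (n - 1) → R}
    (H : ∀ x y, HeckeRel T x y → x = y) (i j : Fin (n - 1)) (h : i.1 + 1 = j.1) :
    T i * tinv (T j) * tinv (T i) = tinv (T j) * tinv (T i) * T j ∧
      tinv (T i) * tinv (T j) * T i = T j * tinv (T i) * tinv (T j) := by
  have b := H _ _ (.braid i j h)
  have i1 := mul_tinv (H _ _ (.quad i))
  have i2 := tinv_mul (H _ _ (.quad i))
  have j1 := mul_tinv (H _ _ (.quad j))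
  have j2 := tinv_mul (H _ _ (.quad j))
  generalize tinv (T i) = a at *
  generalize tinv (T j) = c at *
  generalize T i = x at *
  generalize T j = y at *
  constructor
  · calc x * c * a = (c * (a * x) * y) * (x * c * a) := by rw [i2, mul_one, j2, one_mul]
      _ = c * a * (x * y * x) * c * a := by noncomm_ring
      _ = c * a * y * (x * (y * c) * a) := by rw [b]; noncomm_ring
      _ = c * a * y := by rw [j1, mul_one, i1, mul_one]
  · calc a * c * x = (a * c * x) * (y * (x * a) * c) := by rw [i1, mul_one, j1, mul_one]
      _ = a * c * (x * y * x) * a * c := by noncomm_ring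
      _ = (a * (c * y) * x) * y * a * c := by rw [b]; noncomm_ring
      _ = y * a * c := by rw [j2, mul_one, i2, one_mul]

/-- `θ̄_(k+1)` commutes with `T_j` for `j < k`. -/
theorem thetaBarAux_commute_below {n : ℕ} {T : Fin (n - 1) → R}
    (H : ∀ x y, HeckeRel T x y → x = y) (k : ℕ) (j : Fin (n - 1)) (hk : j.1 + 1 < k) :
    Commute (T j) (thetaBarAux T k) := by
  induction k with
  | zero => omega
  | succ k ih =>
    rw [thetaBarAux]
    split_ifs with h
    · by_cases hj : j.1 + 1 < k
      · have h1 : Commute (T j) (tinv (T ⟨k, h⟩)) :=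
          commute_tinv (H _ _ (.far j ⟨k, h⟩ (Or.inl hj)))
        exact ((h1.mul_right (ih hj)).mul_right h1).smul_right _
      · obtain rfl : k = j.1 + 1 := by omega
        have hj' : j.1 < n - 1 := j.2
        rw [thetaBarAux, dif_pos hj']
        obtain ⟨b1, b2⟩ := braid_tinv H j ⟨j.1 + 1, h⟩ rfl
        have c := (thetaBarAux_commute_above H j.1 ⟨j.1 + 1, h⟩ (Nat.lt_succ_self _)).eq
        simp only [Fin.eta]
        generalize tinv (T ⟨j.1 + 1, h⟩) = u at *
        generalize T ⟨j.1 + 1, h⟩ = v at *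
        generalize thetaBarAux T j.1 = w at *
        generalize tinv (T j) = a at *
        generalize T j = x at *
        rw [mul_smul_comm, smul_mul_assoc]
        refine Commute.smul_right (Commute.smul_right ?_ _) _
        show x * (u * (a * w * a) * u) = u * (a * w * a) * u * x
        calc x * (u * (a * w * a) * u) = (x * u * a) * w * (a * u) := by noncomm_ring
          _ = u * a * (v * w) * (a * u) := by rw [b1]; noncomm_ring
          _ = u * a * w * (v * a * u) := by rw [c]; noncomm_ring
          _ = u * (a * w * a) * u * x := by rw [← b2]; noncomm_ring
    · exact Commute.one_right _

theorem thetaBarAux_commute_lt {n : ℕ} {T : Fin (n - 1) → R}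
    (H : ∀ x y, HeckeRel T x y → x = y) (k l : ℕ) (hkl : k < l) :
    Commute (thetaBarAux T k) (thetaBarAux T l) := by
  induction k with
  | zero => exact Commute.one_left _
  | succ k ih =>
    rw [thetaBarAux]
    split_ifs with h
    · have h1 : Commute (tinv (T ⟨k, h⟩)) (thetaBarAux T l) :=
        (commute_tinv (thetaBarAux_commute_below H l ⟨k, h⟩ hkl).symm).symm
      exact ((h1.mul_left (ih (by omega))).mul_left h1).smul_left _
    · exact Commute.one_left _

/-- The elements `θ̄_i` satisfy the affine relations. -/
theorem affRel_thetaBarAux {n : ℕ} {T : Fin (n - 1) → R}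
    (H : ∀ x y, HeckeRel T x y → x = y) {x y : R}
    (h : AffRel T (fun i : Fin n => thetaBarAux T i.1) x y) : x = y := by
  cases h with
  | hecke h => exact H _ _ h
  | comm i j =>
    rcases lt_trichotomy i.1 j.1 with h | h | h
    · exact thetaBarAux_commute_lt H _ _ h
    · rw [h]
    · exact (thetaBarAux_commute_lt H _ _ h).symm
  | step i =>
    show thetaBarAux T (i.1 + 1) = _
    rw [thetaBarAux, dif_pos i.2]
    rfl
  | far i j h₁ h₂ =>
    have h₁' : j.1 ≠ i.1 := fun e => h₁ (Fin.ext e)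
    have h₂' : j.1 ≠ i.1 + 1 := fun e => h₂ (Fin.ext e)
    rcases lt_or_gt_of_ne h₁' with h | h
    · exact thetaBarAux_commute_above H _ _ h
    · exact thetaBarAux_commute_below H _ _ (by omega)

end Relations

/-! ### The finite Hecke algebra -/

/-- The finite Hecke algebra `ℋ_n` over `ℚ(q,t)`. -/
def Hecke (n : ℕ) : Type :=
  RingQuot (HeckeRel (FreeAlgebra.ι Kqt : Fin (n - 1) → FreeAlgebra Kqt (Fin (n - 1))))

instance (n : ℕ) : Ring (Hecke n) :=
  inferInstanceAs (Ring (RingQuot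
    (HeckeRel (FreeAlgebra.ι Kqt : Fin (n - 1) → FreeAlgebra Kqt (Fin (n - 1))))))

instance (n : ℕ) : Algebra Kqt (Hecke n) :=
  inferInstanceAs (Algebra Kqt (RingQuot
    (HeckeRel (FreeAlgebra.ι Kqt : Fin (n - 1) → FreeAlgebra Kqt (Fin (n - 1))))))

/-- The quotient map from the free algebra. -/
def Hecke.mk (n : ℕ) : FreeAlgebra Kqt (Fin (n - 1)) →ₐ[Kqt] Hecke n :=
  RingQuot.mkAlgHom Kqt (HeckeRel (FreeAlgebra.ι Kqt))

/-- The generators `T_i` of `ℋ_n`. -/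
def Hecke.T {n : ℕ} (i : Fin (n - 1)) : Hecke n := Hecke.mk n (FreeAlgebra.ι Kqt i)

/-- The elements `θ̄_i` of `ℋ_n`. -/
def Hecke.thetaBar {n : ℕ} (i : Fin n) : Hecke n := thetaBarAux Hecke.T i.1

/-- `φ̄_i = (t T_i⁻¹) θ̄_i - θ̄_i (t T_i⁻¹)`. -/
def Hecke.phiBar {n : ℕ} (i : Fin (n - 1)) : Hecke n :=
  (t • tinv (Hecke.T i)) * Hecke.thetaBar (lo i) - Hecke.thetaBar (lo i) * (t • tinv (Hecke.T i))

theorem Hecke.rel {n : ℕ} (x y : Hecke n) (h : HeckeRel (Hecke.T (n := n)) x y) : x = y := by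
  have key : ∀ {a b : FreeAlgebra Kqt (Fin (n - 1))}, HeckeRel (FreeAlgebra.ι Kqt) a b →
      Hecke.mk n a = Hecke.mk n b := fun h => RingQuot.mkAlgHom_rel Kqt h
  cases h with
  | quad i => simpa [Hecke.T] using key (.quad i)
  | braid i j h => simpa [Hecke.T] using key (.braid i j h)
  | far i j h => simpa [Hecke.T] using key (.far i j h)

/-! ### The positive affine Hecke algebra -/

/-- The generators of `𝒜_n`. -/
inductive AffGen (n : ℕ) : Type
  | T (i : Fin (n - 1))
  | θ (i : Fin n)

/-- The defining relations of `𝒜_n` in the free algebra. -/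
abbrev affRel (n : ℕ) : FreeAlgebra Kqt (AffGen n) → FreeAlgebra Kqt (AffGen n) → Prop :=
  AffRel (fun i => FreeAlgebra.ι Kqt (AffGen.T i)) (fun i => FreeAlgebra.ι Kqt (AffGen.θ i))

/-- The positive affine Hecke algebra `𝒜_n` over `ℚ(q,t)`. -/
def Aff (n : ℕ) : Type := RingQuot (affRel n)

instance (n : ℕ) : Ring (Aff n) := inferInstanceAs (Ring (RingQuot (affRel n)))

instance (n : ℕ) : Algebra Kqt (Aff n) := inferInstanceAs (Algebra Kqt (RingQuot (affRel n)))

/-- The quotient map from the free algebra. -/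
def Aff.mk (n : ℕ) : FreeAlgebra Kqt (AffGen n) →ₐ[Kqt] Aff n :=
  RingQuot.mkAlgHom Kqt (affRel n)

/-- The generators `T_i` of `𝒜_n`. -/
def Aff.T {n : ℕ} (i : Fin (n - 1)) : Aff n := Aff.mk n (FreeAlgebra.ι Kqt (AffGen.T i))

/-- The generators `θ_i` of `𝒜_n`. -/
def Aff.θ {n : ℕ} (i : Fin n) : Aff n := Aff.mk n (FreeAlgebra.ι Kqt (AffGen.θ i))

/-- The element `π_n` of `𝒜_n`. -/
def Aff.pi (n : ℕ) : Aff n := piElt Aff.T Aff.θ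

/-- The algebra homomorphism `ρ_n : 𝒜_n → ℋ_n`, `T_i ↦ T_i`, `θ_i ↦ θ̄_i`. -/
def rho (n : ℕ) : Aff n →ₐ[Kqt] Hecke n :=
  RingQuot.liftAlgHom Kqt ⟨FreeAlgebra.lift Kqt (fun g : AffGen n => match g with
      | .T i => Hecke.T i
      | .θ i => Hecke.thetaBar i), by
    intro x y h
    have h' := h.map (FreeAlgebra.lift Kqt (fun g : AffGen n => match g with
      | .T i => Hecke.T i
      | .θ i => Hecke.thetaBar i))
    simp only [FreeAlgebra.lift_ι_apply] at h'
    exact affRel_thetaBarAux Hecke.rel h'⟩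

theorem rho_T {n : ℕ} (i : Fin (n - 1)) : rho n (Aff.T i) = Hecke.T i := by
  unfold rho Aff.T Aff.mk
  exact (RingQuot.liftAlgHom_mkAlgHom_apply Kqt _ _ _).trans (FreeAlgebra.lift_ι_apply _ _)

theorem rho_θ {n : ℕ} (i : Fin n) : rho n (Aff.θ i) = Hecke.thetaBar i := by
  unfold rho Aff.θ Aff.mk
  exact (RingQuot.liftAlgHom_mkAlgHom_apply Kqt _ _ _).trans (FreeAlgebra.lift_ι_apply _ _)

/-! ### The positive double affine Hecke algebra -/

/-- The generators of `𝒟_n`. -/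
inductive DahaGen (n : ℕ) : Type
  | T (i : Fin (n - 1))
  | θ (i : Fin n)
  | X (i : Fin n)

/-- The defining relations of `𝒟_n` in the free algebra. -/
abbrev dahaRel (n : ℕ) : FreeAlgebra Kqt (DahaGen n) → FreeAlgebra Kqt (DahaGen n) → Prop :=
  DahaRel (fun i => FreeAlgebra.ι Kqt (DahaGen.T i)) (fun i => FreeAlgebra.ι Kqt (DahaGen.θ i))
    (fun i => FreeAlgebra.ι Kqt (DahaGen.X i))

/-- The positive double affine Hecke algebra `𝒟_n` over `ℚ(q,t)`. -/
def Daha (n : ℕ) : Type := RingQuot (dahaRel n)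

instance (n : ℕ) : Ring (Daha n) := inferInstanceAs (Ring (RingQuot (dahaRel n)))

instance (n : ℕ) : Algebra Kqt (Daha n) := inferInstanceAs (Algebra Kqt (RingQuot (dahaRel n)))

/-- The quotient map from the free algebra. -/
def Daha.mk (n : ℕ) : FreeAlgebra Kqt (DahaGen n) →ₐ[Kqt] Daha n :=
  RingQuot.mkAlgHom Kqt (dahaRel n)

/-- The generators `T_i` of `𝒟_n`. -/
def Daha.T {n : ℕ} (i : Fin (n - 1)) : Daha n := Daha.mk n (FreeAlgebra.ι Kqt (DahaGen.T i))

/-- The generators `θ_i` of `𝒟_n`. -/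
def Daha.θ {n : ℕ} (i : Fin n) : Daha n := Daha.mk n (FreeAlgebra.ι Kqt (DahaGen.θ i))

/-- The generators `X_i` of `𝒟_n`. -/
def Daha.X {n : ℕ} (i : Fin n) : Daha n := Daha.mk n (FreeAlgebra.ι Kqt (DahaGen.X i))

/-- The canonical homomorphism `𝒜_n → 𝒟_n`, `T_i ↦ T_i`, `θ_i ↦ θ_i`. -/
def incl (n : ℕ) : Aff n →ₐ[Kqt] Daha n :=
  RingQuot.liftAlgHom Kqt ⟨(Daha.mk n).comp (FreeAlgebra.lift Kqt (fun g : AffGen n => match g with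
      | .T i => FreeAlgebra.ι Kqt (DahaGen.T i)
      | .θ i => FreeAlgebra.ι Kqt (DahaGen.θ i))), by
    intro x y h
    have h' := h.map (FreeAlgebra.lift Kqt (fun g : AffGen n => match g with
      | .T i => FreeAlgebra.ι Kqt (DahaGen.T i)
      | .θ i => FreeAlgebra.ι Kqt (DahaGen.θ i)))
    simp only [FreeAlgebra.lift_ι_apply] at h'
    exact RingQuot.mkAlgHom_rel Kqt (DahaRel.aff h')⟩

theorem incl_T {n : ℕ} (i : Fin (n - 1)) : incl n (Aff.T i) = Daha.T i := by
  unfold incl Aff.T Aff.mk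
  refine (RingQuot.liftAlgHom_mkAlgHom_apply Kqt _ _ _).trans ?_
  rw [AlgHom.comp_apply, FreeAlgebra.lift_ι_apply]
  rfl

theorem incl_θ {n : ℕ} (i : Fin n) : incl n (Aff.θ i) = Daha.θ i := by
  unfold incl Aff.θ Aff.mk
  refine (RingQuot.liftAlgHom_mkAlgHom_apply Kqt _ _ _).trans ?_
  rw [AlgHom.comp_apply, FreeAlgebra.lift_ι_apply]
  rfl

/-! ## Labellings of Young diagrams -/

/-- The boxes `(row, column)` of a Young diagram in English notation. -/
abbrev Box (lam : YoungDiagram) : Type := {b : ℕ × ℕ // b ∈ lam.cells}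

/-- The content (column minus row) of a box. -/
def content {lam : YoungDiagram} (b : Box lam) : ℤ := (b.1.2 : ℤ) - (b.1.1 : ℤ)

/-- The box `b` comes strictly before `b'` in the same row or in the same column. -/
def Before {lam : YoungDiagram} (b b' : Box lam) : Prop :=
  (b.1.1 = b'.1.1 ∧ b.1.2 < b'.1.2) ∨ (b.1.2 = b'.1.2 ∧ b.1.1 < b'.1.1)

/-- The order on the labels: the pair `(j, m)` stands for the formal product `(j+1) q^m`, and
`j q^m < k q^l` if `m > l`, or `m = l` and `j < k`. -/
def LabelLt {n : ℕ} (x y : Fin n × ℕ) : Prop := y.2 < x.2 ∨ (x.2 = y.2 ∧ x.1 < y.1)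

/-- Non-negative reverse Young tableaux. -/
@[ext]
structure RYT (lam : YoungDiagram) where
  /-- the labelling -/
  toFun : Box lam → ℕ
  anti : ∀ b b', Before b b' → toFun b' ≤ toFun b

/-- Standard Young tableaux. The labels `1, …, n` are shifted to `0, …, n-1`. -/
@[ext]
structure SYT (lam : YoungDiagram) where
  /-- the labelling -/
  toFun : Box lam → Fin lam.card
  bij : Function.Bijective toFun
  mono : ∀ b b', Before b b' → toFun b < toFun b'

/-- Non-negative periodic standard Young tableaux; the pair `(j, m)` stands for the label
`(j+1) q^m`. -/
@[ext]
structure PSYT (lam : YoungDiagram) where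
  /-- the labelling -/
  toFun : Box lam → Fin lam.card × ℕ
  bij : Function.Bijective fun b => (toFun b).1
  mono : ∀ b b', Before b b' → LabelLt (toFun b) (toFun b')

instance (lam : YoungDiagram) : DecidableEq (RYT lam) := Classical.decEq _

/-- The inclusion of standard into periodic standard Young tableaux. -/
def SYT.toPSYT {lam : YoungDiagram} (τ : SYT lam) : PSYT lam where
  toFun b := (τ.toFun b, 0)
  bij := τ.bij
  mono b b' h := Or.inr ⟨rfl, τ.mono b b' h⟩

namespace PSYT

variable {lam : YoungDiagram}

/-- The box of `τ` with label `i q^b` for some `b`. -/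
def box (τ : PSYT lam) (i : Fin lam.card) : Box lam := (Equiv.ofBijective _ τ.bij).symm i

/-- `w_τ(i) = b` if `i q^b` is a label of `τ`. -/
def w (τ : PSYT lam) (i : Fin lam.card) : ℕ := (τ.toFun (τ.box i)).2

/-- `c_τ(i)` is the content of the box of `τ` with label `i q^b` for some `b`. -/
def c (τ : PSYT lam) (i : Fin lam.card) : ℤ := content (τ.box i)

/-- The weight `q^(w_τ(i)) t^(c_τ(i))`. -/
def weight (τ : PSYT lam) (i : Fin lam.card) : Kqt := q ^ τ.w i * t ^ τ.c i

/-- `s_i(τ)` is defined and equal to `τ'`. -/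
def IsSwap (i : Fin (lam.card - 1)) (τ τ' : PSYT lam) : Prop :=
  ∀ b, τ'.toFun b = (Equiv.swap (lo i) (hi i) (τ.toFun b).1, (τ.toFun b).2)

/-- `s_i(τ)` is defined, equal to `τ'`, and larger than `τ`. -/
def SwapUp (i : Fin (lam.card - 1)) (τ τ' : PSYT lam) : Prop :=
  IsSwap i τ τ' ∧ (τ.w (lo i) < τ.w (hi i) ∨
    (τ.w (lo i) = τ.w (hi i) ∧ 1 < τ.c (lo i) - τ.c (hi i)))

/-- The effect of `Ψ` on labels: `k q^a ↦ (k-1) q^a` for `k ≥ 2`, and `1 q^a ↦ n q^(a+1)`. -/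
def psiLabel {n : ℕ} (x : Fin n × ℕ) : Fin n × ℕ :=
  if x.1.1 = 0 then (⟨n - 1, by have := x.1.2; omega⟩, x.2 + 1)
  else (⟨x.1.1 - 1, by have := x.1.2; omega⟩, x.2)

/-- The map `Ψ`. -/
def psi (τ : PSYT lam) : PSYT lam where
  toFun b := psiLabel (τ.toFun b)
  bij := by
    have h : Function.Injective (fun k : Fin lam.card => (psiLabel (k, 0)).1) := by
      intro x y h
      simp only [psiLabel] at h
      have hx := x.2
      have hy := y.2
      split_ifs at h <;> simp only [Fin.mk.injEq] at h <;> apply Fin.ext <;> omega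
    have h2 := (Finite.injective_iff_bijective.mp h).comp τ.bij
    convert h2 using 1
    funext b
    simp only [psiLabel, Function.comp]
    split_ifs <;> rfl
  mono b b' hb := by
    have h := τ.mono b b' hb
    have hne : (τ.toFun b).1 ≠ (τ.toFun b').1 := by
      intro e
      have := τ.bij.1 e
      subst this
      rcases hb with hb | hb <;> omega
    have hne' : (τ.toFun b).1.1 ≠ (τ.toFun b').1.1 := fun e => hne (Fin.ext e)
    simp only [LabelLt, psiLabel, Fin.lt_def] at h ⊢
    have h1 := (τ.toFun b).1.2
    have h2 := (τ.toFun b').1.2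
    split_ifs <;> simp only <;> omega

/-- The map `𝔭_λ : PSYT(λ) → RYT(λ)`. -/
def toRYT (τ : PSYT lam) : RYT lam where
  toFun b := (τ.toFun b).2
  anti b b' h := by
    rcases τ.mono b b' h with h | h
    · exact h.le
    · exact h.1.ge

end PSYT

/-! ## The modules -/

/-- The defining relations of the irreducible `ℋ_n`-module attached to `λ`, in the free
`ℋ_n`-module on the standard Young tableaux of shape `λ`. -/
inductive SpechtRel (lam : YoungDiagram) : (SYT lam →₀ Hecke lam.card) →
    (SYT lam →₀ Hecke lam.card) → Prop
  | theta (i : Fin lam.card) (τ : SYT lam) :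
      SpechtRel lam (Hecke.thetaBar i • Finsupp.single τ 1)
        (t ^ τ.toPSYT.c i • Finsupp.single τ 1)
  | phi (i : Fin (lam.card - 1)) (τ τ' : SYT lam) (h : PSYT.SwapUp i τ.toPSYT τ'.toPSYT) :
      SpechtRel lam (Hecke.phiBar i • Finsupp.single τ 1)
        ((t ^ τ.toPSYT.c (lo i) - t ^ τ.toPSYT.c (hi i)) • Finsupp.single τ' 1)
  | row (i : Fin (lam.card - 1)) (τ : SYT lam)
      (h : (τ.toPSYT.box (lo i)).1.1 = (τ.toPSYT.box (hi i)).1.1) :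
      SpechtRel lam (Hecke.T i • Finsupp.single τ 1) (Finsupp.single τ 1)
  | col (i : Fin (lam.card - 1)) (τ : SYT lam)
      (h : (τ.toPSYT.box (lo i)).1.2 = (τ.toPSYT.box (hi i)).1.2) :
      SpechtRel lam (Hecke.T i • Finsupp.single τ 1) ((-t) • Finsupp.single τ 1)

/-- The submodule generated by the relations. -/
abbrev spechtSub (lam : YoungDiagram) :
    Submodule (Hecke lam.card) (SYT lam →₀ Hecke lam.card) :=
  Submodule.span (Hecke lam.card) {z | ∃ x y, SpechtRel lam x y ∧ z = x - y}

/-- The `ℋ_n`-module attached to `λ`: generated by the standard Young tableaux of shape `λ`,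
subject to the relations `SpechtRel`. -/
def Specht (lam : YoungDiagram) : Type := (SYT lam →₀ Hecke lam.card) ⧸ spechtSub lam

instance (lam : YoungDiagram) : AddCommGroup (Specht lam) :=
  inferInstanceAs (AddCommGroup (_ ⧸ spechtSub lam))

instance (lam : YoungDiagram) : Module (Hecke lam.card) (Specht lam) :=
  inferInstanceAs (Module (Hecke lam.card) (_ ⧸ spechtSub lam))

instance (lam : YoungDiagram) : Module Kqt (Specht lam) :=
  inferInstanceAs (Module Kqt (_ ⧸ spechtSub lam))

instance (lam : YoungDiagram) : IsScalarTower Kqt (Hecke lam.card) (Specht lam) :=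
  inferInstanceAs (IsScalarTower Kqt (Hecke lam.card) (_ ⧸ spechtSub lam))

/-- The element of `Specht lam` given by a standard Young tableau. -/
def Specht.vec {lam : YoungDiagram} (τ : SYT lam) : Specht lam :=
  (spechtSub lam).mkQ (Finsupp.single τ 1)

/-- The `𝒜_n`-module `ρ_n^*(λ)`: the pull-back of the `ℋ_n`-module along `ρ_n`. -/
instance (lam : YoungDiagram) : Module (Aff lam.card) (Specht lam) :=
  Module.compHom (Specht lam) (rho lam.card).toRingHom

/-- The `𝒟_n`-submodule of `𝒟_n ⊗_K ρ_n^*(λ)` that makes the tensor product `𝒜_n`-balanced. -/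
abbrev inducedSub (lam : YoungDiagram) :
    Submodule (Daha lam.card) (Daha lam.card ⊗[Kqt] Specht lam) :=
  Submodule.span (Daha lam.card) {z | ∃ (d : Daha lam.card) (a : Aff lam.card) (m : Specht lam),
    z = (d * incl lam.card a) ⊗ₜ[Kqt] m - d ⊗ₜ[Kqt] (a • m)}

/-- The `𝒟_n`-module `V_λ`, induced from the `𝒜_n`-module `ρ_n^*(λ)`, that is, the tensor product
`𝒟_n ⊗_{𝒜_n} ρ_n^*(λ)`. -/
def V (lam : YoungDiagram) : Type := (Daha lam.card ⊗[Kqt] Specht lam) ⧸ inducedSub lam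

instance (lam : YoungDiagram) : AddCommGroup (V lam) :=
  inferInstanceAs (AddCommGroup (_ ⧸ inducedSub lam))

instance (lam : YoungDiagram) : Module (Daha lam.card) (V lam) :=
  inferInstanceAs (Module (Daha lam.card) (_ ⧸ inducedSub lam))

instance (lam : YoungDiagram) : Module Kqt (V lam) :=
  inferInstanceAs (Module Kqt (_ ⧸ inducedSub lam))

instance (lam : YoungDiagram) : IsScalarTower Kqt (Daha lam.card) (V lam) :=
  inferInstanceAs (IsScalarTower Kqt (Daha lam.card) (_ ⧸ inducedSub lam))

/-- The restriction of `V_λ` to `𝒜_n`. -/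
instance (lam : YoungDiagram) : Module (Aff lam.card) (V lam) :=
  Module.compHom (V lam) (incl lam.card).toRingHom

theorem aff_smul_def {lam : YoungDiagram} (a : Aff lam.card) (v : V lam) :
    a • v = incl lam.card a • v := rfl

instance (lam : YoungDiagram) : IsScalarTower Kqt (Aff lam.card) (V lam) where
  smul_assoc k a v := by rw [aff_smul_def, aff_smul_def, map_smul, smul_assoc]

/-- The class `d ⊗ m` in `V_λ`. -/
def V.tmul {lam : YoungDiagram} (d : Daha lam.card) (m : Specht lam) : V lam :=
  (inducedSub lam).mkQ (d ⊗ₜ[Kqt] m)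

/-- The properties that characterise the basis of non-symmetric vector-valued Macdonald
polynomials `F_τ` of `V_λ`. In `psi`, the vector `v` is `π_n⁻¹ F_τ`. -/
structure IsMacdonaldBasis {lam : YoungDiagram} (F : Module.Basis (PSYT lam) Kqt (V lam)) :
    Prop where
  weight : ∀ (τ : PSYT lam) (i : Fin lam.card),
    (Aff.θ i : Aff lam.card) • F τ = τ.weight i • F τ
  weight_injective : Function.Injective (PSYT.weight (lam := lam))
  standard : ∀ τ : SYT lam, F τ.toPSYT = V.tmul 1 (Specht.vec τ)
  swap : ∀ (i : Fin (lam.card - 1)) (τ τ' : PSYT lam), PSYT.SwapUp i τ τ' →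
    F τ' = (t • tinv (Aff.T i : Aff lam.card)) • F τ +
      ((t - 1) * τ.weight (hi i) / (τ.weight (lo i) - τ.weight (hi i))) • F τ
  psi : ∀ (τ : PSYT lam) (i j : Fin lam.card), i.1 = 0 → j.1 + 1 = lam.card →
    ∀ v : V lam, Aff.pi lam.card • v = F τ →
      F τ.psi = q ^ τ.w i • (Daha.X j : Daha lam.card) • v

end MackeyDAHA

end

/-!
Let the operators `θ_i`, `S_i = t T_i⁻¹` and `Q = X_n π_n⁻¹` act on the space with basis `e_τ`,
`τ ∈ PSYT(λ)`, by the formulas that the basis `F_τ` has to satisfy. A tableau is determined by the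
exponents and contents of its labels, so each formula can be read off from such data, and the
relations between the three families of operators become identities of rational functions in `q`
and `t`. Since `T_i`, `θ_i` and `X_i` are expressible in `S_i`, `θ_i` and `Q`, these relations make
the space a `𝒟_n`-module in which the `e_σ`, `σ ∈ SYT(λ)`, satisfy the defining relations of the
`ℋ_n`-module `λ`; this gives a map from `V_λ` to it.

The map is surjective because every `τ` arises from a standard tableau by the moves `s_i` and `Ψ`.
On the other side the vectors `X^α ⊗ σ` span `V_λ`, and sorting the labels `(j, α_j)` turns the
pairs `(α, σ)` injectively into tableaux with `∑ α_j` as the sum of the exponents. As there are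
finitely many tableaux with a given sum of exponents, the map is injective in each degree.

The weights of the `θ_i` separate the tableaux, so a submodule contains every `F_τ` occurring in one
of its vectors; and tableaux with the same exponents are connected by the moves `s_i`. Hence each
`U_T` is irreducible.
-/

noncomputable section

namespace MackeyDAHA

/-! ## Combinatorics of periodic standard Young tableaux -/

theorem LabelLt.trans {n : ℕ} {x y z : Fin n × ℕ} (h₁ : LabelLt x y) (h₂ : LabelLt y z) :
    LabelLt x z := by
  simp only [LabelLt, Fin.lt_def] at *; omega

theorem LabelLt.irrefl {n : ℕ} (x : Fin n × ℕ) : ¬ LabelLt x x := by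
  simp only [LabelLt, Fin.lt_def]; omega

/-- Two labels with data `(exponent, content)` that cannot be exchanged. -/
def Adj (x y : ℕ × ℤ) : Prop := x.1 = y.1 ∧ |x.2 - y.2| ≤ 1

/-- Exchanging two labels with data `(exponent, content)` leads to a larger tableau. -/
def Up (x y : ℕ × ℤ) : Prop := x.1 < y.1 ∨ (x.1 = y.1 ∧ 1 < x.2 - y.2)

theorem Adj.symm {x y : ℕ × ℤ} (h : Adj x y) : Adj y x :=
  ⟨h.1.symm, by rw [abs_sub_comm]; exact h.2⟩

theorem Up.not_adj {x y : ℕ × ℤ} (h : Up x y) : ¬ Adj x y := by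
  rintro ⟨h1, h2⟩
  rw [abs_le] at h2
  rcases h with h | h <;> omega

theorem Up.asymm {x y : ℕ × ℤ} (h : Up x y) : ¬ Up y x := by
  simp only [Up] at *; omega

theorem up_or_up_of_not_adj {x y : ℕ × ℤ} (h : ¬ Adj x y) : Up x y ∨ Up y x := by
  simp only [Up, Adj, abs_le] at *
  omega

theorem lo_lt_hi {n : ℕ} (i : Fin (n - 1)) : (lo i : Fin n) < hi i :=
  Fin.lt_def.mpr (Nat.lt_succ_self _)

theorem lo_ne_hi {n : ℕ} (i : Fin (n - 1)) : (lo i : Fin n) ≠ hi i := (lo_lt_hi i).ne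

theorem LabelLt.swap {n : ℕ} {i : Fin (n - 1)} {x y : Fin n × ℕ} (h : LabelLt x y)
    (hne : x.1 = lo i → y.1 = hi i → x.2 ≠ y.2) :
    LabelLt (Equiv.swap (lo i) (hi i) x.1, x.2) (Equiv.swap (lo i) (hi i) y.1, y.2) := by
  obtain ⟨⟨x, hx⟩, a⟩ := x
  obtain ⟨⟨y, hy⟩, b⟩ := y
  simp only [LabelLt, Equiv.swap_apply_def, lo, hi, Fin.lt_def, Fin.mk.injEq] at *
  split_ifs <;> simp only <;> omega

section Box

variable {lam : YoungDiagram} {b b' : Box lam}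

theorem box_le_iff : b ≤ b' ↔ b.1.1 ≤ b'.1.1 ∧ b.1.2 ≤ b'.1.2 := Iff.rfl

theorem mem_cells_of_le (b : Box lam) {r c : ℕ} (hr : r ≤ b.1.1) (hc : c ≤ b.1.2) :
    (r, c) ∈ lam.cells :=
  lam.isLowerSet (Prod.mk_le_mk.mpr ⟨hr, hc⟩) b.2

theorem box_lt_iff : b < b' ↔ (b.1.1 ≤ b'.1.1 ∧ b.1.2 ≤ b'.1.2) ∧
    (b.1.1 < b'.1.1 ∨ b.1.2 < b'.1.2) := by
  rw [lt_iff_le_not_ge, box_le_iff, box_le_iff]; omega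

theorem box_covBy_iff : b ⋖ b' ↔ (b.1.1 + 1 = b'.1.1 ∧ b.1.2 = b'.1.2) ∨
    (b.1.2 + 1 = b'.1.2 ∧ b.1.1 = b'.1.1) := by
  have hconn : (Set.range (OrderEmbedding.subtype (· ∈ lam.cells))).OrdConnected := by
    convert lam.isLowerSet.ordConnected
    exact Subtype.range_coe
  rw [← hconn.apply_covBy_apply_iff]
  simp [Prod.covBy_iff, Order.covBy_iff_add_one_eq]

theorem le_total_of_content_eq (h : content b = content b') : b ≤ b' ∨ b' ≤ b := by
  simp only [content, box_le_iff] at *; omega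

end Box

namespace PSYT

variable {lam : YoungDiagram}

theorem toFun_box (τ : PSYT lam) (i : Fin lam.card) : τ.toFun (τ.box i) = (i, τ.w i) := by
  have h : (τ.toFun (τ.box i)).1 = i := (Equiv.ofBijective _ τ.bij).apply_symm_apply i
  exact Prod.ext h rfl

theorem box_fst (τ : PSYT lam) (b : Box lam) : τ.box (τ.toFun b).1 = b :=
  (Equiv.ofBijective _ τ.bij).symm_apply_apply b

theorem box_injective (τ : PSYT lam) : Function.Injective τ.box :=
  (Equiv.ofBijective _ τ.bij).symm.injective

/-- The exponent and the content of the label with number `i`; they determine its weight. -/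
def datum (τ : PSYT lam) (i : Fin lam.card) : ℕ × ℤ := (τ.w i, τ.c i)

theorem box_eq_of_toFun {τ : PSYT lam} {b : Box lam} {i : Fin lam.card} {m : ℕ}
    (h : τ.toFun b = (i, m)) : τ.box i = b := by
  have := τ.box_fst b
  rwa [h] at this

theorem w_eq_of_toFun {τ : PSYT lam} {b : Box lam} {i : Fin lam.card} {m : ℕ}
    (h : τ.toFun b = (i, m)) : τ.w i = m := by
  rw [w, box_eq_of_toFun h, h]

theorem datum_eq_of_toFun {τ : PSYT lam} {b : Box lam} {i : Fin lam.card} {m : ℕ}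
    (h : τ.toFun b = (i, m)) : τ.datum i = (m, content b) := by
  rw [datum, c, w_eq_of_toFun h, box_eq_of_toFun h]

theorem labelLt_of_lt (τ : PSYT lam) {b b' : Box lam} (h : b < b') :
    LabelLt (τ.toFun b) (τ.toFun b') := by
  obtain ⟨⟨hr, hc⟩, hne⟩ := And.intro (show b.1 ≤ b'.1 from h.le) h.ne
  rcases hr.eq_or_lt with hr | hr <;> rcases hc.eq_or_lt with hc | hc
  · exact absurd (Subtype.ext (Prod.ext hr hc)) hne
  · exact τ.mono _ _ (Or.inl ⟨hr, hc⟩)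
  · exact τ.mono _ _ (Or.inr ⟨hc, hr⟩)
  · let corner : Box lam := ⟨(b.1.1, b'.1.2), mem_cells_of_le b' hr.le le_rfl⟩
    exact (τ.mono b corner (Or.inl ⟨rfl, hc⟩)).trans (τ.mono corner b' (Or.inr ⟨rfl, hr⟩))

theorem labelLt_box_of_lt (τ : PSYT lam) {i j : Fin lam.card} (hw : τ.w i = τ.w j) (h : i < j) :
    LabelLt (τ.toFun (τ.box i)) (τ.toFun (τ.box j)) := by
  rw [toFun_box, toFun_box]; exact Or.inr ⟨hw, h⟩

theorem not_box_le_of_lt (τ : PSYT lam) {i j : Fin lam.card} (hw : τ.w i = τ.w j) (h : i < j) :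
    ¬ τ.box j ≤ τ.box i := fun hle =>
  LabelLt.irrefl _ <| (τ.labelLt_box_of_lt hw h).trans <|
    τ.labelLt_of_lt (hle.lt_of_ne (τ.box_injective.ne h.ne'))

theorem number_between (τ : PSYT lam) {i j : Fin lam.card} (hw : τ.w i = τ.w j) {b : Box lam}
    (hib : τ.box i < b) (hbj : b < τ.box j) : i < (τ.toFun b).1 ∧ (τ.toFun b).1 < j := by
  have h₁ := τ.labelLt_of_lt hib
  have h₂ := τ.labelLt_of_lt hbj
  rw [toFun_box] at h₁ h₂
  simp only [LabelLt, Fin.lt_def] at *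
  omega

theorem box_covBy_of_le (τ : PSYT lam) (i : Fin (lam.card - 1)) (hw : τ.w (lo i) = τ.w (hi i))
    (h : τ.box (lo i) ≤ τ.box (hi i)) : τ.box (lo i) ⋖ τ.box (hi i) := by
  refine ⟨h.lt_of_ne (τ.box_injective.ne (lo_ne_hi i)), fun b hb hb' => ?_⟩
  have := τ.number_between hw hb hb'
  simp only [Fin.lt_def, lo, hi] at this
  omega

theorem adj_iff (τ : PSYT lam) (i : Fin (lam.card - 1)) :
    Adj (τ.datum (lo i)) (τ.datum (hi i)) ↔
      τ.w (lo i) = τ.w (hi i) ∧ τ.box (lo i) ⋖ τ.box (hi i) := by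
  refine and_congr_right fun hw => ⟨fun hc => τ.box_covBy_of_le i hw ?_, fun hcov => ?_⟩
  · have hnot := τ.not_box_le_of_lt hw (lo_lt_hi i)
    simp only [datum, c, content, abs_le] at hc
    simp only [box_le_iff] at hnot ⊢
    omega
  · rw [box_covBy_iff] at hcov
    simp only [datum, c, content, abs_le]
    omega

/-- Two boxes with equal contents are two corners of a rectangle whose other two corners
carry further labels in between. -/
theorem datum_ne_of_lt_add_three (τ : PSYT lam) {i j : Fin lam.card} (hij : i < j)
    (hji : j.1 < i.1 + 3) : τ.datum i ≠ τ.datum j := by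
  intro h
  obtain ⟨hw, hc⟩ : τ.w i = τ.w j ∧ τ.c i = τ.c j := Prod.ext_iff.mp h
  have hnot := τ.not_box_le_of_lt hw hij
  have hbetween := fun b => τ.number_between (b := b) hw
  simp only [c, content] at hc
  rw [box_le_iff] at hnot
  generalize τ.box i = b at *
  generalize τ.box j = b' at *
  let right : Box lam := ⟨(b.1.1, b'.1.2), mem_cells_of_le b' (by omega) le_rfl⟩
  let below : Box lam := ⟨(b'.1.1, b.1.2), mem_cells_of_le b' le_rfl (by omega)⟩
  have hright := hbetween right (by simp only [box_lt_iff, right]; omega)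
    (by simp only [box_lt_iff, right]; omega)
  have hbelow := hbetween below (by simp only [box_lt_iff, below]; omega)
    (by simp only [box_lt_iff, below]; omega)
  have hne : (τ.toFun right).1.1 ≠ (τ.toFun below).1.1 := fun heq => by
    have hcorner : right = below := τ.bij.1 (Fin.ext heq)
    have : right.1.1 = below.1.1 := by rw [hcorner]
    simp only [right, below] at this
    omega
  simp only [Fin.lt_def] at hright hbelow hij
  omega

open Classical in
/-- `s_i(τ)` if it is defined, and `τ` otherwise. -/
def swap (i : Fin (lam.card - 1)) (τ : PSYT lam) : PSYT lam :=
  if h : Adj (τ.datum (lo i)) (τ.datum (hi i)) then τ else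
  { toFun := fun b => (Equiv.swap (lo i) (hi i) (τ.toFun b).1, (τ.toFun b).2)
    bij := (Equiv.swap (lo i) (hi i)).bijective.comp τ.bij
    mono := fun b b' hb => by
      refine (τ.mono b b' hb).swap fun hlo hhi hw => h ((τ.adj_iff i).mpr ?_)
      obtain rfl : τ.box (lo i) = b := by rw [← hlo, box_fst]
      obtain rfl : τ.box (hi i) = b' := by rw [← hhi, box_fst]
      refine ⟨hw, τ.box_covBy_of_le i hw (box_le_iff.mpr ?_)⟩
      rcases hb with hb | hb <;> omega }

theorem swap_of_adj {i : Fin (lam.card - 1)} {τ : PSYT lam}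
    (h : Adj (τ.datum (lo i)) (τ.datum (hi i))) : swap i τ = τ := by rw [swap, dif_pos h]

theorem toFun_swap {i : Fin (lam.card - 1)} {τ : PSYT lam}
    (h : ¬ Adj (τ.datum (lo i)) (τ.datum (hi i))) (b : Box lam) :
    (swap i τ).toFun b = (Equiv.swap (lo i) (hi i) (τ.toFun b).1, (τ.toFun b).2) := by
  rw [swap, dif_neg h]

theorem datum_swap {i : Fin (lam.card - 1)} {τ : PSYT lam}
    (h : ¬ Adj (τ.datum (lo i)) (τ.datum (hi i))) :
    (swap i τ).datum = τ.datum ∘ Equiv.swap (lo i) (hi i) := by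
  funext j
  have := toFun_swap h (τ.box (Equiv.swap (lo i) (hi i) j))
  rw [toFun_box, Equiv.swap_apply_self] at this
  exact datum_eq_of_toFun this

theorem swap_swap (i : Fin (lam.card - 1)) (τ : PSYT lam) : swap i (swap i τ) = τ := by
  by_cases h : Adj (τ.datum (lo i)) (τ.datum (hi i))
  · rw [swap_of_adj h, swap_of_adj h]
  · have h' : ¬ Adj ((swap i τ).datum (lo i)) ((swap i τ).datum (hi i)) := by
      rw [datum_swap h]
      simpa using fun h' => h (Adj.symm h')
    ext1
    funext b
    rw [toFun_swap h', toFun_swap h]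
    simp

theorem eq_swap_of_isSwap {i : Fin (lam.card - 1)} {τ τ' : PSYT lam} (h : IsSwap i τ τ')
    (hn : ¬ Adj (τ.datum (lo i)) (τ.datum (hi i))) : τ' = swap i τ := by
  ext1
  funext b
  rw [h b, toFun_swap hn]

theorem swapUp_iff {i : Fin (lam.card - 1)} {τ τ' : PSYT lam} :
    SwapUp i τ τ' ↔ Up (τ.datum (lo i)) (τ.datum (hi i)) ∧ τ' = swap i τ := by
  constructor
  · intro h
    have hu : Up (τ.datum (lo i)) (τ.datum (hi i)) := h.2
    exact ⟨hu, eq_swap_of_isSwap h.1 hu.not_adj⟩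
  · rintro ⟨hu, rfl⟩
    exact ⟨toFun_swap hu.not_adj, hu⟩

theorem toRYT_swap (i : Fin (lam.card - 1)) (τ : PSYT lam) : (swap i τ).toRYT = τ.toRYT := by
  by_cases h : Adj (τ.datum (lo i)) (τ.datum (hi i))
  · rw [swap_of_adj h]
  · ext b
    simp [toRYT, toFun_swap h]

theorem datum_psi_of_lt (τ : PSYT lam) {i : Fin lam.card} (h : i.1 + 1 < lam.card) :
    τ.psi.datum i = τ.datum ⟨i.1 + 1, h⟩ := by
  have : τ.psi.toFun (τ.box ⟨i.1 + 1, h⟩) = (i, τ.w ⟨i.1 + 1, h⟩) := by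
    change psiLabel _ = _
    rw [toFun_box]; simp [psiLabel]
  exact datum_eq_of_toFun this

theorem datum_psi_last (τ : PSYT lam) {i : Fin lam.card} (h : ¬ i.1 + 1 < lam.card) :
    τ.psi.datum i = ((τ.datum ⟨0, i.pos⟩).1 + 1, (τ.datum ⟨0, i.pos⟩).2) := by
  have : τ.psi.toFun (τ.box ⟨0, i.pos⟩) = (i, τ.w ⟨0, i.pos⟩ + 1) := by
    change psiLabel _ = _
    rw [toFun_box]
    simp only [psiLabel, if_true, Prod.mk.injEq, and_true]
    exact Fin.ext (by have := i.2; simp only; omega)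
  exact datum_eq_of_toFun this

theorem not_box_lt_of_forall_labelLt {τ τ' : PSYT lam} (hw : τ.w = τ'.w) {i : Fin lam.card}
    (ih : ∀ j, LabelLt (j, τ.w j) (i, τ.w i) → τ.box j = τ'.box j) :
    ¬ τ.box i < τ'.box i := fun hlt => by
  obtain ⟨j, hj⟩ : ∃ j, τ'.box j = τ.box i := ⟨_, τ'.box_fst _⟩
  have hji : LabelLt (j, τ.w j) (i, τ.w i) := by
    have := τ'.labelLt_of_lt (hj ▸ hlt)
    rwa [toFun_box, toFun_box, ← hw] at this
  obtain rfl : j = i := τ.box_injective ((ih j hji).trans hj)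
  exact LabelLt.irrefl _ hji

theorem ext_of_box_eq {τ τ' : PSYT lam} (hw : τ.w = τ'.w) (hbox : τ.box = τ'.box) : τ = τ' := by
  ext1
  funext b
  obtain ⟨i, rfl⟩ : ∃ i, τ.box i = b := ⟨_, τ.box_fst b⟩
  rw [toFun_box, hbox, toFun_box, hw]

/-- Boxes of equal content are comparable, so if `τ` and `τ'` have the same data and agree on all
labels below that of `i`, then neither can place `i` strictly before the other. -/
theorem datum_injective : Function.Injective (datum (lam := lam)) := by
  intro τ τ' h
  have hw : τ.w = τ'.w := funext fun i => congrArg Prod.fst (congrFun h i)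
  have hc : τ.c = τ'.c := funext fun i => congrArg Prod.snd (congrFun h i)
  let R (i j : Fin lam.card) : Prop := LabelLt (i, τ.w i) (j, τ.w j)
  have : IsTrans _ R := ⟨fun _ _ _ => LabelLt.trans⟩
  have : Std.Irrefl R := ⟨fun _ => LabelLt.irrefl _⟩
  refine ext_of_box_eq hw (funext fun i => ?_)
  induction i using (Finite.wellFounded_of_trans_of_irrefl R).induction with
  | _ i ih =>
    rcases le_total_of_content_eq (congrFun hc i) with hle | hle
    · exact hle.eq_of_not_lt (not_box_lt_of_forall_labelLt hw ih)
    · exact (hle.eq_of_not_lt (not_box_lt_of_forall_labelLt hw.symm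
        fun j hj => (ih j (by rwa [← hw] at hj)).symm)).symm

/-- The sum of all exponents. -/
def deg (τ : PSYT lam) : ℕ := ∑ b, (τ.toFun b).2

theorem deg_swap (i : Fin (lam.card - 1)) (τ : PSYT lam) : (swap i τ).deg = τ.deg :=
  congrArg (fun T : RYT lam => ∑ b, T.toFun b) (toRYT_swap i τ)

theorem toRYT_psi_apply (τ : PSYT lam) (h : 0 < lam.card) (b : Box lam) :
    τ.psi.toRYT.toFun b = τ.toRYT.toFun b + if b = τ.box ⟨0, h⟩ then 1 else 0 := by
  have hb : b = τ.box ⟨0, h⟩ ↔ (τ.toFun b).1.1 = 0 := by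
    refine ⟨?_, fun h0 => ?_⟩
    · rintro rfl; rw [toFun_box]
    · rw [← τ.box_fst b]
      exact congrArg _ (Fin.ext h0)
  change (psiLabel _).2 = (τ.toFun b).2 + _
  simp only [hb, psiLabel]
  split_ifs <;> rfl

theorem deg_psi (τ : PSYT lam) (h : 0 < lam.card) : τ.psi.deg = τ.deg + 1 := by
  change ∑ b, τ.psi.toRYT.toFun b = ∑ b, τ.toRYT.toFun b + 1
  simp only [toRYT_psi_apply τ h, Finset.sum_add_distrib, Finset.sum_ite_eq', Finset.mem_univ,
    if_true]

theorem deg_toPSYT (τ : SYT lam) : τ.toPSYT.deg = 0 := by simp [deg, SYT.toPSYT]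

theorem exists_toPSYT_eq {τ : PSYT lam} (h : τ.deg = 0) : ∃ σ : SYT lam, σ.toPSYT = τ := by
  have hexp : ∀ b, (τ.toFun b).2 = 0 := by
    simpa [deg, Finset.sum_eq_zero_iff] using h
  refine ⟨⟨fun b => (τ.toFun b).1, τ.bij, fun b b' hb => ?_⟩, ?_⟩
  · simpa only [LabelLt, hexp, lt_irrefl, true_and, false_or] using τ.mono b b' hb
  · ext1
    funext b
    exact Prod.ext rfl (hexp b).symm

theorem exists_w_pos {τ : PSYT lam} (h : 0 < τ.deg) : ∃ i, 0 < τ.w i := by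
  obtain ⟨b, -, hb⟩ := Finset.exists_ne_zero_of_sum_ne_zero h.ne'
  exact ⟨(τ.toFun b).1, by rw [w, box_fst]; exact Nat.pos_of_ne_zero hb⟩

/-- The inverse of the effect of `Ψ` on labels; the exponent of the last number must be positive
for the truncated subtraction to be meaningful. -/
def psiInvLabel {n : ℕ} (x : Fin n × ℕ) : Fin n × ℕ :=
  if h : x.1.1 + 1 < n then (⟨x.1.1 + 1, h⟩, x.2) else (⟨0, x.1.pos⟩, x.2 - 1)

theorem psiLabel_psiInvLabel {n : ℕ} {x : Fin n × ℕ} (hx : x.1.1 + 1 < n ∨ 0 < x.2) :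
    psiLabel (psiInvLabel x) = x := by
  obtain ⟨⟨k, hk⟩, m⟩ := x
  by_cases h : k + 1 < n
  · simp [psiLabel, psiInvLabel, h]
  · simp only [psiLabel, psiInvLabel, h, dite_false, if_true, Prod.mk.injEq, Fin.mk.injEq] at hx ⊢
    simp only [false_or] at hx
    omega

theorem fst_eq_of_psiInvLabel {n : ℕ} {x y : Fin n × ℕ}
    (h : (psiInvLabel x).1 = (psiInvLabel y).1) : x.1 = y.1 := by
  obtain ⟨⟨k, hk⟩, m⟩ := x
  obtain ⟨⟨l, hl⟩, m'⟩ := y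
  simp only [psiInvLabel] at h
  split_ifs at h <;> simp only [Fin.mk.injEq] at h ⊢ <;> omega

theorem psiInvLabel_labelLt {n : ℕ} {x y : Fin n × ℕ} (h : LabelLt x y) (hne : x.1 ≠ y.1)
    (hx : x.1.1 + 1 < n ∨ 0 < x.2) (hy : y.1.1 + 1 < n ∨ 0 < y.2) :
    LabelLt (psiInvLabel x) (psiInvLabel y) := by
  obtain ⟨⟨k, hk⟩, m⟩ := x
  obtain ⟨⟨l, hl⟩, m'⟩ := y
  simp only [LabelLt, psiInvLabel, Fin.lt_def, ne_eq, Fin.mk.injEq] at *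
  split_ifs <;> simp only <;> omega

theorem exists_psi_eq (τ : PSYT lam) {i : Fin lam.card} (hi : lam.card ≤ i.1 + 1)
    (hw : 0 < τ.w i) : ∃ σ : PSYT lam, σ.psi = τ := by
  have hpos : ∀ b, (τ.toFun b).1.1 + 1 < lam.card ∨ 0 < (τ.toFun b).2 := by
    refine fun b => or_iff_not_imp_left.mpr fun hb => ?_
    have hbi : (τ.toFun b).1 = i := Fin.ext (by have := (τ.toFun b).1.2; have := i.2; omega)
    rwa [w, ← hbi, box_fst] at hw
  have hinj : Function.Injective fun b => (psiInvLabel (τ.toFun b)).1 := fun _ _ h =>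
    τ.bij.1 (fst_eq_of_psiInvLabel h)
  let σ : PSYT lam :=
    { toFun := fun b => psiInvLabel (τ.toFun b)
      bij := (Fintype.bijective_iff_injective_and_card _).mpr
        ⟨hinj, Fintype.card_of_bijective τ.bij⟩
      mono := fun b b' hb => by
        refine psiInvLabel_labelLt (τ.mono b b' hb) (τ.bij.1.ne ?_) (hpos b) (hpos b')
        rintro rfl
        rcases hb with hb | hb <;> omega }
  refine ⟨σ, PSYT.ext (funext fun b => ?_)⟩
  exact psiLabel_psiInvLabel (hpos b)

theorem of_deg_eq_succ {P : PSYT lam → Prop} {N : ℕ} (hswap : ∀ i τ, P τ → P (swap i τ))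
    (hpsi : ∀ τ : PSYT lam, τ.deg = N → P τ.psi) {τ : PSYT lam} (hτ : τ.deg = N + 1) : P τ := by
  obtain ⟨i, hw⟩ := exists_w_pos (hτ.symm ▸ N.succ_pos : 0 < τ.deg)
  obtain ⟨k, hk⟩ := Nat.exists_eq_add_of_le i.2
  induction k generalizing τ i with
  | zero =>
    obtain ⟨σ, rfl⟩ := τ.exists_psi_eq hk.le hw
    rw [deg_psi _ i.pos] at hτ
    exact hpsi σ (Nat.succ_injective hτ)
  | succ k ih =>
    let j : Fin (lam.card - 1) := ⟨i.1, by omega⟩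
    have hk' : lam.card = (hi j : Fin lam.card).1.succ + k := by simp only [hi, j]; omega
    by_cases hw' : 0 < τ.w (hi j)
    · exact ih hτ (hi j) hw' hk'
    · have hnot : ¬ Adj (τ.datum (lo j)) (τ.datum (hi j)) := fun h =>
        hw' (hw.trans_eq h.1)
      have hwswap : (swap j τ).w (hi j) = τ.w i := by
        have := congrArg Prod.fst (congrFun (datum_swap hnot) (hi j))
        rwa [Function.comp_apply, Equiv.swap_apply_right] at this
      rw [← swap_swap j τ]
      exact hswap j _ (ih ((deg_swap j τ).trans hτ) (hi j) (hwswap ▸ hw) hk')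

theorem induction_swap_psi {P : PSYT lam → Prop} (hSYT : ∀ σ : SYT lam, P σ.toPSYT)
    (hswap : ∀ i τ, P τ → P (swap i τ)) (hpsi : ∀ τ, P τ → P τ.psi) (τ : PSYT lam) : P τ := by
  induction hN : τ.deg generalizing τ with
  | zero =>
    obtain ⟨σ, rfl⟩ := exists_toPSYT_eq hN
    exact hSYT σ
  | succ N ih => exact of_deg_eq_succ hswap (fun σ hσ => hpsi σ (ih σ hσ)) hN

/-- The pairs of boxes that `τ` and `τ'` number in opposite orders. The number of such pairs
measures how far `τ` is from `τ'`. -/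
def inversions (τ τ' : PSYT lam) : Finset (Box lam × Box lam) :=
  {p | (τ.toFun p.1).1 < (τ.toFun p.2).1 ∧ (τ'.toFun p.2).1 < (τ'.toFun p.1).1}

theorem mem_inversions {τ τ' : PSYT lam} {p : Box lam × Box lam} : p ∈ inversions τ τ' ↔
    (τ.toFun p.1).1 < (τ.toFun p.2).1 ∧ (τ'.toFun p.2).1 < (τ'.toFun p.1).1 := by
  simp [inversions]

theorem lt_of_swap_lt_swap {n : ℕ} {i : Fin (n - 1)} {x y : Fin n}
    (h : Equiv.swap (lo i) (hi i) x < Equiv.swap (lo i) (hi i) y)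
    (hne : ¬ (x = hi i ∧ y = lo i)) : x < y := by
  obtain ⟨x, hx⟩ := x
  obtain ⟨y, hy⟩ := y
  simp only [Equiv.swap_apply_def, lo, hi, Fin.lt_def, Fin.mk.injEq] at *
  split_ifs at h <;> simp only at h <;> omega

theorem inversions_swap_ssubset {i : Fin (lam.card - 1)} {τ τ' : PSYT lam}
    (hnot : ¬ Adj (τ.datum (lo i)) (τ.datum (hi i)))
    (hdesc : (τ'.toFun (τ.box (hi i))).1 < (τ'.toFun (τ.box (lo i))).1) :
    inversions (swap i τ) τ' ⊂ inversions τ τ' := by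
  refine (Finset.ssubset_iff_of_subset fun p hp => ?_).mpr ⟨(τ.box (lo i), τ.box (hi i)), ?_, ?_⟩
  · rw [mem_inversions, toFun_swap hnot, toFun_swap hnot] at hp
    refine mem_inversions.mpr ⟨lt_of_swap_lt_swap hp.1 fun ⟨hhi, hlo⟩ => hdesc.not_gt ?_, hp.2⟩
    rw [← hhi, ← hlo, box_fst, box_fst]
    exact hp.2
  · rw [mem_inversions, toFun_box, toFun_box]
    exact ⟨lo_lt_hi i, hdesc⟩
  · rw [mem_inversions, toFun_swap hnot, toFun_swap hnot, toFun_box, toFun_box,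
      Equiv.swap_apply_left, Equiv.swap_apply_right]
    exact fun h => h.1.not_gt (lo_lt_hi i)

theorem strictMono_of_lo_lt_hi {n : ℕ} {α : Type*} [Preorder α] {f : Fin n → α}
    (h : ∀ i : Fin (n - 1), f (lo i) < f (hi i)) : StrictMono f := by
  cases n with
  | zero => exact fun i => i.elim0
  | succ n => exact Fin.strictMono_iff_lt_succ.mpr h

section SameExponents

variable {τ τ' : PSYT lam} (hτ : τ.toRYT = τ'.toRYT)

include hτ

theorem snd_toFun_eq_of_toRYT_eq (b : Box lam) : (τ.toFun b).2 = (τ'.toFun b).2 :=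
  congrFun (congrArg RYT.toFun hτ) b

theorem not_adj_of_descent {i : Fin (lam.card - 1)}
    (hdesc : (τ'.toFun (τ.box (hi i))).1 < (τ'.toFun (τ.box (lo i))).1) :
    ¬ Adj (τ.datum (lo i)) (τ.datum (hi i)) := by
  rw [adj_iff]
  rintro ⟨hw, hcov⟩
  have hlt := τ'.labelLt_of_lt hcov.lt
  rw [w, w, snd_toFun_eq_of_toRYT_eq hτ, snd_toFun_eq_of_toRYT_eq hτ] at hw
  simp only [LabelLt, hw, lt_irrefl, false_or, true_and] at hlt
  exact hlt.not_gt hdesc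

theorem eq_of_forall_not_descent
    (hasc : ∀ i, (τ'.toFun (τ.box (lo i))).1 ≤ (τ'.toFun (τ.box (hi i))).1) : τ = τ' := by
  let f (i : Fin lam.card) : Fin lam.card := (τ'.toFun (τ.box i)).1
  have hbij : Function.Bijective f :=
    τ'.bij.comp (Equiv.ofBijective _ τ.bij).symm.bijective
  have hmono : StrictMono f := strictMono_of_lo_lt_hi fun i =>
    (hasc i).lt_of_ne (hbij.1.ne (lo_ne_hi i))
  have hid : f = id := (hmono.range_inj strictMono_id).mp (by
    rw [hbij.2.range_eq, Set.range_id])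
  refine PSYT.ext (funext fun b => Prod.ext ?_ (snd_toFun_eq_of_toRYT_eq hτ b))
  have := congrFun hid (τ.toFun b).1
  simp only [f, box_fst, id] at this
  exact this.symm

theorem induction_swap {P : PSYT lam → Prop} (hswap : ∀ i τ, P τ → P (swap i τ)) (h : P τ) :
    P τ' := by
  induction hN : (inversions τ τ').card using Nat.strong_induction_on generalizing τ with
  | _ N ih =>
    subst hN
    by_cases hdesc : ∃ i, (τ'.toFun (τ.box (hi i))).1 < (τ'.toFun (τ.box (lo i))).1
    · obtain ⟨i, hi'⟩ := hdesc
      exact ih _ (Finset.card_lt_card (inversions_swap_ssubset (not_adj_of_descent hτ hi') hi'))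
        ((toRYT_swap i τ).trans hτ) (hswap i τ h) rfl
    · push Not at hdesc
      exact eq_of_forall_not_descent hτ hdesc ▸ h

end SameExponents

/-- The permutation that sorts the labels `(j, α j)` increasingly. -/
def sortPerm {n : ℕ} (α : Fin n → ℕ) : Equiv.Perm (Fin n) :=
  Tuple.sort fun j => toLex (OrderDual.toDual (α j), j)

theorem sortPerm_labelLt {n : ℕ} (α : Fin n → ℕ) {r s : Fin n} (h : r < s) :
    LabelLt (sortPerm α r, α (sortPerm α r)) (sortPerm α s, α (sortPerm α s)) := by
  have hle : toLex (OrderDual.toDual (α (sortPerm α r)), sortPerm α r) ≤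
      toLex (OrderDual.toDual (α (sortPerm α s)), sortPerm α s) :=
    Tuple.monotone_sort (fun j => toLex (OrderDual.toDual (α j), j)) h.le
  rw [Prod.Lex.toLex_le_toLex] at hle
  exact hle.imp_right fun h' => ⟨h'.1, h'.2.lt_of_ne ((sortPerm α).injective.ne h.ne)⟩

/-- The tableau with given exponents of the numbers whose standardization is a given standard
tableau. -/
def ofExponents (p : (Fin lam.card → ℕ) × SYT lam) : PSYT lam where
  toFun b := (sortPerm p.1 (p.2.toFun b), p.1 (sortPerm p.1 (p.2.toFun b)))
  bij := (sortPerm p.1).bijective.comp p.2.bij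
  mono b b' h := sortPerm_labelLt p.1 (p.2.mono b b' h)

theorem ofExponents_injective : Function.Injective (ofExponents (lam := lam)) := by
  rintro ⟨α, σ⟩ ⟨β, ρ⟩ h
  have hlabel : ∀ b, (ofExponents (α, σ)).toFun b = (ofExponents (β, ρ)).toFun b :=
    congrFun (congrArg toFun h)
  obtain rfl : α = β := by
    funext j
    obtain ⟨b, rfl⟩ := (ofExponents (α, σ)).bij.2 j
    have hexp := congrArg Prod.snd (hlabel b)
    simp only [ofExponents] at hexp ⊢
    rw [hexp]
    exact congrArg β (congrArg Prod.fst (hlabel b)).symm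
  congr 1
  ext1
  funext b
  exact (sortPerm α).injective (congrArg Prod.fst (hlabel b))

theorem deg_ofExponents (p : (Fin lam.card → ℕ) × SYT lam) :
    (ofExponents p).deg = ∑ i, p.1 i :=
  (Equiv.ofBijective _ (ofExponents p).bij).sum_comp p.1

theorem finite_deg (N : ℕ) : {τ : PSYT lam | τ.deg = N}.Finite := by
  refine .of_finite_image (f := toFun) ?_ fun τ _ τ' _ h => PSYT.ext h
  refine (Set.Finite.pi fun _ : Box lam => Set.finite_univ.prod (Set.finite_Iic N)).subset ?_
  rintro _ ⟨τ, hτ, rfl⟩ b -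
  have hle : (τ.toFun b).2 ≤ τ.deg :=
    Finset.single_le_sum (f := fun b => (τ.toFun b).2) (fun _ _ => Nat.zero_le _)
      (Finset.mem_univ b)
  exact ⟨trivial, hle.trans hτ.le⟩

end PSYT

/-! ## Scalars -/

theorem q_ne_zero : q ≠ 0 := by
  unfold q
  rw [Ne, IsFractionRing.to_map_eq_zero_iff]
  exact MvPolynomial.X_ne_zero 0

/-- The weight `q^w t^c` attached to the pair `(w, c)`. -/
def wt (x : ℕ × ℤ) : Kqt := q ^ x.1 * t ^ x.2

theorem wt_ne_zero (x : ℕ × ℤ) : wt x ≠ 0 :=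
  mul_ne_zero (pow_ne_zero _ q_ne_zero) (zpow_ne_zero _ t_ne_zero)

theorem q_pow_mul_t_pow_injective {a b m n : ℕ} (h : q ^ a * t ^ m = q ^ b * t ^ n) :
    a = b ∧ m = n := by
  have hpoly : (.X 0 ^ a * .X 1 ^ m : MvPolynomial (Fin 2) ℚ) = .X 0 ^ b * .X 1 ^ n := by
    apply IsFractionRing.injective (MvPolynomial (Fin 2) ℚ) Kqt
    rwa [map_mul, map_mul, map_pow, map_pow, map_pow, map_pow]
  simp only [MvPolynomial.X_pow_eq_monomial, MvPolynomial.monomial_mul, mul_one] at hpoly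
  have hexp := MvPolynomial.monomial_left_injective one_ne_zero hpoly
  exact ⟨by simpa using DFunLike.congr_fun hexp 0, by simpa using DFunLike.congr_fun hexp 1⟩

theorem wt_injective : Function.Injective wt := by
  rintro ⟨a, m⟩ ⟨b, n⟩ h
  simp only [wt] at h
  have hshift : q ^ a * t ^ (m + (|m| + |n|)).toNat = q ^ b * t ^ (n + (|m| + |n|)).toNat := by
    rw [← zpow_natCast t, ← zpow_natCast t,
      Int.toNat_of_nonneg (by linarith [neg_abs_le m, abs_nonneg n]),
      Int.toNat_of_nonneg (by linarith [neg_abs_le n, abs_nonneg m]),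
      zpow_add₀ t_ne_zero m, zpow_add₀ t_ne_zero n, ← mul_assoc, ← mul_assoc, h]
  obtain ⟨hab, hmn⟩ := q_pow_mul_t_pow_injective hshift
  have := neg_abs_le m
  have := neg_abs_le n
  have := abs_nonneg m
  have := abs_nonneg n
  exact Prod.ext hab (by simp only; omega)

theorem wt_sub_ne_zero {x y : ℕ × ℤ} (h : x ≠ y) : wt x - wt y ≠ 0 :=
  sub_ne_zero.mpr fun e => h (wt_injective e)

/-- The coefficient `(t - 1) b / (a - b)` occurring in the relation between `F_τ` and `F_{s_i τ}`,
for the weights `a` and `b` of the numbers `i` and `i + 1` in `τ`. -/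
def diagCoeff (x y : ℕ × ℤ) : Kqt := (t - 1) * wt y / (wt x - wt y)

/-- The scalar by which the square of the intertwiner `t T_i⁻¹ + diagCoeff` acts on a vector with
weights `x` and `y` at `i` and `i + 1`. -/
def intertwinerSq (x y : ℕ × ℤ) : Kqt :=
  (t * wt x - wt y) * (wt x - t * wt y) / (wt x - wt y) ^ 2

/-- The coefficient of `F_{s_i τ}` in the image of `F_τ` under the intertwiner: by the normalization
of the basis it is `1` when `s_i τ > τ`, and hence the scalar `intertwinerSq` when `s_i τ < τ`. -/
def swapCoeff (x y : ℕ × ℤ) : Kqt :=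
  open Classical in if Up x y then 1 else intertwinerSq x y

theorem diagCoeff_add_diagCoeff {x y : ℕ × ℤ} (h : x ≠ y) :
    diagCoeff x y + diagCoeff y x = -(t - 1) := by
  have := wt_sub_ne_zero h
  have := wt_sub_ne_zero h.symm
  simp only [diagCoeff]
  field_simp
  ring

theorem intertwinerSq_eq {x y : ℕ × ℤ} (h : x ≠ y) :
    intertwinerSq x y = t + diagCoeff x y * diagCoeff y x := by
  have := wt_sub_ne_zero h
  have := wt_sub_ne_zero h.symm
  simp only [diagCoeff, intertwinerSq]
  field_simp
  ring

theorem intertwinerSq_comm (x y : ℕ × ℤ) : intertwinerSq x y = intertwinerSq y x := by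
  simp only [intertwinerSq]
  rw [← neg_sub (wt x) (wt y), neg_sq]
  ring

theorem diagCoeff_mul_wt {x y : ℕ × ℤ} (h : x ≠ y) :
    diagCoeff x y * wt x + diagCoeff y x * wt y = 0 := by
  have := wt_sub_ne_zero h
  have := wt_sub_ne_zero h.symm
  simp only [diagCoeff]
  field_simp
  ring

theorem diagCoeff_braid_left {x y z : ℕ × ℤ} (hxy : x ≠ y) (hyz : y ≠ z) (hxz : x ≠ z) :
    diagCoeff x y * diagCoeff y z + diagCoeff x z * diagCoeff y x =
      diagCoeff y z * diagCoeff x z := by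
  have := wt_sub_ne_zero hxy
  have := wt_sub_ne_zero hxy.symm
  have := wt_sub_ne_zero hyz
  have := wt_sub_ne_zero hxz
  simp only [diagCoeff]
  field_simp
  ring

theorem diagCoeff_braid_right {x y z : ℕ × ℤ} (hxy : x ≠ y) (hyz : y ≠ z) (hxz : x ≠ z) :
    diagCoeff x y * diagCoeff x z =
      diagCoeff y z * diagCoeff x y + diagCoeff x z * diagCoeff z y := by
  have := wt_sub_ne_zero hxy
  have := wt_sub_ne_zero hyz
  have := wt_sub_ne_zero hyz.symm
  have := wt_sub_ne_zero hxz
  simp only [diagCoeff]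
  field_simp
  ring

theorem diagCoeff_braid {x y z : ℕ × ℤ} (hxy : x ≠ y) (hyz : y ≠ z) (hxz : x ≠ z) :
    diagCoeff x y * diagCoeff y z * diagCoeff x y + diagCoeff x z * intertwinerSq x y =
      diagCoeff y z * diagCoeff x y * diagCoeff y z + diagCoeff x z * intertwinerSq y z := by
  rw [intertwinerSq_eq hxy, intertwinerSq_eq hyz]
  linear_combination diagCoeff x y * diagCoeff_braid_left hxy hyz hxz +
    diagCoeff y z * diagCoeff_braid_right hxy hyz hxz

theorem ne_of_not_adj {x y : ℕ × ℤ} (h : ¬ Adj x y) : x ≠ y := by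
  rintro rfl
  exact h (by simp [Adj])

theorem t_mul_wt (x : ℕ × ℤ) : t * wt x = wt (x.1, x.2 + 1) := by
  simp only [wt, zpow_add_one₀ t_ne_zero]
  ring

theorem t_mul_wt_sub_wt_ne_zero {x y : ℕ × ℤ} (h : ¬ Adj x y) : t * wt x - wt y ≠ 0 := by
  rw [t_mul_wt]
  refine wt_sub_ne_zero ?_
  rintro rfl
  exact h (by simp [Adj])

theorem intertwinerSq_ne_zero {x y : ℕ × ℤ} (h : ¬ Adj x y) : intertwinerSq x y ≠ 0 := by
  refine div_ne_zero (mul_ne_zero (t_mul_wt_sub_wt_ne_zero h) ?_)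
    (pow_ne_zero _ (wt_sub_ne_zero (ne_of_not_adj h)))
  rw [← neg_sub]
  exact neg_ne_zero.mpr (t_mul_wt_sub_wt_ne_zero fun h' => h h'.symm)

theorem intertwinerSq_of_adj {x y : ℕ × ℤ} (h : Adj x y) (hne : x ≠ y) :
    intertwinerSq x y = 0 := by
  obtain ⟨a, m⟩ := x
  obtain ⟨b, n⟩ := y
  obtain ⟨rfl, hc⟩ : a = b ∧ |m - n| ≤ 1 := h
  have hmn : m ≠ n := fun hmn => hne (by rw [hmn])
  rw [abs_le] at hc
  rw [intertwinerSq, t_mul_wt, t_mul_wt, div_eq_zero_iff, mul_eq_zero, sub_eq_zero, sub_eq_zero]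
  obtain rfl | rfl : n = m + 1 ∨ m = n + 1 := by omega
  exacts [Or.inl (Or.inl rfl), Or.inl (Or.inr rfl)]

theorem swapCoeff_of_up {x y : ℕ × ℤ} (h : Up x y) : swapCoeff x y = 1 := if_pos h

theorem swapCoeff_of_not_up {x y : ℕ × ℤ} (h : ¬ Up x y) : swapCoeff x y = intertwinerSq x y :=
  if_neg h

theorem swapCoeff_of_adj {x y : ℕ × ℤ} (h : Adj x y) (hne : x ≠ y) : swapCoeff x y = 0 := by
  rw [swapCoeff_of_not_up fun h' => h'.not_adj h, intertwinerSq_of_adj h hne]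

theorem swapCoeff_ne_zero {x y : ℕ × ℤ} (h : ¬ Adj x y) : swapCoeff x y ≠ 0 := by
  by_cases hu : Up x y
  · rw [swapCoeff_of_up hu]; exact one_ne_zero
  · rw [swapCoeff_of_not_up hu]; exact intertwinerSq_ne_zero h

theorem swapCoeff_mul_swapCoeff {x y : ℕ × ℤ} (hne : x ≠ y) :
    swapCoeff x y * swapCoeff y x = intertwinerSq x y := by
  by_cases h : Adj x y
  · rw [swapCoeff_of_adj h hne, intertwinerSq_of_adj h hne, zero_mul]
  · rcases up_or_up_of_not_adj h with hu | hu
    · rw [swapCoeff_of_up hu, swapCoeff_of_not_up hu.asymm, one_mul, intertwinerSq_comm]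
    · rw [swapCoeff_of_up hu, swapCoeff_of_not_up hu.asymm, mul_one]

/-- The effect of multiplying a weight by `q`. -/
def qShift (x : ℕ × ℤ) : ℕ × ℤ := (x.1 + 1, x.2)

theorem wt_qShift (x : ℕ × ℤ) : wt (qShift x) = q * wt x := by
  simp only [wt, qShift, pow_succ]; ring

theorem diagCoeff_qShift (x y : ℕ × ℤ) : diagCoeff (qShift x) (qShift y) = diagCoeff x y := by
  simp only [diagCoeff, wt_qShift]
  rw [← mul_sub, mul_left_comm, mul_div_mul_left _ _ q_ne_zero]

theorem intertwinerSq_qShift (x y : ℕ × ℤ) :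
    intertwinerSq (qShift x) (qShift y) = intertwinerSq x y := by
  simp only [intertwinerSq, wt_qShift]
  rw [← mul_div_mul_left ((t * wt x - wt y) * (wt x - t * wt y)) _ (pow_ne_zero 2 q_ne_zero)]
  congr 1 <;> ring

theorem up_qShift (x y : ℕ × ℤ) : Up (qShift x) (qShift y) ↔ Up x y := by
  simp [Up, qShift]

theorem swapCoeff_qShift (x y : ℕ × ℤ) : swapCoeff (qShift x) (qShift y) = swapCoeff x y := by
  by_cases h : Up x y
  · rw [swapCoeff_of_up h, swapCoeff_of_up ((up_qShift x y).mpr h)]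
  · rw [swapCoeff_of_not_up h, swapCoeff_of_not_up (mt (up_qShift x y).mp h), intertwinerSq_qShift]

/-! ## A model of the induced module -/

/-- The datum `i ↦ (exponent, content)` of `Ψ(τ)` in terms of that of `τ`. -/
def psiDatum {n : ℕ} (x : Fin n → ℕ × ℤ) (i : Fin n) : ℕ × ℤ :=
  if h : i.1 + 1 < n then x ⟨i.1 + 1, h⟩ else qShift (x ⟨0, i.pos⟩)

/-- The exponent of the number `1`, and `0` for the empty diagram. -/
def firstExp {n : ℕ} (x : Fin n → ℕ × ℤ) : ℕ := if h : 0 < n then (x ⟨0, h⟩).1 else 0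

section Datum

variable {n : ℕ} (x : Fin n → ℕ × ℤ)

theorem psiDatum_of_val_eq {k l : Fin n} (h : k.1 + 1 = l.1) : psiDatum x k = x l := by
  rw [psiDatum, dif_pos (h ▸ l.2)]
  exact congrArg x (Fin.ext h)

theorem psiDatum_last {k l : Fin n} (hk : k.1 = 0) (hl : l.1 + 1 = n) :
    psiDatum x l = qShift (x k) := by
  rw [psiDatum, dif_neg (by omega)]
  exact congrArg (fun k => qShift (x k)) (Fin.ext hk.symm)

theorem psiDatum_injective : Function.Injective (psiDatum (n := n)) := by
  intro x y h
  funext ⟨k, hk⟩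
  cases k with
  | zero =>
    have hshift := congrFun h ⟨n - 1, by omega⟩
    rw [psiDatum_last x (k := ⟨0, hk⟩) rfl (Nat.sub_add_cancel hk),
      psiDatum_last y (k := ⟨0, hk⟩) rfl (Nat.sub_add_cancel hk)] at hshift
    simpa [qShift, Prod.ext_iff] using hshift
  | succ k =>
    have hshift := congrFun h ⟨k, by omega⟩
    rwa [psiDatum_of_val_eq x (l := ⟨k + 1, hk⟩) rfl,
      psiDatum_of_val_eq y (l := ⟨k + 1, hk⟩) rfl] at hshift

theorem firstExp_eq {k : Fin n} (hk : k.1 = 0) : firstExp x = (x k).1 := by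
  rw [firstExp, dif_pos k.pos]
  exact congrArg (fun k => (x k).1) (Fin.ext hk.symm)

theorem firstExp_comp_swap {j : Fin (n - 1)} (hj : 0 < j.1) :
    firstExp (x ∘ Equiv.swap (lo j) (hi j)) = firstExp x := by
  have hn : 0 < n := (lo j).pos
  rw [firstExp_eq (k := ⟨0, hn⟩) _ rfl, firstExp_eq (k := ⟨0, hn⟩) _ rfl, Function.comp_apply,
    Equiv.swap_apply_of_ne_of_ne] <;> simp only [lo, hi, Ne, Fin.mk.injEq] <;> omega

theorem comp_swap_comp_swap (a b : Fin n) : (x ∘ Equiv.swap a b) ∘ Equiv.swap a b = x :=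
  funext fun k => congrArg x (Equiv.swap_apply_self a b k)

theorem comp_swap_braid {a b c : Fin n} (hab : a ≠ b) (hac : a ≠ c) (hbc : b ≠ c) :
    ((x ∘ Equiv.swap a b) ∘ Equiv.swap b c) ∘ Equiv.swap a b =
      ((x ∘ Equiv.swap b c) ∘ Equiv.swap a b) ∘ Equiv.swap b c := by
  have hperm : Equiv.swap a b * Equiv.swap b c * Equiv.swap a b =
      Equiv.swap b c * Equiv.swap a b * Equiv.swap b c := by
    rw [Equiv.swap_mul_swap_mul_swap hab hac, Equiv.swap_comm b c, Equiv.swap_comm a b,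
      Equiv.swap_mul_swap_mul_swap hbc.symm hac.symm, Equiv.swap_comm]
  exact funext fun k => congrArg x (DFunLike.congr_fun hperm k)

theorem comp_swap_comm {a b c d : Fin n} (h : [a, b, c, d].Nodup) :
    (x ∘ Equiv.swap a b) ∘ Equiv.swap c d = (x ∘ Equiv.swap c d) ∘ Equiv.swap a b :=
  funext fun k => congrArg x
    (DFunLike.congr_fun (Equiv.Perm.disjoint_swap_swap h).commute.eq k)

theorem psiDatum_comp_swap {i j : Fin (n - 1)} (hij : i.1 + 1 = j.1) :
    psiDatum x ∘ Equiv.swap (lo i) (hi i) = psiDatum (x ∘ Equiv.swap (lo j) (hi j)) := by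
  have hlo : (lo i).1 + 1 = (lo j).1 := hij
  have hhi : (hi i).1 + 1 = (hi j).1 := congrArg (· + 1) hij
  funext k
  rw [Function.comp_apply]
  rcases eq_or_ne k (lo i) with rfl | hklo
  · rw [Equiv.swap_apply_left, psiDatum_of_val_eq x hhi, psiDatum_of_val_eq _ hlo,
      Function.comp_apply, Equiv.swap_apply_left]
  rcases eq_or_ne k (hi i) with rfl | hkhi
  · rw [Equiv.swap_apply_right, psiDatum_of_val_eq x hlo, psiDatum_of_val_eq _ hhi,
      Function.comp_apply, Equiv.swap_apply_right]
  rw [Equiv.swap_apply_of_ne_of_ne hklo hkhi, psiDatum, psiDatum]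
  simp only [lo, hi, Ne, Fin.ext_iff] at hklo hkhi
  split_ifs with hk <;> rw [Function.comp_apply, Equiv.swap_apply_of_ne_of_ne] <;>
    simp only [lo, hi, Ne, Fin.ext_iff] <;> omega

theorem psiDatum_psiDatum_comp_swap {f l : Fin (n - 1)} (hf : f.1 = 0) (hl : l.1 + 2 = n) :
    psiDatum (psiDatum x) ∘ Equiv.swap (lo l) (hi l) =
      psiDatum (psiDatum (x ∘ Equiv.swap (lo f) (hi f))) := by
  have hlof : (lo f).1 + 1 = (hi f).1 := rfl
  have hlol : (lo l).1 + 1 = (hi l).1 := rfl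
  have psi_lo (y) : psiDatum (psiDatum y) (lo l) = qShift (y (lo f)) := by
    rw [psiDatum_of_val_eq _ hlol, psiDatum_last y (k := lo f) hf hl]
  have psi_hi (y) : psiDatum (psiDatum y) (hi l) = qShift (y (hi f)) := by
    rw [psiDatum_last _ (k := lo f) hf hl, psiDatum_of_val_eq y hlof]
  funext k
  rw [Function.comp_apply]
  rcases eq_or_ne k (lo l) with rfl | hklo
  · rw [Equiv.swap_apply_left, psi_hi, psi_lo, Function.comp_apply, Equiv.swap_apply_left]
  rcases eq_or_ne k (hi l) with rfl | hkhi
  · rw [Equiv.swap_apply_right, psi_hi, psi_lo, Function.comp_apply, Equiv.swap_apply_right]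
  have hk : k.1 + 2 < n := by
    simp only [lo, hi, Ne, Fin.ext_iff] at hklo hkhi
    omega
  have psi_k (y) : psiDatum (psiDatum y) k = y ⟨k.1 + 2, hk⟩ := by
    rw [psiDatum_of_val_eq _ (l := ⟨k.1 + 1, by omega⟩) rfl, psiDatum_of_val_eq]
    rfl
  rw [Equiv.swap_apply_of_ne_of_ne hklo hkhi, psi_k, psi_k, Function.comp_apply,
    Equiv.swap_apply_of_ne_of_ne] <;> simp only [lo, hi, Ne, Fin.ext_iff] <;> omega

end Datum

theorem PSYT.datum_psi {lam : YoungDiagram} (τ : PSYT lam) : τ.psi.datum = psiDatum τ.datum := by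
  funext i
  rw [psiDatum]
  split_ifs with h
  · exact τ.datum_psi_of_lt h
  · exact τ.datum_psi_last h

theorem PSYT.exists_datum_eq_of_psiDatum {lam : YoungDiagram} {τ : PSYT lam}
    {x : Fin lam.card → ℕ × ℤ} (h : τ.datum = psiDatum x) : ∃ σ : PSYT lam, σ.datum = x := by
  rcases Nat.eq_zero_or_pos lam.card with h0 | h0
  · exact ⟨τ, funext fun i => absurd i.2 (by omega)⟩
  · have hlast : lam.card - 1 + 1 = lam.card := Nat.sub_add_cancel h0
    have hw : 0 < τ.w ⟨lam.card - 1, by omega⟩ := by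
      change 0 < (τ.datum _).1
      rw [h, psiDatum_last x (k := ⟨0, h0⟩) rfl hlast]
      exact Nat.succ_pos _
    obtain ⟨σ, rfl⟩ := τ.exists_psi_eq hlast.ge hw
    exact ⟨σ, psiDatum_injective (σ.datum_psi.symm.trans h)⟩

theorem PSYT.datum_lo_ne_hi {lam : YoungDiagram} (τ : PSYT lam) (i : Fin (lam.card - 1)) :
    τ.datum (lo i) ≠ τ.datum (hi i) :=
  τ.datum_ne_of_lt_add_three (Nat.lt_succ_self _) (by simp only [lo, hi]; omega)

/-- The vector space with basis the periodic standard Young tableaux, on which the operators `θ_i`,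
`t T_i⁻¹` and `X_n π_n⁻¹` are prescribed by the formulas that the basis `F_τ` must satisfy. -/
def Model (lam : YoungDiagram) : Type := PSYT lam →₀ Kqt

namespace Model

variable {lam : YoungDiagram}

instance : AddCommGroup (Model lam) := inferInstanceAs (AddCommGroup (PSYT lam →₀ Kqt))

instance : Module Kqt (Model lam) := inferInstanceAs (Module Kqt (PSYT lam →₀ Kqt))

/-- The basis of the model. -/
def e : Module.Basis (PSYT lam) Kqt (Model lam) := ⟨LinearEquiv.refl Kqt (PSYT lam →₀ Kqt)⟩

/-- The action of `θ_i` on the model. -/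
def thetaOp (i : Fin lam.card) : Module.End Kqt (Model lam) :=
  e.constr Kqt fun τ => wt (τ.datum i) • e τ

/-- The action of `t T_i⁻¹` on the model. -/
def sOp (i : Fin (lam.card - 1)) : Module.End Kqt (Model lam) :=
  e.constr Kqt fun τ => swapCoeff (τ.datum (lo i)) (τ.datum (hi i)) • e (τ.swap i) -
    diagCoeff (τ.datum (lo i)) (τ.datum (hi i)) • e τ

/-- The action of `X_n π_n⁻¹` on the model. -/
def qOp : Module.End Kqt (Model lam) :=
  e.constr Kqt fun τ => (q ^ firstExp τ.datum)⁻¹ • e τ.psi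

theorem thetaOp_e (i : Fin lam.card) (τ : PSYT lam) : thetaOp i (e τ) = wt (τ.datum i) • e τ :=
  e.constr_basis _ _ _

theorem sOp_e (i : Fin (lam.card - 1)) (τ : PSYT lam) :
    sOp i (e τ) = swapCoeff (τ.datum (lo i)) (τ.datum (hi i)) • e (τ.swap i) -
      diagCoeff (τ.datum (lo i)) (τ.datum (hi i)) • e τ :=
  e.constr_basis _ _ _

theorem qOp_e (τ : PSYT lam) : qOp (e τ) = (q ^ firstExp τ.datum)⁻¹ • e τ.psi :=
  e.constr_basis _ _ _

open Classical in
/-- The basis vector with datum `x`, or `0` if no tableau has datum `x`. With this convention the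
formulas for the operators hold for every function `x`, whether or not `s_i` is defined. -/
def vec (x : Fin lam.card → ℕ × ℤ) : Model lam :=
  if h : ∃ τ : PSYT lam, τ.datum = x then e h.choose else 0

theorem vec_datum (τ : PSYT lam) : vec τ.datum = e τ := by
  have h : ∃ σ : PSYT lam, σ.datum = τ.datum := ⟨τ, rfl⟩
  rw [vec, dif_pos h, PSYT.datum_injective h.choose_spec]

theorem vec_eq_zero {x : Fin lam.card → ℕ × ℤ} (h : ∀ τ : PSYT lam, τ.datum ≠ x) : vec x = 0 :=
  dif_neg (not_exists.mpr h)

theorem thetaOp_vec (i : Fin lam.card) (x : Fin lam.card → ℕ × ℤ) :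
    thetaOp i (vec x) = wt (x i) • vec x := by
  by_cases h : ∃ τ : PSYT lam, τ.datum = x
  · obtain ⟨τ, rfl⟩ := h
    rw [vec_datum, thetaOp_e]
  · rw [vec_eq_zero (not_exists.mp h), map_zero, smul_zero]

theorem swapCoeff_smul_e_swap (i : Fin (lam.card - 1)) (τ : PSYT lam) :
    swapCoeff (τ.datum (lo i)) (τ.datum (hi i)) • e (τ.swap i) =
      swapCoeff (τ.datum (lo i)) (τ.datum (hi i)) • vec (τ.datum ∘ Equiv.swap (lo i) (hi i)) := by
  by_cases ha : Adj (τ.datum (lo i)) (τ.datum (hi i))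
  · rw [swapCoeff_of_adj ha (τ.datum_lo_ne_hi i), zero_smul, zero_smul]
  · rw [← PSYT.datum_swap ha, vec_datum]

theorem swapCoeff_smul_vec_comp_swap_eq_zero (i : Fin (lam.card - 1)) {x : Fin lam.card → ℕ × ℤ}
    (hx : ∀ τ : PSYT lam, τ.datum ≠ x) :
    swapCoeff (x (lo i)) (x (hi i)) • vec (x ∘ Equiv.swap (lo i) (hi i)) = 0 := by
  by_cases h : ∃ τ : PSYT lam, τ.datum = x ∘ Equiv.swap (lo i) (hi i)
  · obtain ⟨τ, hτ⟩ := h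
    have hxτ : x = τ.datum ∘ Equiv.swap (lo i) (hi i) := by rw [hτ, comp_swap_comp_swap]
    have ha : Adj (τ.datum (lo i)) (τ.datum (hi i)) :=
      not_not.mp fun ha => hx (τ.swap i) (by rw [PSYT.datum_swap ha, hxτ])
    rw [hxτ, Function.comp_apply, Function.comp_apply, Equiv.swap_apply_left,
      Equiv.swap_apply_right, swapCoeff_of_adj ha.symm (τ.datum_lo_ne_hi i).symm, zero_smul]
  · rw [vec_eq_zero (not_exists.mp h), smul_zero]

theorem sOp_vec (i : Fin (lam.card - 1)) (x : Fin lam.card → ℕ × ℤ) :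
    sOp i (vec x) = swapCoeff (x (lo i)) (x (hi i)) • vec (x ∘ Equiv.swap (lo i) (hi i)) -
      diagCoeff (x (lo i)) (x (hi i)) • vec x := by
  by_cases h : ∃ τ : PSYT lam, τ.datum = x
  · obtain ⟨τ, rfl⟩ := h
    rw [vec_datum, sOp_e, swapCoeff_smul_e_swap]
  · have hx := not_exists.mp h
    rw [swapCoeff_smul_vec_comp_swap_eq_zero i hx, vec_eq_zero hx, map_zero, smul_zero, sub_zero]

theorem qOp_vec (x : Fin lam.card → ℕ × ℤ) :
    qOp (vec x) = (q ^ firstExp x)⁻¹ • vec (psiDatum x) := by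
  by_cases h : ∃ τ : PSYT lam, τ.datum = x
  · obtain ⟨τ, rfl⟩ := h
    rw [vec_datum, qOp_e, ← PSYT.datum_psi, vec_datum]
  · have hx := not_exists.mp h
    rw [vec_eq_zero hx, map_zero, vec_eq_zero, smul_zero]
    intro τ hτ
    obtain ⟨σ, hσ⟩ := PSYT.exists_datum_eq_of_psiDatum hτ
    exact hx σ hσ

theorem ext_vec {f g : Module.End Kqt (Model lam)}
    (h : ∀ τ : PSYT lam, f (vec τ.datum) = g (vec τ.datum)) : f = g :=
  e.ext fun τ => by rw [← vec_datum, h]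

theorem thetaOp_comm (i j : Fin lam.card) :
    thetaOp i * thetaOp j = thetaOp j * thetaOp (lam := lam) i := by
  refine e.ext fun τ => ?_
  simp only [Module.End.mul_apply, thetaOp_e, map_smul]
  rw [smul_comm]

theorem sOp_sq (i : Fin (lam.card - 1)) :
    sOp (lam := lam) i * sOp i = (t - 1) • sOp i + t • 1 := by
  refine ext_vec fun τ => ?_
  have hne := τ.datum_lo_ne_hi i
  simp only [Module.End.mul_apply, LinearMap.add_apply, LinearMap.smul_apply, sOp_vec,
    Module.End.one_apply, map_sub, map_smul, comp_swap_comp_swap, Function.comp_apply,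
    Equiv.swap_apply_left, Equiv.swap_apply_right]
  linear_combination (norm := module)
    (-swapCoeff (τ.datum (lo i)) (τ.datum (hi i)) * diagCoeff_add_diagCoeff hne) •
        vec (τ.datum ∘ Equiv.swap (lo i) (hi i)) +
      (swapCoeff_mul_swapCoeff hne + intertwinerSq_eq hne +
        diagCoeff (τ.datum (lo i)) (τ.datum (hi i)) * diagCoeff_add_diagCoeff hne) • vec τ.datum

theorem sOp_theta_sOp (i : Fin (lam.card - 1)) :
    sOp (lam := lam) i * thetaOp (lo i) * sOp i = t • thetaOp (hi i) := by
  refine ext_vec fun τ => ?_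
  have hne := τ.datum_lo_ne_hi i
  simp only [Module.End.mul_apply, LinearMap.smul_apply, sOp_vec, thetaOp_vec, map_sub, map_smul,
    comp_swap_comp_swap, Function.comp_apply, Equiv.swap_apply_left, Equiv.swap_apply_right]
  linear_combination (norm := module)
    (-swapCoeff (τ.datum (lo i)) (τ.datum (hi i)) * diagCoeff_mul_wt hne) •
        vec (τ.datum ∘ Equiv.swap (lo i) (hi i)) +
      (wt (τ.datum (hi i)) * (swapCoeff_mul_swapCoeff hne + intertwinerSq_eq hne) +
        diagCoeff (τ.datum (lo i)) (τ.datum (hi i)) * diagCoeff_mul_wt hne) • vec τ.datum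

theorem sOp_theta_far (i : Fin (lam.card - 1)) (j : Fin lam.card) (h₁ : j ≠ lo i)
    (h₂ : j ≠ hi i) : sOp i * thetaOp j = thetaOp j * sOp (lam := lam) i := by
  refine ext_vec fun τ => ?_
  simp only [Module.End.mul_apply, sOp_vec, thetaOp_vec, map_sub, map_smul, Function.comp_apply,
    Equiv.swap_apply_of_ne_of_ne h₁ h₂]
  module

theorem sOp_far {i j : Fin (lam.card - 1)} (hij : i.1 + 1 < j.1 ∨ j.1 + 1 < i.1) :
    sOp i * sOp j = sOp j * sOp (lam := lam) i := by
  refine ext_vec fun τ => ?_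
  have hdisj : [lo i, hi i, lo j, hi j].Nodup := by
    simp only [lo, hi, List.nodup_cons, List.mem_cons, List.not_mem_nil, List.nodup_nil,
      Fin.mk.injEq, or_false, not_false_eq_true, and_true]
    omega
  have hcomm := comp_swap_comm τ.datum hdisj
  simp only [List.nodup_cons, List.mem_cons, List.not_mem_nil, not_or, or_false] at hdisj
  obtain ⟨⟨-, hll, hlh⟩, ⟨hhl, hhh⟩, -⟩ := hdisj
  simp only [Module.End.mul_apply, sOp_vec, map_sub, map_smul, hcomm, Function.comp_apply,
    Equiv.swap_apply_of_ne_of_ne hll hlh, Equiv.swap_apply_of_ne_of_ne hhl hhh,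
    Equiv.swap_apply_of_ne_of_ne (Ne.symm hll) (Ne.symm hhl),
    Equiv.swap_apply_of_ne_of_ne (Ne.symm hlh) (Ne.symm hhh)]
  module

theorem sOp_braid {i j : Fin (lam.card - 1)} (hij : i.1 + 1 = j.1) :
    sOp i * sOp j * sOp i = sOp j * sOp i * sOp (lam := lam) j := by
  refine ext_vec fun τ => ?_
  have hm : lo j = hi i := Fin.ext hij.symm
  have hab : lo i ≠ hi i := lo_ne_hi i
  have hbc : hi i ≠ hi j := hm ▸ lo_ne_hi j
  have hac : lo i ≠ hi j := by
    simp only [lo, hi, Ne, Fin.mk.injEq]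
    omega
  have hab' := τ.datum_lo_ne_hi i
  have hbc' : τ.datum (hi i) ≠ τ.datum (hi j) := hm ▸ τ.datum_lo_ne_hi j
  have hac' : τ.datum (lo i) ≠ τ.datum (hi j) :=
    τ.datum_ne_of_lt_add_three (by simp only [lo, hi, Fin.mk_lt_mk]; omega)
      (by simp only [lo, hi]; omega)
  have hbraid := comp_swap_braid τ.datum hab hac hbc
  simp only [Module.End.mul_apply, sOp_vec, map_sub, map_smul, comp_swap_comp_swap, hm, hbraid,
    Function.comp_apply, Equiv.swap_apply_left, Equiv.swap_apply_right,
    Equiv.swap_apply_of_ne_of_ne hac.symm hbc.symm, Equiv.swap_apply_of_ne_of_ne hab hac]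
  linear_combination (norm := module)
    (swapCoeff (τ.datum (lo i)) (τ.datum (hi i)) * diagCoeff_braid_left hab' hbc' hac') •
        vec (τ.datum ∘ Equiv.swap (lo i) (hi i)) +
      (swapCoeff (τ.datum (hi i)) (τ.datum (hi j)) * diagCoeff_braid_right hab' hbc' hac') •
        vec (τ.datum ∘ Equiv.swap (hi i) (hi j)) -
      (diagCoeff_braid hab' hbc' hac' + diagCoeff (τ.datum (lo i)) (τ.datum (hi j)) *
        (swapCoeff_mul_swapCoeff hab' - swapCoeff_mul_swapCoeff hbc')) • vec τ.datum

theorem sOp_qOp {i j : Fin (lam.card - 1)} (hij : i.1 + 1 = j.1) :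
    sOp i * qOp = qOp * sOp (lam := lam) j := by
  refine ext_vec fun τ => ?_
  have hlo : psiDatum τ.datum (lo i) = τ.datum (lo j) := psiDatum_of_val_eq _ hij
  have hhi : psiDatum τ.datum (hi i) = τ.datum (hi j) :=
    psiDatum_of_val_eq _ (congrArg (· + 1) hij)
  simp only [Module.End.mul_apply, sOp_vec, qOp_vec, map_sub, map_smul, hlo, hhi,
    psiDatum_comp_swap _ hij, firstExp_comp_swap _ (hij ▸ Nat.succ_pos _ : 0 < j.1)]
  module

theorem sOp_qOp_qOp {f l : Fin (lam.card - 1)} (hf : f.1 = 0) (hl : l.1 + 2 = lam.card) :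
    sOp l * (qOp * qOp) = qOp * qOp * sOp (lam := lam) f := by
  refine ext_vec fun τ => ?_
  have hlo : psiDatum (psiDatum τ.datum) (lo l) = qShift (τ.datum (lo f)) := by
    rw [psiDatum_of_val_eq _ (l := hi l) rfl, psiDatum_last _ (k := lo f) hf hl]
  have hhi : psiDatum (psiDatum τ.datum) (hi l) = qShift (τ.datum (hi f)) := by
    rw [psiDatum_last _ (k := lo f) hf hl, psiDatum_of_val_eq _ (l := hi f) rfl]
  have hexp (x : Fin lam.card → ℕ × ℤ) : firstExp x = (x (lo f)).1 := firstExp_eq x hf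
  have hpsi (x : Fin lam.card → ℕ × ℤ) : psiDatum x (lo f) = x (hi f) := psiDatum_of_val_eq x rfl
  simp only [Module.End.mul_apply, sOp_vec, qOp_vec, map_sub, map_smul, hlo, hhi, hexp, hpsi,
    psiDatum_psiDatum_comp_swap _ hf hl, swapCoeff_qShift, diagCoeff_qShift, Function.comp_apply,
    Equiv.swap_apply_left, Equiv.swap_apply_right]
  module

theorem thetaOp_qOp {i j : Fin lam.card} (h : i.1 + 1 = j.1) :
    thetaOp i * qOp = qOp * thetaOp (lam := lam) j := by
  refine ext_vec fun τ => ?_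
  simp only [Module.End.mul_apply, qOp_vec, thetaOp_vec, map_smul, psiDatum_of_val_eq _ h]
  rw [smul_comm]

theorem thetaOp_last_qOp {i j : Fin lam.card} (hi : i.1 = 0) (hj : j.1 + 1 = lam.card) :
    thetaOp j * qOp = q • (qOp * thetaOp (lam := lam) i) := by
  refine ext_vec fun τ => ?_
  simp only [Module.End.mul_apply, LinearMap.smul_apply, qOp_vec, thetaOp_vec, map_smul,
    psiDatum_last _ hi hj, wt_qShift]
  module

end Model

/-! ## The relations of the double affine Hecke algebra from those of an intertwiner -/

section Intertwiner

variable {R : Type*} [Ring R] [Algebra Kqt R]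

/-- Relations between elements `S_i = t T_i⁻¹`, `θ_i` and `Q = X_n π_n⁻¹`, for `n = N + 1`, with
indices starting at `0`. -/
structure IntertwinerData (N : ℕ) (S θ : ℕ → R) (Q : R) : Prop where
  sq : ∀ i < N, S i * S i = (t - 1) • S i + t • 1
  braid : ∀ i, i + 1 < N → S i * S (i + 1) * S i = S (i + 1) * S i * S (i + 1)
  far : ∀ i j, i + 1 < j → j < N → S i * S j = S j * S i
  theta_comm : ∀ i j, i ≤ N → j ≤ N → θ i * θ j = θ j * θ i
  theta_step : ∀ i < N, S i * θ i * S i = t • θ (i + 1)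
  theta_far : ∀ i j, i < N → j ≤ N → j ≠ i → j ≠ i + 1 → S i * θ j = θ j * S i
  s_q : ∀ i, i + 1 < N → S i * Q = Q * S (i + 1)
  s_q_q : ∀ i, i + 1 = N → S i * (Q * Q) = Q * Q * S 0
  theta_q : ∀ i < N, θ i * Q = Q * θ (i + 1)
  theta_q_last : θ N * Q = q • (Q * θ 0)

/-- The element `T = s - (t - 1)` for `s = t T⁻¹`. -/
def heckeGen (s : R) : R := s - (t - 1) • 1

/-- The product `S_0 ⋯ S_(k-1)`. -/
def upProd {M : Type*} [Monoid M] (S : ℕ → M) : ℕ → M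
  | 0 => 1
  | k + 1 => upProd S k * S k

/-- The product `S_(k-1) ⋯ S_0`. -/
def downProd {M : Type*} [Monoid M] (S : ℕ → M) : ℕ → M
  | 0 => 1
  | k + 1 => S k * downProd S k

/-- The elements `X_0 = x`, `X_(k+1) = t⁻¹ S_k X_k S_k`. -/
def conjSeq (S : ℕ → R) (x : R) : ℕ → R
  | 0 => x
  | k + 1 => t⁻¹ • (S k * conjSeq S x k * S k)

theorem upProd_succ_eq_mul {M : Type*} [Monoid M] (S : ℕ → M) (k : ℕ) :
    upProd S (k + 1) = S 0 * upProd (fun i => S (i + 1)) k := by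
  induction k with
  | zero => simp [upProd]
  | succ k ih => rw [upProd, ih, upProd, mul_assoc]

theorem smul_conjSeq (S : ℕ → R) (x : R) (k : ℕ) :
    t • conjSeq S x (k + 1) = S k * conjSeq S x k * S k := by
  rw [conjSeq, smul_smul, mul_inv_cancel₀ t_ne_zero, one_smul]

theorem downProd_mul_upProd (S : ℕ → R) (x : R) (k : ℕ) :
    downProd S k * x * upProd S k = t ^ k • conjSeq S x k := by
  induction k with
  | zero => simp [downProd, upProd, conjSeq]
  | succ k ih =>
    calc S k * downProd S k * x * (upProd S k * S k)
        = S k * (downProd S k * x * upProd S k) * S k := by noncomm_ring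
      _ = _ := by
        rw [ih, mul_smul_comm, smul_mul_assoc, ← smul_conjSeq, smul_smul, pow_succ]

namespace IntertwinerData

variable {N : ℕ} {S θ : ℕ → R} {Q : R}

/-- The element `π = θ_0 S_0 ⋯ S_(N-1)`. -/
def pi (N : ℕ) (S θ : ℕ → R) : R := θ 0 * upProd S N

/-- The elements `X_k`. -/
def xSeq (N : ℕ) (S θ : ℕ → R) (Q : R) : ℕ → R := conjSeq S (q⁻¹ • (pi N S θ * Q))

theorem s_commute_upProd (h : IntertwinerData N S θ Q) {i k : ℕ} (hk : k < i) (hi : i < N) :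
    Commute (S i) (upProd S k) := by
  induction k with
  | zero => exact Commute.one_right _
  | succ k ih =>
    exact (ih (by omega)).mul_right (Commute.symm (h.far k i hk hi))

theorem s_succ_mul_upProd (h : IntertwinerData N S θ Q) {i k : ℕ} (hk : i + 1 < k) (hN : k ≤ N) :
    S (i + 1) * upProd S k = upProd S k * S i := by
  induction k with
  | zero => omega
  | succ k ih =>
    rcases Nat.lt_or_ge (i + 1) k with hik | hik
    · rw [upProd, ← mul_assoc, ih hik (by omega), mul_assoc, h.far i k hik (by omega), mul_assoc]
    · obtain rfl : k = i + 1 := by omega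
      have hc := (h.s_commute_upProd (i := i + 1) (k := i) (by omega) (by omega)).eq
      simp only [upProd]
      calc S (i + 1) * (upProd S i * S i * S (i + 1))
          = (S (i + 1) * upProd S i) * S i * S (i + 1) := by noncomm_ring
        _ = upProd S i * (S (i + 1) * S i * S (i + 1)) := by rw [hc]; noncomm_ring
        _ = _ := by rw [← h.braid i (by omega)]; noncomm_ring

theorem s_succ_mul_pi (h : IntertwinerData N S θ Q) {i : ℕ} (hi : i + 1 < N) :
    S (i + 1) * pi N S θ = pi N S θ * S i := by
  rw [pi, ← mul_assoc, h.theta_far (i + 1) 0 hi (by omega) (by omega) (by omega), mul_assoc,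
    h.s_succ_mul_upProd hi le_rfl, mul_assoc]

theorem theta_eq_conjSeq (h : IntertwinerData N S θ Q) {k : ℕ} (hk : k ≤ N) :
    θ k = conjSeq S (θ 0) k := by
  induction k with
  | zero => rfl
  | succ k ih =>
    rw [conjSeq, ← ih (by omega), h.theta_step k (by omega), smul_smul,
      inv_mul_cancel₀ t_ne_zero, one_smul]

theorem upProd_shift_mul_upProd (h : IntertwinerData N S θ Q) {k : ℕ} (hk : k < N) :
    upProd (fun i => S (i + 1)) k * upProd S N = upProd S N * upProd S k := by
  induction k with
  | zero => simp [upProd]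
  | succ k ih =>
    rw [upProd, mul_assoc, h.s_succ_mul_upProd hk le_rfl, ← mul_assoc, ih (by omega), mul_assoc]
    rfl

theorem commute_theta_zero_upProd_shift (h : IntertwinerData N S θ Q) {k : ℕ} (hk : k < N) :
    Commute (θ 0) (upProd (fun i => S (i + 1)) k) := by
  induction k with
  | zero => exact Commute.one_right _
  | succ k ih =>
    exact (ih (by omega)).mul_right
      (Commute.symm (h.theta_far (k + 1) 0 hk (by omega) (by omega) (by omega)))

theorem upProd_mul_q (h : IntertwinerData N S θ Q) {k : ℕ} (hk : k < N) :
    upProd S k * Q = Q * upProd (fun i => S (i + 1)) k := by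
  induction k with
  | zero => simp [upProd]
  | succ k ih =>
    rw [upProd, mul_assoc, h.s_q k hk, ← mul_assoc, ih (by omega), mul_assoc]
    rfl

theorem pi_mul_pi_mul_s (h : IntertwinerData N S θ Q) {M : ℕ} (hM : M + 1 = N) :
    pi N S θ * pi N S θ * S M = S 0 * (pi N S θ * pi N S θ) := by
  have hfirst : upProd S N = S 0 * upProd (fun i => S (i + 1)) M := by
    rw [← hM, upProd_succ_eq_mul]
  have hlast : upProd S N = upProd S M * S M := by rw [← hM]; rfl
  set D := upProd (fun i => S (i + 1)) M
  have hshift : D * upProd S N = upProd S N * upProd S M := h.upProd_shift_mul_upProd (by omega)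
  have hcomm : θ 0 * D = D * θ 0 := (h.commute_theta_zero_upProd_shift (k := M) (by omega)).eq
  have hpi : pi N S θ * pi N S θ = θ 0 * S 0 * θ 0 * D * upProd S N := by
    calc θ 0 * upProd S N * (θ 0 * upProd S N)
        = θ 0 * S 0 * (D * θ 0) * upProd S N := by rw [hfirst]; noncomm_ring
      _ = _ := by rw [← hcomm]; noncomm_ring
  rw [hpi]
  calc θ 0 * S 0 * θ 0 * D * upProd S N * S M
      = θ 0 * S 0 * θ 0 * (D * upProd S N) * S M := by noncomm_ring
    _ = θ 0 * S 0 * θ 0 * upProd S N * (upProd S M * S M) := by rw [hshift]; noncomm_ring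
    _ = θ 0 * (S 0 * θ 0 * S 0) * D * upProd S N := by
      rw [← hlast]; nth_rewrite 1 [hfirst]; noncomm_ring
    _ = (S 0 * θ 0 * S 0) * θ 0 * D * upProd S N := by
      rw [h.theta_step 0 (by omega), mul_smul_comm, h.theta_comm 0 (0 + 1) (by omega) (by omega)]
      simp only [smul_mul_assoc]
    _ = _ := by noncomm_ring

theorem s_mul_heckeGen (h : IntertwinerData N S θ Q) {i : ℕ} (hi : i < N) :
    S i * heckeGen (S i) = t • 1 := by
  rw [heckeGen, mul_sub, h.sq i hi, mul_smul_comm, mul_one, add_sub_cancel_left]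

theorem heckeGen_mul_s (h : IntertwinerData N S θ Q) {i : ℕ} (hi : i < N) :
    heckeGen (S i) * S i = t • 1 := by
  rw [heckeGen, sub_mul, h.sq i hi, smul_mul_assoc, one_mul, add_sub_cancel_left]

theorem q_mul_s_zero_mul_pi (h : IntertwinerData N S θ Q) {M : ℕ} (hM : M + 1 = N) :
    Q * S 0 * pi N S θ = pi N S θ * heckeGen (S M) * Q := by
  have hfirst : upProd S N = S 0 * upProd (fun i => S (i + 1)) M := by
    rw [← hM, upProd_succ_eq_mul]
  have hlast : upProd S N = upProd S M * S M := by rw [← hM]; rfl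
  have hq := h.upProd_mul_q (k := M) (by omega)
  set D := upProd (fun i => S (i + 1)) M
  have lhs : Q * S 0 * pi N S θ = t • (θ 0 * upProd S M * Q) := by
    calc Q * S 0 * (θ 0 * upProd S N) = Q * (S 0 * θ 0 * S 0) * D := by rw [hfirst]; noncomm_ring
      _ = t • ((Q * θ (0 + 1)) * D) := by
        rw [h.theta_step 0 (by omega), mul_smul_comm, smul_mul_assoc]
      _ = t • (θ 0 * (Q * D)) := by rw [← h.theta_q 0 (by omega), mul_assoc]
      _ = _ := by rw [← hq, mul_assoc]
  rw [lhs]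
  symm
  calc θ 0 * upProd S N * heckeGen (S M) * Q
      = θ 0 * upProd S M * (S M * heckeGen (S M)) * Q := by
        rw [hlast]; simp only [mul_assoc]
    _ = _ := by rw [h.s_mul_heckeGen (by omega), mul_smul_comm, smul_mul_assoc, mul_one]

theorem xSeq_last_eq (h : IntertwinerData N S θ Q) : xSeq N S θ Q N = Q * pi N S θ := by
  have htheta : downProd S N * θ 0 * upProd S N = t ^ N • θ N := by
    rw [downProd_mul_upProd, ← h.theta_eq_conjSeq le_rfl]
  apply smul_right_injective R (pow_ne_zero N t_ne_zero)
  beta_reduce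
  calc t ^ N • xSeq N S θ Q N
      = downProd S N * (q⁻¹ • (θ 0 * upProd S N * Q)) * upProd S N :=
        (downProd_mul_upProd S _ N).symm
    _ = q⁻¹ • ((downProd S N * θ 0 * upProd S N) * Q * upProd S N) := by
        rw [mul_smul_comm, smul_mul_assoc]; simp only [mul_assoc]
    _ = t ^ N • q⁻¹ • ((θ N * Q) * upProd S N) := by
        rw [htheta, smul_mul_assoc, smul_mul_assoc, smul_comm]
    _ = t ^ N • (Q * pi N S θ) := by
        rw [h.theta_q_last, smul_mul_assoc, inv_smul_smul₀ q_ne_zero, pi, mul_assoc]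

theorem pi_mul_xSeq_zero (h : IntertwinerData N S θ Q) (hN : 0 < N) :
    pi N S θ * xSeq N S θ Q 0 = xSeq N S θ Q 1 * pi N S θ := by
  obtain ⟨M, hM⟩ : ∃ M, M + 1 = N := ⟨N - 1, by omega⟩
  apply smul_right_injective R t_ne_zero
  beta_reduce
  rw [← smul_mul_assoc t (xSeq N S θ Q 1), xSeq, smul_conjSeq, conjSeq]
  set p := pi N S θ with hp
  calc t • (p * q⁻¹ • (p * Q)) = q⁻¹ • (p * p * (t • 1) * Q) := by
        simp only [mul_smul_comm, smul_mul_assoc, mul_one, mul_assoc]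
        rw [smul_comm]
    _ = q⁻¹ • (p * p * S M * heckeGen (S M) * Q) := by
        rw [← h.s_mul_heckeGen (i := M) (by omega)]; simp only [mul_assoc]
    _ = q⁻¹ • (S 0 * p * (p * heckeGen (S M) * Q)) := by
        rw [h.pi_mul_pi_mul_s hM, ← hp]; simp only [mul_assoc]
    _ = q⁻¹ • (S 0 * p * (Q * S 0 * p)) := by rw [h.q_mul_s_zero_mul_pi hM]
    _ = _ := by simp only [mul_smul_comm, smul_mul_assoc, mul_assoc]

theorem pi_mul_xSeq (h : IntertwinerData N S θ Q) {i : ℕ} (hi : i < N) :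
    pi N S θ * xSeq N S θ Q i = xSeq N S θ Q (i + 1) * pi N S θ := by
  induction i with
  | zero => exact h.pi_mul_xSeq_zero hi
  | succ i ih =>
    have ih := ih (by omega)
    have hs := h.s_succ_mul_pi hi
    simp only [xSeq, conjSeq, mul_smul_comm, smul_mul_assoc] at ih ⊢
    congr 1
    set x := conjSeq S (q⁻¹ • (pi N S θ * Q)) i
    set p := pi N S θ
    calc p * (S i * x * S i) = (p * S i) * x * S i := by noncomm_ring
      _ = S (i + 1) * (p * x) * S i := by rw [← hs]; noncomm_ring
      _ = S (i + 1) * (t⁻¹ • (S i * x * S i)) * (p * S i) := by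
        rw [ih]; simp only [mul_smul_comm, smul_mul_assoc, mul_assoc]
      _ = _ := by rw [← hs]; simp only [mul_smul_comm, smul_mul_assoc, mul_assoc]

theorem s_commute_xSeq_of_lt (h : IntertwinerData N S θ Q) {k j : ℕ} (hk : k < j) (hj : j < N) :
    Commute (S j) (xSeq N S θ Q k) := by
  induction k with
  | zero =>
    obtain ⟨i, rfl⟩ : ∃ i, j = i + 1 := ⟨j - 1, by omega⟩
    refine Commute.smul_right ?_ _
    change S (i + 1) * (pi N S θ * Q) = pi N S θ * Q * S (i + 1)
    rw [← mul_assoc, h.s_succ_mul_pi hj, mul_assoc, h.s_q i hj, mul_assoc]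
  | succ k ih =>
    have hjk : Commute (S j) (S k) := Commute.symm (h.far k j hk hj)
    exact ((hjk.mul_right (ih (by omega))).mul_right hjk).smul_right _

theorem s_commute_xSeq_of_add_one_lt (h : IntertwinerData N S θ Q) {k j : ℕ} (hj : j + 1 < k)
    (hk : k ≤ N) : Commute (S j) (xSeq N S θ Q k) := by
  induction k with
  | zero => omega
  | succ k ih =>
    rcases Nat.lt_or_ge (j + 1) k with hjk | hjk
    · have hc : Commute (S j) (S k) := h.far j k hjk (by omega)
      exact ((hc.mul_right (ih hjk (by omega))).mul_right hc).smul_right _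
    · obtain rfl : k = j + 1 := by omega
      have hcomm := (h.s_commute_xSeq_of_lt (k := j) (j := j + 1) (by omega) (by omega)).eq
      have hbraid := h.braid j (by omega)
      simp only [xSeq] at hcomm
      simp only [xSeq, conjSeq, mul_smul_comm, smul_mul_assoc]
      refine Commute.smul_right (Commute.smul_right ?_ _) _
      set x := conjSeq S (q⁻¹ • (pi N S θ * Q)) j
      set u := S (j + 1)
      set s := S j
      change s * (u * (s * x * s) * u) = u * (s * x * s) * u * s
      calc s * (u * (s * x * s) * u) = (s * u * s) * x * s * u := by noncomm_ring
        _ = u * s * (u * x) * s * u := by rw [hbraid]; noncomm_ring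
        _ = u * s * x * (u * s * u) := by rw [hcomm]; noncomm_ring
        _ = _ := by rw [← hbraid]; noncomm_ring

theorem xSeq_zero_commute_xSeq_one (h : IntertwinerData N S θ Q) (hN : 0 < N) :
    Commute (xSeq N S θ Q 0) (xSeq N S θ Q 1) := by
  obtain ⟨M, hM⟩ : ∃ M, M + 1 = N := ⟨N - 1, by omega⟩
  have hqsp := h.q_mul_s_zero_mul_pi hM
  simp only [xSeq, conjSeq]
  refine Commute.smul_right (Commute.smul_left ?_ _) _
  set p := pi N S θ
  set T := heckeGen (S M)
  rw [mul_smul_comm, smul_mul_assoc]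
  refine Commute.smul_right ?_ _
  change p * Q * (S 0 * (p * Q) * S 0) = S 0 * (p * Q) * S 0 * (p * Q)
  calc p * Q * (S 0 * (p * Q) * S 0) = p * (Q * S 0 * p) * (Q * S 0) := by noncomm_ring
    _ = p * p * T * (Q * Q * S 0) := by rw [hqsp]; noncomm_ring
    _ = p * p * (T * S M) * (Q * Q) := by rw [← h.s_q_q M hM]; noncomm_ring
    _ = p * p * (S M * T) * (Q * Q) := by
      rw [h.heckeGen_mul_s (by omega), h.s_mul_heckeGen (by omega)]
    _ = (p * p * S M) * T * (Q * Q) := by noncomm_ring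
    _ = S 0 * p * (p * T * Q) * Q := by rw [h.pi_mul_pi_mul_s hM]; noncomm_ring
    _ = _ := by rw [← hqsp]; noncomm_ring

theorem xSeq_commute_of_lt (h : IntertwinerData N S θ Q) {i j : ℕ} (hij : i < j) (hj : j ≤ N) :
    Commute (xSeq N S θ Q i) (xSeq N S θ Q j) := by
  induction i with
  | zero =>
    induction j with
    | zero => omega
    | succ j ih =>
      rcases Nat.eq_zero_or_pos j with rfl | hpos
      · exact h.xSeq_zero_commute_xSeq_one (by omega)
      · have hs := (h.s_commute_xSeq_of_lt (k := 0) (j := j) hpos (by omega)).symm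
        exact ((hs.mul_right (ih (by omega) (by omega))).mul_right hs).smul_right _
  | succ i ih =>
    have hs := h.s_commute_xSeq_of_add_one_lt (j := i) hij hj
    exact ((hs.mul_left (ih (by omega))).mul_left hs).smul_left _

theorem s_commute_xSeq (h : IntertwinerData N S θ Q) {j k : ℕ} (hj : j < N) (hk : k ≤ N)
    (hkj : k ≠ j) (hkj' : k ≠ j + 1) : Commute (S j) (xSeq N S θ Q k) := by
  rcases lt_or_gt_of_ne hkj with hlt | hgt
  · exact h.s_commute_xSeq_of_lt hlt hj
  · exact h.s_commute_xSeq_of_add_one_lt (by omega) hk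

theorem xSeq_commute (h : IntertwinerData N S θ Q) {i j : ℕ} (hi : i ≤ N) (hj : j ≤ N) :
    Commute (xSeq N S θ Q i) (xSeq N S θ Q j) := by
  rcases lt_trichotomy i j with hij | rfl | hij
  · exact h.xSeq_commute_of_lt hij hj
  · exact Commute.refl _
  · exact (h.xSeq_commute_of_lt hij hi).symm

theorem upProd_mul_downProd_heckeGen (h : IntertwinerData N S θ Q) {k : ℕ} (hk : k ≤ N) :
    upProd S k * downProd (fun i => heckeGen (S i)) k = t ^ k • 1 := by
  induction k with
  | zero => simp [upProd, downProd]
  | succ k ih =>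
    calc upProd S k * S k * (heckeGen (S k) * downProd (fun i => heckeGen (S i)) k)
        = upProd S k * (S k * heckeGen (S k)) * downProd (fun i => heckeGen (S i)) k := by
          simp only [mul_assoc]
      _ = _ := by
        rw [h.s_mul_heckeGen (by omega), mul_smul_comm, mul_one, smul_mul_assoc, ih (by omega),
          smul_smul, pow_succ, mul_comm]

theorem q_mul_theta_zero (h : IntertwinerData N S θ Q) :
    t ^ N • (Q * θ 0) =
      xSeq N S θ Q N * downProd (fun i => heckeGen (S i)) N := by
  rw [h.xSeq_last_eq, pi, mul_assoc, mul_assoc, h.upProd_mul_downProd_heckeGen le_rfl,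
    mul_smul_comm, mul_smul_comm, mul_one]

end IntertwinerData

end Intertwiner

section Relations

variable {R : Type*} [Ring R] [Algebra Kqt R]

theorem map_piElt {R' : Type*} [Ring R'] [Algebra Kqt R'] (f : R →ₐ[Kqt] R') {n : ℕ}
    (T : Fin (n - 1) → R) (θ : Fin n → R) :
    f (piElt T θ) = piElt (fun i => f (T i)) (fun i => f (θ i)) := by
  unfold piElt
  split_ifs with h
  · rw [map_smul, map_mul, map_list_prod, List.map_ofFn]
    simp only [Function.comp_def, map_tinv]
  · exact map_one f

theorem DahaRel.map {R' : Type*} [Ring R'] [Algebra Kqt R'] (f : R →ₐ[Kqt] R') {n : ℕ}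
    {T : Fin (n - 1) → R} {θ X : Fin n → R} {x y : R} (h : DahaRel T θ X x y) :
    DahaRel (fun i => f (T i)) (fun i => f (θ i)) (fun i => f (X i)) (f x) (f y) := by
  cases h with
  | aff h => exact .aff (h.map f)
  | comm i j => rw [map_mul, map_mul]; exact DahaRel.comm i j
  | step i =>
    rw [map_smul, map_mul, map_mul, map_tinv]
    exact DahaRel.step i
  | far i j h₁ h₂ => rw [map_mul, map_mul]; exact DahaRel.far i j h₁ h₂
  | pi i => rw [map_mul, map_mul, map_piElt]; exact DahaRel.pi i
  | pi_last i j h₁ h₂ =>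
    rw [map_smul, map_mul, map_mul, map_piElt]; exact DahaRel.pi_last i j h₁ h₂

theorem tinv_heckeGen (s : R) : tinv (heckeGen s) = t⁻¹ • s := by
  rw [tinv, heckeGen, Algebra.algebraMap_eq_smul_one, sub_add_cancel]

theorem heckeGen_quadratic {s : R} (hs : s * s = (t - 1) • s + t • 1) :
    (heckeGen s - 1) * (heckeGen s + algebraMap Kqt R t) = 0 := by
  rw [heckeGen, Algebra.algebraMap_eq_smul_one]
  simp only [sub_mul, mul_add, mul_sub, hs, smul_mul_assoc, mul_smul_comm, mul_one, one_mul]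
  module

theorem heckeGen_mul_heckeGen_mul_heckeGen (a b : R) :
    heckeGen a * heckeGen b * heckeGen a =
      a * b * a - (t - 1) • (a * b + b * a) - (t - 1) • (a * a) +
        ((t - 1) * (t - 1)) • ((2 : Kqt) • a + b) - ((t - 1) * (t - 1) * (t - 1)) • (1 : R) := by
  simp only [heckeGen, sub_mul, mul_sub, smul_mul_assoc, mul_smul_comm, mul_one, one_mul, smul_sub]
  module

theorem heckeGen_braid {a b : R} (ha : a * a = (t - 1) • a + t • 1)
    (hb : b * b = (t - 1) • b + t • 1) (hab : a * b * a = b * a * b) :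
    heckeGen a * heckeGen b * heckeGen a = heckeGen b * heckeGen a * heckeGen b := by
  rw [heckeGen_mul_heckeGen_mul_heckeGen, heckeGen_mul_heckeGen_mul_heckeGen, hab, ha, hb]
  module

theorem heckeGen_commute {a b : R} (h : Commute a b) : Commute (heckeGen a) b :=
  h.sub_left ((Commute.one_left _).smul_left _)

theorem prod_ofFn_smul_eq_upProd (S : ℕ → R) (m : ℕ) :
    (List.ofFn fun i : Fin m => t⁻¹ • S i.1).prod = t⁻¹ ^ m • upProd S m := by
  induction m with
  | zero => simp [upProd]
  | succ m ih =>
    rw [List.ofFn_succ', List.concat_eq_append, List.prod_append]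
    simp only [Fin.val_castSucc, Fin.val_last, List.prod_cons, List.prod_nil, mul_one]
    rw [ih, smul_mul_smul_comm, pow_succ]
    rfl

namespace IntertwinerData

variable {n : ℕ} {S θ : ℕ → R} {Q : R}

theorem piElt_eq (hn : 0 < n) :
    piElt (n := n) (fun i => heckeGen (S i.1)) (fun i => θ i.1) = pi (n - 1) S θ := by
  rw [piElt, dif_pos hn]
  simp only [tinv_heckeGen]
  rw [prod_ofFn_smul_eq_upProd, mul_smul_comm, smul_smul, ← mul_pow, mul_inv_cancel₀ t_ne_zero,
    one_pow, one_smul]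
  rfl

theorem heckeRel (h : IntertwinerData (n - 1) S θ Q) {x y : R}
    (hxy : HeckeRel (n := n) (fun i => heckeGen (S i.1)) x y) : x = y := by
  cases hxy with
  | quad i => exact heckeGen_quadratic (h.sq i.1 i.2)
  | braid i j hij =>
    refine heckeGen_braid (h.sq i.1 i.2) (h.sq j.1 j.2) ?_
    rw [← hij]
    exact h.braid i.1 (by omega)
  | far i j hij =>
    refine heckeGen_commute (Commute.symm (heckeGen_commute ?_))
    rcases hij with hij | hij
    · exact (h.far _ _ hij j.2).symm
    · exact h.far _ _ hij i.2

theorem affRel (h : IntertwinerData (n - 1) S θ Q) {x y : R}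
    (hxy : AffRel (n := n) (fun i => heckeGen (S i.1)) (fun i => θ i.1) x y) : x = y := by
  cases hxy with
  | hecke hxy => exact h.heckeRel hxy
  | comm i j => exact h.theta_comm _ _ (by have := i.2; omega) (by have := j.2; omega)
  | step i =>
    have hs := h.theta_step i.1 i.2
    simp only [tinv_heckeGen, smul_mul_assoc, mul_smul_comm, lo, hi, hs, smul_smul]
    rw [mul_inv_cancel_left₀ t_ne_zero, inv_mul_cancel₀ t_ne_zero, one_smul]
  | far i j h₁ h₂ =>
    exact heckeGen_commute <| h.theta_far i.1 j.1 i.2 (by have := j.2; omega)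
      (fun e => h₁ (Fin.ext e)) (fun e => h₂ (Fin.ext e))

theorem dahaRel (h : IntertwinerData (n - 1) S θ Q) {x y : R}
    (hxy : DahaRel (n := n) (fun i => heckeGen (S i.1)) (fun i => θ i.1)
      (fun i => xSeq (n - 1) S θ Q i.1) x y) : x = y := by
  cases hxy with
  | aff hxy => exact h.affRel hxy
  | comm i j => exact h.xSeq_commute (by have := i.2; omega) (by have := j.2; omega)
  | step i =>
    simp only [tinv_heckeGen, smul_mul_assoc, mul_smul_comm, lo, hi, smul_smul]
    rw [mul_inv_cancel_left₀ t_ne_zero]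
    rfl
  | far i j h₁ h₂ =>
    exact heckeGen_commute <| h.s_commute_xSeq i.2 (by have := j.2; omega)
      (fun e => h₁ (Fin.ext e)) (fun e => h₂ (Fin.ext e))
  | pi i =>
    rw [piElt_eq (by have := i.2; omega)]
    exact h.pi_mul_xSeq i.2
  | pi_last i j h₁ h₂ =>
    rw [piElt_eq (by omega), show j.1 = n - 1 by omega, h₁, h.xSeq_last_eq]
    change _ = q • (q⁻¹ • (pi (n - 1) S θ * Q) * pi (n - 1) S θ)
    rw [smul_mul_assoc, smul_smul, mul_inv_cancel₀ q_ne_zero, one_smul, mul_assoc]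

end IntertwinerData

end Relations

/-! ## Actions of the algebras on the model -/

theorem induction_of_freeAlgebra_surjective {k X A : Type*} [CommSemiring k] [Semiring A]
    [Algebra k A] {f : FreeAlgebra k X →ₐ[k] A} (hf : Function.Surjective f) {P : A → Prop}
    (algebraMap : ∀ c, P (algebraMap k A c)) (ι : ∀ x, P (f (FreeAlgebra.ι k x)))
    (mul : ∀ a b, P a → P b → P (a * b)) (add : ∀ a b, P a → P b → P (a + b)) (a : A) : P a := by
  obtain ⟨x, rfl⟩ := hf a
  induction x using FreeAlgebra.induction with
  | grade0 c => rw [AlgHom.commutes]; exact algebraMap c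
  | grade1 x => exact ι x
  | mul a b ha hb => rw [map_mul]; exact mul _ _ ha hb
  | add a b ha hb => rw [map_add]; exact add _ _ ha hb

theorem Hecke.induction {n : ℕ} {P : Hecke n → Prop} (alg : ∀ k, P (algebraMap Kqt _ k))
    (T : ∀ i, P (Hecke.T i)) (mul : ∀ a b, P a → P b → P (a * b))
    (add : ∀ a b, P a → P b → P (a + b)) (a : Hecke n) : P a :=
  induction_of_freeAlgebra_surjective (f := Hecke.mk n)
    (RingQuot.mkAlgHom_surjective Kqt _) alg T mul add a

theorem Aff.induction {n : ℕ} {P : Aff n → Prop} (alg : ∀ k, P (algebraMap Kqt _ k))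
    (T : ∀ i, P (Aff.T i)) (θ : ∀ i, P (Aff.θ i)) (mul : ∀ a b, P a → P b → P (a * b))
    (add : ∀ a b, P a → P b → P (a + b)) (a : Aff n) : P a :=
  induction_of_freeAlgebra_surjective (f := Aff.mk n) (RingQuot.mkAlgHom_surjective Kqt _) alg
    (fun | .T i => T i | .θ i => θ i) mul add a

theorem Daha.induction {n : ℕ} {P : Daha n → Prop} (alg : ∀ k, P (algebraMap Kqt _ k))
    (T : ∀ i, P (Daha.T i)) (θ : ∀ i, P (Daha.θ i)) (X : ∀ i, P (Daha.X i))
    (mul : ∀ a b, P a → P b → P (a * b)) (add : ∀ a b, P a → P b → P (a + b)) (a : Daha n) : P a :=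
  induction_of_freeAlgebra_surjective (f := Daha.mk n) (RingQuot.mkAlgHom_surjective Kqt _) alg
    (fun | .T i => T i | .θ i => θ i | .X i => X i) mul add a

theorem Daha.rel {n : ℕ} (x y : Daha n) (h : DahaRel (n := n) Daha.T Daha.θ Daha.X x y) :
    x = y := by
  have mk_eq : ∀ {a b : FreeAlgebra Kqt (DahaGen n)}, dahaRel n a b →
      Daha.mk n a = Daha.mk n b := fun h => RingQuot.mkAlgHom_rel Kqt h
  have hpi : Daha.mk n (piElt (fun i => FreeAlgebra.ι Kqt (DahaGen.T i))
      (fun i => FreeAlgebra.ι Kqt (DahaGen.θ i))) = piElt Daha.T Daha.θ := map_piElt _ _ _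
  cases h with
  | aff h =>
    cases h with
    | hecke h =>
      cases h with
      | quad i => simpa [Daha.T] using mk_eq (.aff (.hecke (.quad i)))
      | braid i j h => simpa [Daha.T] using mk_eq (.aff (.hecke (.braid i j h)))
      | far i j h => simpa [Daha.T] using mk_eq (.aff (.hecke (.far i j h)))
    | comm i j => simpa [Daha.θ] using mk_eq (.aff (.comm i j))
    | step i => simpa [Daha.T, Daha.θ, map_tinv] using mk_eq (.aff (.step i))
    | far i j h₁ h₂ => simpa [Daha.T, Daha.θ] using mk_eq (.aff (.far i j h₁ h₂))
  | comm i j => simpa [Daha.X] using mk_eq (.comm i j)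
  | step i => simpa [Daha.T, Daha.X, map_tinv] using mk_eq (.step i)
  | far i j h₁ h₂ => simpa [Daha.T, Daha.X] using mk_eq (.far i j h₁ h₂)
  | pi i =>
    rw [← hpi]
    simpa [Daha.X] using mk_eq (.pi i)
  | pi_last i j h₁ h₂ =>
    rw [← hpi]
    simpa [Daha.X] using mk_eq (.pi_last i j h₁ h₂)

section SMulStabilizer

variable {R A M : Type*} [CommSemiring R] [Semiring A] [Algebra R A] [AddCommMonoid M] [Module R M]
  [Module A M] [IsScalarTower R A M]

variable (A) in
/-- The subalgebra of the elements of `A` that map the submodule `N` into itself. -/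
def smulStabilizer (N : Submodule R M) : Subalgebra R A where
  carrier := {a | ∀ v ∈ N, a • v ∈ N}
  mul_mem' ha hb v hv := by
    rw [mul_smul]
    exact ha _ (hb v hv)
  add_mem' ha hb v hv := by
    rw [add_smul]
    exact add_mem (ha v hv) (hb v hv)
  algebraMap_mem' k v hv := by
    rw [algebraMap_smul]
    exact N.smul_mem k hv

theorem mem_smulStabilizer_span {s : Set M} {a : A}
    (h : ∀ v ∈ s, a • v ∈ Submodule.span R s) : a ∈ smulStabilizer A (Submodule.span R s) :=
  Submodule.span_le (p := (Submodule.span R s).comap (Algebra.lsmul R R M a)).mpr h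

end SMulStabilizer

namespace Model

variable {lam : YoungDiagram}

/-- The operators `S_k`, indexed by natural numbers. -/
def sSeq (lam : YoungDiagram) (k : ℕ) : Module.End Kqt (Model lam) :=
  if h : k < lam.card - 1 then sOp ⟨k, h⟩ else 0

/-- The operators `θ_k`, indexed by natural numbers. -/
def thetaSeq (lam : YoungDiagram) (k : ℕ) : Module.End Kqt (Model lam) :=
  if h : k < lam.card then thetaOp ⟨k, h⟩ else 0

theorem sSeq_of_lt {k : ℕ} (h : k < lam.card - 1) : sSeq lam k = sOp ⟨k, h⟩ := dif_pos h

theorem thetaSeq_of_lt {k : ℕ} (h : k < lam.card) : thetaSeq lam k = thetaOp ⟨k, h⟩ := dif_pos h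

theorem thetaSeq_commute (i j : ℕ) : Commute (thetaSeq lam i) (thetaSeq lam j) := by
  unfold thetaSeq
  split_ifs
  exacts [thetaOp_comm _ _, Commute.zero_right _, Commute.zero_left _, Commute.zero_left _]

theorem intertwinerData (lam : YoungDiagram) :
    IntertwinerData (lam.card - 1) (sSeq lam) (thetaSeq lam) qOp where
  sq i h := by
    rw [sSeq_of_lt h]
    exact sOp_sq _
  braid i h := by
    rw [sSeq_of_lt h, sSeq_of_lt (Nat.lt_of_succ_lt h)]
    exact sOp_braid rfl
  far i j hij h := by
    rw [sSeq_of_lt h, sSeq_of_lt (by omega)]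
    exact sOp_far (Or.inl hij)
  theta_comm i j _ _ := thetaSeq_commute i j
  theta_step i h := by
    rw [sSeq_of_lt h, thetaSeq_of_lt (by omega : i < lam.card),
      thetaSeq_of_lt (by omega : i + 1 < lam.card)]
    exact sOp_theta_sOp ⟨i, h⟩
  theta_far i j hi hj h₁ h₂ := by
    rw [sSeq_of_lt hi, thetaSeq_of_lt (by omega : j < lam.card)]
    exact sOp_theta_far _ _ (fun hj => h₁ (Fin.val_eq_of_eq hj)) fun hj => h₂ (Fin.val_eq_of_eq hj)
  s_q i h := by
    rw [sSeq_of_lt h, sSeq_of_lt (Nat.lt_of_succ_lt h)]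
    exact sOp_qOp rfl
  s_q_q i h := by
    rw [sSeq_of_lt (by omega : i < lam.card - 1), sSeq_of_lt (by omega : 0 < lam.card - 1)]
    exact sOp_qOp_qOp rfl (show i + 2 = lam.card by omega)
  theta_q i h := by
    rw [thetaSeq_of_lt (by omega : i < lam.card), thetaSeq_of_lt (by omega : i + 1 < lam.card)]
    exact thetaOp_qOp rfl
  theta_q_last := by
    by_cases h : 0 < lam.card
    · rw [thetaSeq_of_lt h, thetaSeq_of_lt (by omega : lam.card - 1 < lam.card)]
      exact thetaOp_last_qOp rfl (Nat.sub_add_cancel h)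
    · simp [thetaSeq, h]

/-- The operators `X_i`. -/
def xOp (i : Fin lam.card) : Module.End Kqt (Model lam) :=
  IntertwinerData.xSeq (lam.card - 1) (sSeq lam) (thetaSeq lam) qOp i.1

/-- The images of the generators of `𝒟_n`. -/
def genOp : DahaGen lam.card → Module.End Kqt (Model lam)
  | .T i => heckeGen (sSeq lam i.1)
  | .θ i => thetaSeq lam i.1
  | .X i => xOp i

/-- The action of `𝒟_n` on the model. -/
def act (lam : YoungDiagram) : Daha lam.card →ₐ[Kqt] Module.End Kqt (Model lam) :=
  RingQuot.liftAlgHom Kqt ⟨FreeAlgebra.lift Kqt genOp, by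
    intro x y h
    have h' := h.map (FreeAlgebra.lift Kqt genOp)
    simp only [FreeAlgebra.lift_ι_apply] at h'
    exact (intertwinerData lam).dahaRel h'⟩

theorem act_mk (g : DahaGen lam.card) :
    act lam (Daha.mk lam.card (FreeAlgebra.ι Kqt g)) = genOp g :=
  (RingQuot.liftAlgHom_mkAlgHom_apply Kqt _ _ _).trans (FreeAlgebra.lift_ι_apply _ _)

/-- The action of `ℋ_n` on the model. -/
def heckeAct (lam : YoungDiagram) : Hecke lam.card →ₐ[Kqt] Module.End Kqt (Model lam) :=
  RingQuot.liftAlgHom Kqt ⟨FreeAlgebra.lift Kqt fun i => genOp (.T i), by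
    intro x y h
    have h' := h.map (FreeAlgebra.lift Kqt fun i => genOp (lam := lam) (.T i))
    simp only [FreeAlgebra.lift_ι_apply] at h'
    exact (intertwinerData lam).heckeRel h'⟩

theorem heckeAct_T (i : Fin (lam.card - 1)) : heckeAct lam (Hecke.T i) = heckeGen (sOp i) := by
  rw [← sSeq_of_lt i.2]
  exact (RingQuot.liftAlgHom_mkAlgHom_apply Kqt _ _ _).trans (FreeAlgebra.lift_ι_apply _ _)

instance : Module (Daha lam.card) (Model lam) := Module.compHom (Model lam) (act lam).toRingHom

theorem smul_def (a : Daha lam.card) (v : Model lam) : a • v = act lam a v := rfl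

instance : IsScalarTower Kqt (Daha lam.card) (Model lam) where
  smul_assoc k a v := by rw [smul_def, smul_def, map_smul]; rfl

instance : Module (Hecke lam.card) (Model lam) :=
  Module.compHom (Model lam) (heckeAct lam).toRingHom

theorem hecke_smul_def (a : Hecke lam.card) (v : Model lam) : a • v = heckeAct lam a v := rfl

instance : IsScalarTower Kqt (Hecke lam.card) (Model lam) where
  smul_assoc k a v := by rw [hecke_smul_def, hecke_smul_def, map_smul]; rfl

theorem T_smul (i : Fin (lam.card - 1)) (v : Model lam) :
    (Daha.T i : Daha lam.card) • v = sOp i v - (t - 1) • v := by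
  rw [smul_def, Daha.T, act_mk, genOp, sSeq_of_lt i.2]; rfl

theorem theta_smul (i : Fin lam.card) (v : Model lam) :
    (Daha.θ i : Daha lam.card) • v = thetaOp i v := by
  rw [smul_def, Daha.θ, act_mk, genOp, thetaSeq_of_lt i.2]

theorem X_smul (i : Fin lam.card) (v : Model lam) :
    (Daha.X i : Daha lam.card) • v = xOp i v := by
  rw [smul_def, Daha.X, act_mk, genOp]

end Model

/-! ## The map from the induced module to the model -/

theorem diagCoeff_right (x : ℕ × ℤ) : diagCoeff x (x.1, x.2 + 1) = -t := by
  have hne := wt_sub_ne_zero (x := x) (y := (x.1, x.2 + 1)) (by simp [Prod.ext_iff])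
  rw [diagCoeff, div_eq_iff hne]
  simp only [wt, zpow_add₀ t_ne_zero, zpow_one]
  ring

theorem diagCoeff_below (x : ℕ × ℤ) : diagCoeff (x.1, x.2 + 1) x = 1 := by
  have hne := wt_sub_ne_zero (x := (x.1, x.2 + 1)) (y := x) (by simp [Prod.ext_iff])
  rw [diagCoeff, div_eq_iff hne]
  simp only [wt, zpow_add₀ t_ne_zero, zpow_one]
  ring

namespace SYT

variable {lam : YoungDiagram}

theorem w_toPSYT (σ : SYT lam) (i : Fin lam.card) : σ.toPSYT.w i = 0 := rfl

theorem wt_datum (σ : SYT lam) (i : Fin lam.card) : wt (σ.toPSYT.datum i) = t ^ σ.toPSYT.c i := by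
  rw [wt, PSYT.datum, w_toPSYT, pow_zero, one_mul]

theorem c_eq_zero (σ : SYT lam) {i : Fin lam.card} (hi : i.1 = 0) : σ.toPSYT.c i = 0 := by
  set b := σ.toPSYT.box i with hb
  let corner : Box lam := ⟨(0, 0), mem_cells_of_le b (Nat.zero_le _) (Nat.zero_le _)⟩
  have hle : corner ≤ b := box_le_iff.mpr ⟨Nat.zero_le _, Nat.zero_le _⟩
  have hnot : ¬ corner < b := fun hlt => by
    have hlabel := σ.toPSYT.labelLt_of_lt hlt
    rw [hb, PSYT.toFun_box, LabelLt, w_toPSYT, Fin.lt_def, hi] at hlabel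
    exact hlabel.elim (lt_irrefl 0) fun h => Nat.not_lt_zero _ h.2
  rw [PSYT.c, ← hb, ← hle.eq_of_not_lt hnot]
  simp [content, corner]

theorem box_covBy (σ : SYT lam) {i : Fin (lam.card - 1)}
    (h : (σ.toPSYT.box (lo i)).1.1 = (σ.toPSYT.box (hi i)).1.1 ∨
      (σ.toPSYT.box (lo i)).1.2 = (σ.toPSYT.box (hi i)).1.2) :
    σ.toPSYT.box (lo i) ⋖ σ.toPSYT.box (hi i) := by
  refine σ.toPSYT.box_covBy_of_le i rfl ?_
  have hnot := σ.toPSYT.not_box_le_of_lt (i := lo i) (j := hi i) rfl (lo_lt_hi i)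
  rw [box_le_iff] at hnot ⊢
  omega

theorem adj (σ : SYT lam) {i : Fin (lam.card - 1)}
    (h : σ.toPSYT.box (lo i) ⋖ σ.toPSYT.box (hi i)) :
    Adj (σ.toPSYT.datum (lo i)) (σ.toPSYT.datum (hi i)) :=
  (σ.toPSYT.adj_iff i).mpr ⟨rfl, h⟩

end SYT

namespace Model

variable {lam : YoungDiagram}

theorem hecke_T_smul (i : Fin (lam.card - 1)) (v : Model lam) :
    (Hecke.T i : Hecke lam.card) • v = sOp i v - (t - 1) • v := by
  rw [hecke_smul_def, heckeAct_T]; rfl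

theorem hecke_tinv_smul (i : Fin (lam.card - 1)) (v : Model lam) :
    tinv (Hecke.T i : Hecke lam.card) • v = t⁻¹ • sOp i v := by
  rw [hecke_smul_def, map_tinv, heckeAct_T, tinv_heckeGen]; rfl

theorem hecke_t_tinv_smul (i : Fin (lam.card - 1)) (v : Model lam) :
    (t • tinv (Hecke.T i : Hecke lam.card)) • v = sOp i v := by
  rw [smul_assoc, hecke_tinv_smul, smul_inv_smul₀ t_ne_zero]

theorem sOp_e_of_adj {i : Fin (lam.card - 1)} {τ : PSYT lam}
    (h : Adj (τ.datum (lo i)) (τ.datum (hi i))) :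
    sOp i (e τ) = -diagCoeff (τ.datum (lo i)) (τ.datum (hi i)) • e τ := by
  rw [sOp_e, swapCoeff_of_adj h (τ.datum_lo_ne_hi i), zero_smul, zero_sub, neg_smul]

/-- The span of the basis vectors attached to standard Young tableaux, a model of the `ℋ_n`-module
attached to `λ`. -/
def stdSpan (lam : YoungDiagram) : Submodule Kqt (Model lam) :=
  Submodule.span Kqt (Set.range fun σ : SYT lam => e σ.toPSYT)

theorem stdSpan_le_iff {N : Submodule Kqt (Model lam)} :
    stdSpan lam ≤ N ↔ ∀ σ : SYT lam, e σ.toPSYT ∈ N := by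
  rw [stdSpan, Submodule.span_le, Set.range_subset_iff]; rfl

theorem e_mem_stdSpan (σ : SYT lam) : e σ.toPSYT ∈ stdSpan lam :=
  Submodule.subset_span ⟨σ, rfl⟩

theorem sOp_mem_stdSpan (i : Fin (lam.card - 1)) {v : Model lam} (hv : v ∈ stdSpan lam) :
    sOp i v ∈ stdSpan lam := by
  suffices hle : stdSpan lam ≤ (stdSpan lam).comap (sOp i) from hle hv
  refine stdSpan_le_iff.mpr fun σ => ?_
  obtain ⟨σ', hσ'⟩ := PSYT.exists_toPSYT_eq (τ := σ.toPSYT.swap i)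
    (by rw [PSYT.deg_swap, PSYT.deg_toPSYT])
  rw [Submodule.mem_comap, sOp_e, ← hσ']
  exact sub_mem (Submodule.smul_mem _ _ (e_mem_stdSpan _))
    (Submodule.smul_mem _ _ (e_mem_stdSpan _))

theorem hecke_smul_mem_stdSpan (a : Hecke lam.card) {v : Model lam} (hv : v ∈ stdSpan lam) :
    a • v ∈ stdSpan lam := by
  suffices ha : a ∈ smulStabilizer (Hecke lam.card) (stdSpan lam) from ha v hv
  refine Hecke.induction (algebraMap_mem _) (fun i v hv => ?_) (fun _ _ => mul_mem)
    (fun _ _ => add_mem) a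
  rw [hecke_T_smul]
  exact sub_mem (sOp_mem_stdSpan i hv) (Submodule.smul_mem _ _ hv)

theorem thetaOp_zero_apply {i : Fin lam.card} (hi : i.1 = 0) {v : Model lam}
    (hv : v ∈ stdSpan lam) : thetaOp i v = v := by
  suffices hle : stdSpan lam ≤ LinearMap.eqLocus (thetaOp i) (1 : Module.End Kqt (Model lam)) from
    hle hv
  refine stdSpan_le_iff.mpr fun σ => ?_
  rw [LinearMap.mem_eqLocus, thetaOp_e, SYT.wt_datum, σ.c_eq_zero hi, zpow_zero, one_smul,
    Module.End.one_apply]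

theorem thetaBarAux_smul {k : ℕ} (hk : k < lam.card) {v : Model lam} (hv : v ∈ stdSpan lam) :
    (thetaBarAux Hecke.T k : Hecke lam.card) • v = thetaOp ⟨k, hk⟩ v := by
  induction k generalizing v with
  | zero => rw [thetaBarAux, one_smul, thetaOp_zero_apply rfl hv]
  | succ k ih =>
    have hk' : k < lam.card - 1 := by omega
    have hstep : sOp ⟨k, hk'⟩ (thetaOp ⟨k, by omega⟩ (sOp ⟨k, hk'⟩ v)) =
        t • thetaOp ⟨k + 1, hk⟩ v :=
      LinearMap.congr_fun (sOp_theta_sOp (lam := lam) ⟨k, hk'⟩) v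
    rw [thetaBarAux, dif_pos hk', smul_assoc, mul_smul, mul_smul, hecke_tinv_smul,
      hecke_tinv_smul, ih (by omega) (Submodule.smul_mem _ _ (sOp_mem_stdSpan _ hv)), map_smul,
      map_smul, hstep, smul_inv_smul₀ t_ne_zero, inv_smul_smul₀ t_ne_zero]

theorem thetaBar_smul {v : Model lam} (hv : v ∈ stdSpan lam) (i : Fin lam.card) :
    (Hecke.thetaBar i : Hecke lam.card) • v = thetaOp i v :=
  thetaBarAux_smul i.2 hv

theorem phiBar_smul_e {i : Fin (lam.card - 1)} {σ σ' : SYT lam}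
    (h : PSYT.SwapUp i σ.toPSYT σ'.toPSYT) :
    (Hecke.phiBar i : Hecke lam.card) • e σ.toPSYT =
      (wt (σ.toPSYT.datum (lo i)) - wt (σ.toPSYT.datum (hi i))) • e σ'.toPSYT := by
  obtain ⟨hup, hσ'⟩ := PSYT.swapUp_iff.mp h
  have hθ : thetaOp (lo i) (e σ'.toPSYT) = wt (σ.toPSYT.datum (hi i)) • e σ'.toPSYT := by
    rw [thetaOp_e, hσ', PSYT.datum_swap hup.not_adj, Function.comp_apply, Equiv.swap_apply_left]
  have hs : sOp i (e σ.toPSYT) = e σ'.toPSYT -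
      diagCoeff (σ.toPSYT.datum (lo i)) (σ.toPSYT.datum (hi i)) • e σ.toPSYT := by
    rw [sOp_e, swapCoeff_of_up hup, one_smul, hσ']
  rw [Hecke.phiBar, sub_smul, mul_smul, mul_smul, hecke_t_tinv_smul, hecke_t_tinv_smul,
    thetaBar_smul (e_mem_stdSpan σ), thetaBar_smul (sOp_mem_stdSpan _ (e_mem_stdSpan σ)),
    thetaOp_e, map_smul, hs, map_sub, map_smul, hθ, thetaOp_e]
  module

theorem hecke_T_smul_e_of_row {i : Fin (lam.card - 1)} {σ : SYT lam}
    (h : (σ.toPSYT.box (lo i)).1.1 = (σ.toPSYT.box (hi i)).1.1) :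
    (Hecke.T i : Hecke lam.card) • e σ.toPSYT = e σ.toPSYT := by
  have hcov := σ.box_covBy (Or.inl h)
  have hdatum : σ.toPSYT.datum (hi i) =
      ((σ.toPSYT.datum (lo i)).1, (σ.toPSYT.datum (lo i)).2 + 1) := by
    have := box_covBy_iff.mp hcov
    refine Prod.ext rfl ?_
    simp only [PSYT.datum, PSYT.c, content]
    omega
  rw [hecke_T_smul, sOp_e_of_adj (σ.adj hcov), hdatum, diagCoeff_right]
  module

theorem hecke_T_smul_e_of_col {i : Fin (lam.card - 1)} {σ : SYT lam}
    (h : (σ.toPSYT.box (lo i)).1.2 = (σ.toPSYT.box (hi i)).1.2) :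
    (Hecke.T i : Hecke lam.card) • e σ.toPSYT = (-t) • e σ.toPSYT := by
  have hcov := σ.box_covBy (Or.inr h)
  have hdatum : σ.toPSYT.datum (lo i) =
      ((σ.toPSYT.datum (hi i)).1, (σ.toPSYT.datum (hi i)).2 + 1) := by
    have := box_covBy_iff.mp hcov
    refine Prod.ext rfl ?_
    simp only [PSYT.datum, PSYT.c, content]
    omega
  rw [hecke_T_smul, sOp_e_of_adj (σ.adj hcov), hdatum, diagCoeff_below]
  module

/-- The `ℋ_n`-linear map from the free module on the standard Young tableaux to the model. -/
def stdMap (lam : YoungDiagram) : (SYT lam →₀ Hecke lam.card) →ₗ[Hecke lam.card] Model lam :=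
  Finsupp.linearCombination (Hecke lam.card) fun σ : SYT lam => e σ.toPSYT

theorem stdMap_single (σ : SYT lam) : stdMap lam (Finsupp.single σ 1) = e σ.toPSYT := by
  rw [stdMap, Finsupp.linearCombination_single, one_smul]

theorem stdMap_scalar_smul_single (k : Kqt) (σ : SYT lam) :
    stdMap lam (k • Finsupp.single σ 1) = k • e σ.toPSYT := by
  rw [← algebraMap_smul (Hecke lam.card) k, map_smul, stdMap_single, algebraMap_smul]

theorem stdMap_eq_of_spechtRel {x y : SYT lam →₀ Hecke lam.card} (h : SpechtRel lam x y) :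
    stdMap lam x = stdMap lam y := by
  cases h with
  | theta i σ =>
    rw [map_smul, stdMap_single, stdMap_scalar_smul_single, thetaBar_smul (e_mem_stdSpan σ),
      thetaOp_e, SYT.wt_datum]
  | phi i σ σ' h =>
    rw [map_smul, stdMap_single, stdMap_scalar_smul_single, phiBar_smul_e h, SYT.wt_datum,
      SYT.wt_datum]
  | row i σ h => rw [map_smul, stdMap_single, hecke_T_smul_e_of_row h]
  | col i σ h =>
    rw [map_smul, stdMap_single, stdMap_scalar_smul_single, hecke_T_smul_e_of_col h]

/-- The map from the `ℋ_n`-module attached to `λ` to the model. -/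
def spechtMap (lam : YoungDiagram) : Specht lam →ₗ[Hecke lam.card] Model lam :=
  (spechtSub lam).liftQ (stdMap lam) (by
    rw [Submodule.span_le]
    rintro _ ⟨x, y, h, rfl⟩
    rw [SetLike.mem_coe, LinearMap.mem_ker, map_sub, stdMap_eq_of_spechtRel h, sub_self])

theorem spechtMap_vec (σ : SYT lam) : spechtMap lam (Specht.vec σ) = e σ.toPSYT :=
  ((spechtSub lam).liftQ_apply _ _).trans (stdMap_single σ)

theorem spechtMap_mem_stdSpan (m : Specht lam) : spechtMap lam m ∈ stdSpan lam := by
  obtain ⟨x, rfl⟩ := (spechtSub lam).mkQ_surjective m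
  have hx : spechtMap lam ((spechtSub lam).mkQ x) = stdMap lam x := (spechtSub lam).liftQ_apply _ x
  rw [hx, stdMap, Finsupp.linearCombination_apply]
  exact Submodule.sum_mem _ fun σ _ => hecke_smul_mem_stdSpan _ (e_mem_stdSpan σ)

theorem aff_smul_specht (a : Aff lam.card) (m : Specht lam) : a • m = rho lam.card a • m := rfl

theorem spechtMap_aff_smul (a : Aff lam.card) (m : Specht lam) :
    spechtMap lam (a • m) = incl lam.card a • spechtMap lam m := by
  induction a using Aff.induction generalizing m with
  | alg k =>
    rw [aff_smul_specht, AlgHom.commutes, AlgHom.commutes, map_smul, algebraMap_smul,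
      algebraMap_smul]
  | T i => rw [aff_smul_specht, rho_T, incl_T, map_smul, hecke_T_smul, T_smul]
  | θ i =>
    rw [aff_smul_specht, rho_θ, incl_θ, map_smul, thetaBar_smul (spechtMap_mem_stdSpan m),
      theta_smul]
  | mul a b ha hb => rw [mul_smul, ha, hb, map_mul, mul_smul]
  | add a b ha hb => rw [add_smul, map_add, ha, hb, map_add, add_smul]

/-- The map `𝒟_n ⊗_K ρ_n^*(λ) → Model`. -/
def tensorMap (lam : YoungDiagram) :
    Daha lam.card ⊗[Kqt] Specht lam →ₗ[Daha lam.card] Model lam :=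
  TensorProduct.AlgebraTensorModule.lift
    { toFun := fun a => (act lam a).comp ((spechtMap lam).restrictScalars Kqt)
      map_add' := fun a b => by ext m; simp
      map_smul' := fun a b => by ext m; simp [smul_def] }

theorem tensorMap_tmul (a : Daha lam.card) (m : Specht lam) :
    tensorMap lam (a ⊗ₜ m) = a • spechtMap lam m := rfl

/-- The map `V_λ → Model`. -/
def ofV (lam : YoungDiagram) : V lam →ₗ[Daha lam.card] Model lam :=
  (inducedSub lam).liftQ (tensorMap lam) (by
    rw [Submodule.span_le]
    rintro _ ⟨d, a, m, rfl⟩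
    rw [SetLike.mem_coe, LinearMap.mem_ker, map_sub, tensorMap_tmul, tensorMap_tmul,
      spechtMap_aff_smul, mul_smul, sub_self])

theorem ofV_tmul (a : Daha lam.card) (m : Specht lam) :
    ofV lam (V.tmul a m) = a • spechtMap lam m :=
  ((inducedSub lam).liftQ_apply _ _).trans (tensorMap_tmul a m)

theorem e_swap_mem {N : Submodule Kqt (Model lam)} {i : Fin (lam.card - 1)} {τ : PSYT lam}
    (hτ : e τ ∈ N) (hs : sOp i (e τ) ∈ N) : e (τ.swap i) ∈ N := by
  by_cases ha : Adj (τ.datum (lo i)) (τ.datum (hi i))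
  · rwa [PSYT.swap_of_adj ha]
  · have hsum := N.add_mem hs (N.smul_mem (diagCoeff (τ.datum (lo i)) (τ.datum (hi i))) hτ)
    rw [sOp_e, sub_add_cancel] at hsum
    exact (N.smul_mem_iff (swapCoeff_ne_zero ha)).mp hsum

theorem sOp_mem_of_T_smul_mem {N : Submodule Kqt (Model lam)} {i : Fin (lam.card - 1)}
    {v : Model lam} (hv : v ∈ N) (hT : (Daha.T i : Daha lam.card) • v ∈ N) : sOp i v ∈ N := by
  rw [T_smul] at hT
  simpa using N.add_mem hT (N.smul_mem (t - 1) hv)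

section DahaSubmodule

variable {N : Submodule (Daha lam.card) (Model lam)}

theorem downProd_mem {k : ℕ} (hk : k ≤ lam.card - 1) {v : Model lam} (hv : v ∈ N) :
    downProd (fun i => heckeGen (sSeq lam i)) k v ∈ N := by
  induction k with
  | zero => exact hv
  | succ k ih =>
    have hT := N.smul_mem (Daha.T ⟨k, hk⟩) (ih (by omega))
    rwa [T_smul, ← sSeq_of_lt hk] at hT

theorem qOp_theta_zero_mem (h : 0 < lam.card) {v : Model lam} (hv : v ∈ N) :
    qOp (thetaOp ⟨0, h⟩ v) ∈ N := by
  have hX := N.smul_mem (Daha.X ⟨lam.card - 1, by omega⟩) (downProd_mem le_rfl hv)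
  have hQ := LinearMap.congr_fun (intertwinerData lam).q_mul_theta_zero v
  rw [X_smul, xOp, ← Module.End.mul_apply, ← hQ, thetaSeq_of_lt h] at hX
  exact ((N.restrictScalars Kqt).smul_mem_iff (pow_ne_zero _ t_ne_zero)).mp hX

theorem e_psi_mem {τ : PSYT lam} (hτ : e τ ∈ N) : e τ.psi ∈ N := by
  by_cases h : 0 < lam.card
  · have hQ : qOp (thetaOp ⟨0, h⟩ (e τ)) ∈ N.restrictScalars Kqt := qOp_theta_zero_mem h hτ
    rwa [thetaOp_e, map_smul, qOp_e, Submodule.smul_mem_iff _ (wt_ne_zero _),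
      Submodule.smul_mem_iff _ (inv_ne_zero (pow_ne_zero _ q_ne_zero))] at hQ
  · have hpsi : τ.psi = τ := PSYT.ext (funext fun b => absurd (τ.toFun b).1.pos h)
    rwa [hpsi]

theorem eq_top_of_forall_e_toPSYT_mem (hN : ∀ σ : SYT lam, e σ.toPSYT ∈ N) : N = ⊤ := by
  have he (τ : PSYT lam) : e τ ∈ N :=
    PSYT.induction_swap_psi (P := fun τ => e τ ∈ N) hN
      (fun i τ h => e_swap_mem (N := N.restrictScalars Kqt) h
        (sOp_mem_of_T_smul_mem h (N.smul_mem _ h))) (fun τ h => e_psi_mem h) τ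
  rw [← Submodule.restrictScalars_eq_top_iff Kqt, eq_top_iff, ← e.span_eq, Submodule.span_le,
    Set.range_subset_iff]
  exact he

end DahaSubmodule

theorem ofV_surjective : Function.Surjective (ofV lam) := by
  rw [← LinearMap.range_eq_top]
  refine eq_top_of_forall_e_toPSYT_mem fun σ => ⟨V.tmul 1 (Specht.vec σ), ?_⟩
  rw [ofV_tmul, spechtMap_vec, one_smul]

end Model

/-! ## Monomials span the induced module -/

section Relations

variable {R : Type*} [Ring R] [Algebra Kqt R]

theorem smul_tinv (x : R) : t • tinv x = x + (t - 1) • 1 := by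
  rw [tinv, smul_inv_smul₀ t_ne_zero, Algebra.algebraMap_eq_smul_one]

theorem tinv_mem {S : Subalgebra Kqt R} {x : R} (hx : x ∈ S) : tinv x ∈ S :=
  S.smul_mem (add_mem hx (S.algebraMap_mem _)) _

theorem prod_map_tinv_mul_prod_reverse_map {ι : Type*} {T : ι → R}
    (hT : ∀ i, (T i - 1) * (T i + algebraMap Kqt R t) = 0) (l : List ι) :
    (l.map fun i => tinv (T i)).prod * (l.reverse.map T).prod = 1 := by
  induction l with
  | nil => simp
  | cons i l ih =>
    rw [List.map_cons, List.prod_cons, List.reverse_cons, List.map_append, List.prod_append,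
      mul_assoc, ← mul_assoc _ _ (List.map T [i]).prod, ih, one_mul, List.map_singleton,
      List.prod_singleton, tinv_mul (hT i)]

variable {x y : R} (h : (x - 1) * (x + algebraMap Kqt R t) = 0)
include h

theorem mul_self_of_quadratic : x * x = (1 - t) • x + t • 1 := by
  have hinv : x * (t • tinv x) = t • 1 := by rw [mul_smul_comm, mul_tinv h]
  rw [smul_tinv, mul_add, mul_smul_comm, mul_one] at hinv
  rw [eq_sub_of_add_eq hinv]
  module

theorem mul_conj_tinv : x * (t • (tinv x * y * tinv x)) = y * x + (t - 1) • y := by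
  rw [mul_assoc, mul_smul_comm, ← mul_assoc, mul_tinv h, one_mul, ← mul_smul_comm, smul_tinv,
    mul_add, mul_smul_comm, mul_one]

theorem conj_tinv_mul : t • (tinv x * y * tinv x) * x = x * y + (t - 1) • y := by
  rw [smul_mul_assoc, mul_assoc, tinv_mul h, mul_one, ← smul_mul_assoc, smul_tinv, add_mul,
    smul_mul_assoc, one_mul]

end Relations

theorem Hecke.phiBar_smul {n : ℕ} {M : Type*} [AddCommGroup M] [Module Kqt M] [Module (Hecke n) M]
    [IsScalarTower Kqt (Hecke n) M] {i : Fin (n - 1)} {v : M} {a b : Kqt}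
    (ha : (Hecke.thetaBar (lo i) : Hecke n) • v = a • v)
    (hb : (Hecke.thetaBar (hi i) : Hecke n) • v = b • v) :
    (Hecke.phiBar i : Hecke n) • v = (a - b) • (Hecke.T i : Hecke n) • v + ((t - 1) * a) • v := by
  have hstep : (Hecke.thetaBar (hi i) : Hecke n) =
      t • (tinv (Hecke.T i) * Hecke.thetaBar (lo i) * tinv (Hecke.T i)) :=
    affRel_thetaBarAux Hecke.rel (.step i)
  have hphi : (Hecke.phiBar i : Hecke n) = Hecke.T i * Hecke.thetaBar (lo i) -
      Hecke.T i * Hecke.thetaBar (hi i) + (t - 1) • Hecke.thetaBar (lo i) := by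
    rw [hstep, mul_conj_tinv (Hecke.rel _ _ (.quad i)), Hecke.phiBar, smul_tinv, add_mul, mul_add,
      smul_mul_assoc, mul_smul_comm, one_mul, mul_one]
    abel
  rw [hphi, add_smul, sub_smul, mul_smul, mul_smul, smul_assoc (t - 1), ha, hb,
    smul_comm (Hecke.T i) a, smul_comm (Hecke.T i) b]
  generalize (Hecke.T i : Hecke n) • v = w
  module

namespace Specht

variable {lam : YoungDiagram}

theorem rel {x y : SYT lam →₀ Hecke lam.card} (h : SpechtRel lam x y) :
    (spechtSub lam).mkQ x = (spechtSub lam).mkQ y := by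
  rw [← sub_eq_zero, ← map_sub]
  exact (Submodule.Quotient.mk_eq_zero _).mpr (Submodule.subset_span ⟨x, y, h, rfl⟩)

/-- The span over `ℚ(q,t)` of the standard Young tableaux. -/
def vecSpan (lam : YoungDiagram) : Submodule Kqt (Specht lam) :=
  Submodule.span Kqt (Set.range vec)

theorem vec_mem_vecSpan (σ : SYT lam) : vec σ ∈ vecSpan lam := Submodule.subset_span ⟨σ, rfl⟩

theorem vec_of_swapUp {i : Fin (lam.card - 1)} {σ σ' : SYT lam}
    (h : PSYT.SwapUp i σ.toPSYT σ'.toPSYT) :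
    vec σ' = (Hecke.T i : Hecke lam.card) • vec σ +
      ((t ^ σ.toPSYT.c (lo i) - t ^ σ.toPSYT.c (hi i))⁻¹ * ((t - 1) * t ^ σ.toPSYT.c (lo i))) •
        vec σ := by
  have hne : t ^ σ.toPSYT.c (lo i) - t ^ σ.toPSYT.c (hi i) ≠ 0 := by
    rw [← SYT.wt_datum, ← SYT.wt_datum]
    exact wt_sub_ne_zero (PSYT.datum_lo_ne_hi _ _)
  have hphi : (Hecke.phiBar i : Hecke lam.card) • vec σ =
      (t ^ σ.toPSYT.c (lo i) - t ^ σ.toPSYT.c (hi i)) • vec σ' := rel (.phi i σ σ' h)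
  rw [Hecke.phiBar_smul (rel (.theta (lo i) σ)) (rel (.theta (hi i) σ))] at hphi
  rw [← inv_smul_smul₀ hne (vec σ'), ← hphi, smul_add, inv_smul_smul₀ hne, smul_smul]

theorem T_smul_vec_mem_of_swapUp {i : Fin (lam.card - 1)} {σ σ' : SYT lam}
    (h : PSYT.SwapUp i σ.toPSYT σ'.toPSYT) :
    (Hecke.T i : Hecke lam.card) • vec σ ∈ vecSpan lam := by
  rw [eq_sub_of_add_eq (vec_of_swapUp h).symm]
  exact sub_mem (vec_mem_vecSpan _) (Submodule.smul_mem _ _ (vec_mem_vecSpan _))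

theorem T_smul_vec_mem_of_swapUp_right {i : Fin (lam.card - 1)} {σ σ' : SYT lam}
    (h : PSYT.SwapUp i σ.toPSYT σ'.toPSYT) :
    (Hecke.T i : Hecke lam.card) • vec σ' ∈ vecSpan lam := by
  have hT := T_smul_vec_mem_of_swapUp h
  have hvec := vec_of_swapUp h
  generalize (_ * _ : Kqt) = k at hvec
  rw [hvec, smul_add, ← mul_smul, mul_self_of_quadratic (Hecke.rel _ _ (.quad i)), add_smul,
    smul_assoc (1 - t), smul_assoc t, one_smul, smul_comm (Hecke.T i) k]
  exact add_mem (add_mem (Submodule.smul_mem _ _ hT) (Submodule.smul_mem _ _ (vec_mem_vecSpan _)))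
    (Submodule.smul_mem _ _ hT)

theorem T_smul_vec_mem (i : Fin (lam.card - 1)) (σ : SYT lam) :
    (Hecke.T i : Hecke lam.card) • vec σ ∈ vecSpan lam := by
  by_cases ha : Adj (σ.toPSYT.datum (lo i)) (σ.toPSYT.datum (hi i))
  · rcases box_covBy_iff.mp ((PSYT.adj_iff _ _).mp ha).2 with hcol | hrow
    · have hT : (Hecke.T i : Hecke lam.card) • vec σ = (-t) • vec σ := rel (.col i σ hcol.2)
      rw [hT]
      exact Submodule.smul_mem _ _ (vec_mem_vecSpan σ)
    · have hT : (Hecke.T i : Hecke lam.card) • vec σ = vec σ := rel (.row i σ hrow.2)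
      rw [hT]
      exact vec_mem_vecSpan σ
  · obtain ⟨σ', hσ'⟩ := PSYT.exists_toPSYT_eq (τ := σ.toPSYT.swap i)
      (by rw [PSYT.deg_swap, PSYT.deg_toPSYT])
    rcases up_or_up_of_not_adj ha with hup | hup
    · exact T_smul_vec_mem_of_swapUp (PSYT.swapUp_iff.mpr ⟨hup, hσ'⟩)
    · refine T_smul_vec_mem_of_swapUp_right (σ := σ') ?_
      rw [PSYT.swapUp_iff, hσ', PSYT.swap_swap, PSYT.datum_swap ha]
      simpa using hup

theorem hecke_smul_mem_vecSpan (a : Hecke lam.card) {m : Specht lam} (hm : m ∈ vecSpan lam) :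
    a • m ∈ vecSpan lam := by
  suffices ha : a ∈ smulStabilizer (Hecke lam.card) (vecSpan lam) from ha m hm
  refine Hecke.induction (algebraMap_mem _) (fun i => mem_smulStabilizer_span ?_)
    (fun _ _ => mul_mem) (fun _ _ => add_mem) a
  rintro _ ⟨σ, rfl⟩
  exact T_smul_vec_mem i σ

theorem vecSpan_eq_top (lam : YoungDiagram) : vecSpan lam = ⊤ := by
  rw [eq_top_iff]
  rintro m -
  obtain ⟨x, rfl⟩ := (spechtSub lam).mkQ_surjective m
  induction x using Finsupp.induction_linear with
  | zero => rw [map_zero]; exact zero_mem _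
  | add x y hx hy => rw [map_add]; exact add_mem hx hy
  | single σ a =>
    rw [← mul_one a, ← smul_eq_mul, ← Finsupp.smul_single, map_smul]
    exact hecke_smul_mem_vecSpan a (vec_mem_vecSpan σ)

end Specht

namespace V

variable {lam : YoungDiagram}

theorem incl_smul_tmul (a : Aff lam.card) (m : Specht lam) :
    incl lam.card a • tmul 1 m = tmul 1 (a • m) := by
  refine (Submodule.Quotient.eq (inducedSub lam)).mpr (Submodule.subset_span ⟨1, a, m, ?_⟩)
  rw [one_mul]
  change (incl lam.card a * 1) ⊗ₜ[Kqt] m - _ = _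
  rw [mul_one]

/-- The map `m ↦ 1 ⊗ m`. -/
def ofSpecht (lam : YoungDiagram) : Specht lam →ₗ[Kqt] V lam where
  toFun := tmul 1
  map_add' m m' := by
    rw [tmul, TensorProduct.tmul_add, map_add]; rfl
  map_smul' k m := by
    rw [tmul, TensorProduct.tmul_smul]; rfl

/-- The commutative subalgebra of `𝒟_n` generated by the `X_i`, in which the monomials `X^α` are
formed. -/
def xAlg (n : ℕ) : Subalgebra Kqt (Daha n) :=
  Algebra.adjoin Kqt (Set.range Daha.X)

instance (n : ℕ) : IsMulCommutative (xAlg n) :=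
  Algebra.isMulCommutative_adjoin Kqt (by
    rintro _ ⟨i, rfl⟩ _ ⟨j, rfl⟩
    exact Daha.rel _ _ (.comm i j))

open scoped IsMulCommutative

/-- The monomial `X^α` in `𝒟_n`. -/
def mon {n : ℕ} (α : Fin n → ℕ) : Daha n :=
  ((∏ i, (⟨Daha.X i, Algebra.subset_adjoin ⟨i, rfl⟩⟩ : xAlg n) ^ α i : xAlg n) : Daha n)

theorem mon_zero {n : ℕ} : mon (0 : Fin n → ℕ) = 1 := by
  simp only [mon, Pi.zero_apply, pow_zero, Finset.prod_const_one, OneMemClass.coe_one]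

theorem prod_pow_add_single {ι R : Type*} [Fintype ι] [DecidableEq ι] [CommMonoid R] (x : ι → R)
    (i : ι) (α : ι → ℕ) : ∏ j, x j ^ (α + Pi.single i 1 : ι → ℕ) j = x i * ∏ j, x j ^ α j := by
  simp only [Pi.add_apply, pow_add, Finset.prod_mul_distrib, Pi.single_apply, pow_ite, pow_one,
    pow_zero, Finset.prod_ite_eq', Finset.mem_univ, if_true, mul_comm]

theorem X_mul_mon {n : ℕ} (i : Fin n) (α : Fin n → ℕ) :
    Daha.X i * mon α = mon (α + Pi.single i 1) := by
  rw [mon, mon, prod_pow_add_single]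
  rfl

theorem exponent_induction {n : ℕ} {P : (Fin n → ℕ) → Prop} (zero : P 0)
    (add : ∀ i β, P β → P (β + Pi.single i 1)) (α : Fin n → ℕ) : P α := by
  have hspan : Submodule.span ℕ (Set.range fun i : Fin n => (Pi.single i 1 : Fin n → ℕ)) = ⊤ := by
    rw [← (Pi.basisFun ℕ (Fin n)).span_eq]
    congr with i
    rw [Pi.basisFun_apply]
  have hclosure := Submodule.span_nat_eq_addSubmonoidClosure
    (Set.range fun i : Fin n => (Pi.single i 1 : Fin n → ℕ))
  rw [hspan, Submodule.top_toAddSubmonoid, eq_comm] at hclosure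
  refine AddSubmonoid.induction_of_closure_eq_top_right hclosure α zero ?_
  rintro β _ ⟨i, rfl⟩
  exact add i β

/-- The vectors `X^α ⊗ σ`, which span `V_λ`. -/
def monVec (p : (Fin lam.card → ℕ) × SYT lam) : V lam := mon p.1 • tmul 1 (Specht.vec p.2)

/-- The span of the vectors `X^α ⊗ σ`. -/
def monSpan (lam : YoungDiagram) : Submodule Kqt (V lam) := Submodule.span Kqt (Set.range monVec)

theorem monVec_mem_monSpan (p : (Fin lam.card → ℕ) × SYT lam) : monVec p ∈ monSpan lam :=
  Submodule.subset_span ⟨p, rfl⟩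

theorem one_tmul_mem_monSpan (m : Specht lam) : tmul 1 m ∈ monSpan lam := by
  suffices hle : Specht.vecSpan lam ≤ (monSpan lam).comap (ofSpecht lam) from
    hle (Specht.vecSpan_eq_top lam ▸ Submodule.mem_top)
  rw [Specht.vecSpan, Submodule.span_le, Set.range_subset_iff]
  intro σ
  have h := monVec_mem_monSpan ((0 : Fin lam.card → ℕ), σ)
  rwa [monVec, mon_zero, one_smul] at h

theorem incl_smul_one_tmul_mem_monSpan (a : Aff lam.card) (m : Specht lam) :
    incl lam.card a • tmul 1 m ∈ monSpan lam := by
  rw [incl_smul_tmul]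
  exact one_tmul_mem_monSpan _

/-- The subalgebra of the elements of `𝒟_n` that preserve the span of the vectors `X^α ⊗ σ`. It
turns out to be all of `𝒟_n`. -/
abbrev monStabilizer (lam : YoungDiagram) : Subalgebra Kqt (Daha lam.card) :=
  smulStabilizer (Daha lam.card) (monSpan lam)

theorem X_mem_monStabilizer (i : Fin lam.card) : Daha.X i ∈ monStabilizer lam := by
  refine mem_smulStabilizer_span ?_
  rintro _ ⟨p, rfl⟩
  rw [monVec, ← mul_smul, X_mul_mon]
  exact monVec_mem_monSpan (_, p.2)

theorem mem_monStabilizer {a : Daha lam.card} (one : ∀ m, a • tmul 1 m ∈ monSpan lam)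
    (X : ∀ i, ∀ v ∈ monSpan lam, a • v ∈ monSpan lam →
      (a * Daha.X i : Daha lam.card) • v ∈ monSpan lam) : a ∈ monStabilizer lam := by
  refine mem_smulStabilizer_span ?_
  rintro _ ⟨⟨α, σ⟩, rfl⟩
  induction α using exponent_induction with
  | zero =>
    rw [monVec, mon_zero, one_smul]
    exact one _
  | add i β ih =>
    rw [monVec, ← X_mul_mon, mul_smul, ← mul_smul a]
    exact X i _ (monVec_mem_monSpan (β, σ)) ih

theorem T_mem_monStabilizer (i : Fin (lam.card - 1)) : Daha.T i ∈ monStabilizer lam := by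
  have hquad := Daha.rel (n := lam.card) _ _ (.aff (.hecke (.quad i)))
  have hstep := Daha.rel (n := lam.card) _ _ (.step i)
  refine mem_monStabilizer (fun m => ?_) fun j v hv hT => ?_
  · rw [← incl_T]
    exact incl_smul_one_tmul_mem_monSpan _ m
  have hX (j : Fin lam.card) {v : V lam} (hv : v ∈ monSpan lam) := X_mem_monStabilizer j v hv
  by_cases hlo : j = lo i
  · rw [hlo, eq_sub_of_add_eq (conj_tinv_mul hquad).symm, ← hstep, sub_smul, mul_smul, smul_assoc]
    exact sub_mem (hX _ hT) (Submodule.smul_mem _ _ (hX _ hv))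
  by_cases hhi : j = hi i
  · rw [hhi, hstep, mul_conj_tinv hquad, add_smul, mul_smul, smul_assoc]
    exact add_mem (hX _ hT) (Submodule.smul_mem _ _ (hX _ hv))
  · rw [Daha.rel _ _ (.far i j hlo hhi), mul_smul]
    exact hX _ hT

theorem incl_pi (n : ℕ) : incl n (Aff.pi n) = piElt Daha.T Daha.θ := by
  rw [Aff.pi, map_piElt]
  simp only [incl_T, incl_θ]

theorem pi_mem_monStabilizer : piElt Daha.T Daha.θ ∈ monStabilizer lam := by
  refine mem_monStabilizer (fun m => ?_) fun j v _ hpi => ?_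
  · rw [← incl_pi]
    exact incl_smul_one_tmul_mem_monSpan _ m
  by_cases hj : j.1 + 1 < lam.card
  · have hrel : piElt Daha.T Daha.θ * Daha.X j = Daha.X ⟨j.1 + 1, hj⟩ * piElt Daha.T Daha.θ :=
      Daha.rel _ _ (.pi ⟨j.1, by omega⟩)
    rw [hrel, mul_smul]
    exact X_mem_monStabilizer _ _ hpi
  · have := j.2
    rw [Daha.rel _ _ (.pi_last (n := lam.card) ⟨0, j.pos⟩ j rfl (by omega)), smul_assoc, mul_smul]
    exact Submodule.smul_mem _ _ (X_mem_monStabilizer _ _ hpi)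

theorem theta_zero_mem_monStabilizer (h : 0 < lam.card) :
    Daha.θ ⟨0, h⟩ ∈ monStabilizer lam := by
  set l := List.finRange (lam.card - 1)
  have hmem : (l.reverse.map Daha.T).prod ∈ monStabilizer lam :=
    list_prod_mem fun x hx => by
      obtain ⟨i, -, rfl⟩ := List.mem_map.mp hx
      exact T_mem_monStabilizer i
  have hmul : piElt Daha.T Daha.θ * (l.reverse.map Daha.T).prod =
      t ^ (lam.card - 1) • Daha.θ ⟨0, h⟩ := by
    rw [piElt, dif_pos h, List.ofFn_eq_map, smul_mul_assoc, mul_assoc,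
      prod_map_tinv_mul_prod_reverse_map fun i => Daha.rel _ _ (.aff (.hecke (.quad i))), mul_one]
  rw [← inv_smul_smul₀ (pow_ne_zero (lam.card - 1) t_ne_zero) (Daha.θ ⟨0, h⟩), ← hmul]
  exact Subalgebra.smul_mem _ (mul_mem pi_mem_monStabilizer hmem) _

theorem theta_mem_monStabilizer (i : Fin lam.card) : Daha.θ i ∈ monStabilizer lam := by
  obtain ⟨k, hk⟩ := i
  induction k with
  | zero => exact theta_zero_mem_monStabilizer hk
  | succ k ih =>
    let i : Fin (lam.card - 1) := ⟨k, by omega⟩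
    have hstep : Daha.θ ⟨k + 1, hk⟩ = t • (tinv (Daha.T i) * Daha.θ (lo i) * tinv (Daha.T i)) :=
      Daha.rel _ _ (.aff (.step i))
    have hT := tinv_mem (T_mem_monStabilizer i)
    rw [hstep]
    exact Subalgebra.smul_mem _ (mul_mem (mul_mem hT (ih _)) hT) _

theorem mem_monStabilizer_of_daha (a : Daha lam.card) : a ∈ monStabilizer lam :=
  Daha.induction (algebraMap_mem _) T_mem_monStabilizer theta_mem_monStabilizer
    X_mem_monStabilizer (fun _ _ => mul_mem) (fun _ _ => add_mem) a

theorem monSpan_eq_top (lam : YoungDiagram) : monSpan lam = ⊤ := by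
  rw [eq_top_iff]
  rintro v -
  obtain ⟨x, rfl⟩ := (inducedSub lam).mkQ_surjective v
  induction x using TensorProduct.induction_on with
  | zero => rw [map_zero]; exact zero_mem _
  | tmul a m =>
    rw [← mul_one a, ← smul_eq_mul, ← TensorProduct.smul_tmul', map_smul]
    exact mem_monStabilizer_of_daha a _ (one_tmul_mem_monSpan m)
  | add x y hx hy => rw [map_add]; exact add_mem hx hy

end V

/-! ## The map to the model is injective -/

section Graded

variable {ι D R M : Type*} [Ring R] [AddCommGroup M] [Module R M]

/-- The span of the basis vectors `b i` with `p i = d`. When `p` is thought of as a degree, this is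
the homogeneous part of degree `d`. -/
def fiberSpan (b : Module.Basis ι R M) (p : ι → D) (d : D) : Submodule R M :=
  Submodule.span R (b '' {i | p i = d})

variable {b : Module.Basis ι R M} {p : ι → D}

theorem fiberSpan_le_iff {d : D} {N : Submodule R M} :
    fiberSpan b p d ≤ N ↔ ∀ i, p i = d → b i ∈ N := by
  rw [fiberSpan, Submodule.span_le, Set.image_subset_iff]
  rfl

theorem basis_mem_fiberSpan {i : ι} {d : D} (h : p i = d) : b i ∈ fiberSpan b p d :=
  Submodule.subset_span ⟨i, h, rfl⟩

theorem map_mem_of_mem_fiberSpan {d : D} {N : Submodule R M} {f : Module.End R M}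
    (h : ∀ i, p i = d → f (b i) ∈ N) {v : M} (hv : v ∈ fiberSpan b p d) : f v ∈ N :=
  fiberSpan_le_iff (N := N.comap f).mpr h hv

theorem fiberSpan_le_fiberSpan {b' : Module.Basis ι R M} (h : ∀ i, ∃ k : R, b i = k • b' i)
    (d : D) :
    fiberSpan b p d ≤ fiberSpan b' p d := by
  refine fiberSpan_le_iff.mpr fun i hi => ?_
  obtain ⟨k, hk⟩ := h i
  rw [hk]
  exact Submodule.smul_mem _ k (basis_mem_fiberSpan hi)

theorem iSup_fiberSpan : ⨆ d, fiberSpan b p d = ⊤ := by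
  rw [eq_top_iff, ← b.span_eq, Submodule.span_le]
  rintro _ ⟨i, rfl⟩
  exact Submodule.mem_iSup_of_mem (p i) (basis_mem_fiberSpan rfl)

theorem iSupIndep_fiberSpan : iSupIndep (fiberSpan b p) := by
  intro d
  have hle : ⨆ (d') (_ : d' ≠ d), fiberSpan b p d' ≤ Submodule.span R (b '' {i | p i = d}ᶜ) :=
    iSup₂_le fun d' hd' => fiberSpan_le_iff.mpr fun i hi =>
      Submodule.subset_span ⟨i, fun h => hd' (hi.symm.trans h), rfl⟩
  exact (b.linearIndependent.disjoint_span_image disjoint_compl_right).mono_right hle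

theorem isInternal_fiberSpan [DecidableEq D] : DirectSum.IsInternal (fiberSpan b p) :=
  DirectSum.isInternal_submodule_of_iSupIndep_of_iSup_eq_top iSupIndep_fiberSpan iSup_fiberSpan

theorem repr_eq_zero_of_mem_fiberSpan {d : D} {v : M} (hv : v ∈ fiberSpan b p d) {i : ι}
    (hi : p i ≠ d) : b.repr v i = 0 := by
  by_contra h
  exact hi (b.mem_span_image.mp hv (Finsupp.mem_support_iff.mpr h))

theorem injective_of_surjective_of_isInternal {K V : Type*} [Field K] [AddCommGroup V] [Module K V]
    [DecidableEq D] {A : D → Submodule K V} [∀ d, FiniteDimensional K (A d)]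
    (hA : DirectSum.IsInternal A) {f : Module.End K V} (hf : Function.Surjective f)
    (hfA : ∀ d, ∀ v ∈ A d, f v ∈ A d) : Function.Injective f := by
  let g := DirectSum.lmap fun d => f.restrict (hfA d)
  have hcomm : DirectSum.coeLinearMap A ∘ g = f ∘ DirectSum.coeLinearMap A := by
    have hlin : DirectSum.coeLinearMap A ∘ₗ g = f ∘ₗ DirectSum.coeLinearMap A := by
      ext d v
      simp [g]
    exact congrArg DFunLike.coe hlin
  have hg_surj : Function.Surjective g :=
    .of_comp_left (hcomm ▸ hf.comp hA.surjective) hA.injective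
  have hg_inj : Function.Injective g := (DirectSum.lmap_injective _).mpr fun d =>
    LinearMap.injective_iff_surjective.mpr ((DirectSum.lmap_surjective _).mp hg_surj d)
  exact .of_comp_right (hcomm ▸ hA.injective.comp hg_inj) hA.surjective

end Graded

section Diagonal

variable {ι κ K M : Type*} [Field K] [AddCommGroup M] [Module K M] {b : Module.Basis ι K M}

theorem repr_of_diagonal {f : Module.End K M} {c : ι → K} (hf : ∀ i, f (b i) = c i • b i) (v : M)
    (i : ι) : b.repr (f v) i = c i * b.repr v i := by
  have hcoord : b.coord i ∘ₗ f = c i • b.coord i := by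
    refine b.ext fun k => ?_
    by_cases hk : k = i
    · simp [hf, hk]
    · simp [hf, hk]
  exact LinearMap.congr_fun hcoord v

theorem eq_repr_smul_of_forall_ne {v : M} {i : ι} (h : ∀ k ≠ i, b.repr v k = 0) :
    v = b.repr v i • b i := by
  refine b.ext_elem fun k => ?_
  by_cases hk : k = i
  · simp [hk]
  · simp [h k hk, Ne.symm hk]

variable {f : κ → Module.End K M} {c : ι → κ → K} (hc : Function.Injective c)
  (hf : ∀ j i, f j (b i) = c i j • b i)
include hc hf

theorem eq_repr_smul_of_forall_diagonal {v : M} {i : ι} (hv : ∀ j, f j v = c i j • v) :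
    v = b.repr v i • b i := by
  refine eq_repr_smul_of_forall_ne fun k hk => ?_
  by_contra h0
  refine hk (hc (funext fun j => mul_right_cancel₀ h0 ?_))
  rw [← repr_of_diagonal (hf j), hv, map_smul, Finsupp.smul_apply, smul_eq_mul]

variable {N : Submodule K M} (hN : ∀ j, ∀ v ∈ N, f j v ∈ N)
include hN

theorem exists_mem_support_ssubset {v : M} (hv : v ∈ N) {i k : ι} (hi : b.repr v i ≠ 0)
    (hk : b.repr v k ≠ 0) (hki : k ≠ i) :
    ∃ w ∈ N, b.repr w i ≠ 0 ∧ (b.repr w).support ⊂ (b.repr v).support := by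
  obtain ⟨j, hj⟩ : ∃ j, c i j ≠ c k j := Function.ne_iff.mp fun h => hki (hc h).symm
  have hrepr (l : ι) : b.repr (f j v - c k j • v) l = (c l j - c k j) * b.repr v l := by
    simp [repr_of_diagonal (hf j), sub_mul]
  refine ⟨f j v - c k j • v, sub_mem (hN j v hv) (N.smul_mem _ hv), ?_, ?_⟩
  · rw [hrepr]
    exact mul_ne_zero (sub_ne_zero.mpr hj) hi
  · refine (Finset.ssubset_iff_of_subset fun l hl => ?_).mpr
      ⟨k, Finsupp.mem_support_iff.mpr hk, by
        rw [Finsupp.notMem_support_iff, hrepr, sub_self, zero_mul]⟩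
    rw [Finsupp.mem_support_iff, hrepr] at hl
    exact Finsupp.mem_support_iff.mpr (right_ne_zero_of_mul hl)

theorem basis_mem_of_forall_diagonal {v : M} (hv : v ∈ N) {i : ι} (hi : b.repr v i ≠ 0) :
    b i ∈ N := by
  induction hs : (b.repr v).support using Finset.strongInduction generalizing v with
  | H s ih =>
    subst hs
    by_cases hex : ∃ k ≠ i, b.repr v k ≠ 0
    · obtain ⟨k, hki, hk⟩ := hex
      obtain ⟨w, hw, hwi, hlt⟩ := exists_mem_support_ssubset hc hf hN hv hi hk hki
      exact ih _ hlt hw hwi rfl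
    · push Not at hex
      rw [eq_repr_smul_of_forall_ne hex] at hv
      exact (N.smul_mem_iff hi).mp hv

end Diagonal

namespace Model

variable {lam : YoungDiagram}

/-- The homogeneous part of degree `N` of the model. -/
abbrev degSub (lam : YoungDiagram) (N : ℕ) : Submodule Kqt (Model lam) := fiberSpan e PSYT.deg N

instance (N : ℕ) : FiniteDimensional Kqt (degSub lam N) :=
  FiniteDimensional.span_of_finite Kqt ((PSYT.finite_deg N).image _)

theorem sSeq_mem_degSub (i : ℕ) {N : ℕ} {v : Model lam} (hv : v ∈ degSub lam N) :
    sSeq lam i v ∈ degSub lam N := by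
  rw [sSeq]
  split_ifs
  · refine map_mem_of_mem_fiberSpan (fun τ hτ => ?_) hv
    rw [sOp_e]
    exact sub_mem
      (Submodule.smul_mem _ _ (basis_mem_fiberSpan ((PSYT.deg_swap _ _).trans hτ)))
      (Submodule.smul_mem _ _ (basis_mem_fiberSpan hτ))
  · exact zero_mem _

theorem thetaSeq_mem_degSub (i : ℕ) {N : ℕ} {v : Model lam} (hv : v ∈ degSub lam N) :
    thetaSeq lam i v ∈ degSub lam N := by
  rw [thetaSeq]
  split_ifs
  · refine map_mem_of_mem_fiberSpan (fun τ hτ => ?_) hv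
    rw [thetaOp_e]
    exact Submodule.smul_mem _ _ (basis_mem_fiberSpan hτ)
  · exact zero_mem _

theorem qOp_mem_degSub (h : 0 < lam.card) {N : ℕ} {v : Model lam} (hv : v ∈ degSub lam N) :
    qOp v ∈ degSub lam (N + 1) := by
  refine map_mem_of_mem_fiberSpan (fun τ hτ => ?_) hv
  rw [qOp_e]
  exact Submodule.smul_mem _ _ (basis_mem_fiberSpan (hτ ▸ PSYT.deg_psi τ h))

theorem upProd_mem_degSub (k : ℕ) {N : ℕ} {v : Model lam} (hv : v ∈ degSub lam N) :
    upProd (sSeq lam) k v ∈ degSub lam N := by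
  induction k generalizing v with
  | zero => exact hv
  | succ k ih => exact ih (sSeq_mem_degSub k hv)

theorem xSeq_mem_degSub (h : 0 < lam.card) (k : ℕ) {N : ℕ} {v : Model lam}
    (hv : v ∈ degSub lam N) :
    IntertwinerData.xSeq (lam.card - 1) (sSeq lam) (thetaSeq lam) qOp k v ∈ degSub lam (N + 1) := by
  induction k generalizing v with
  | zero =>
    exact Submodule.smul_mem _ _
      (thetaSeq_mem_degSub 0 (upProd_mem_degSub _ (qOp_mem_degSub h hv)))
  | succ k ih => exact Submodule.smul_mem _ _ (sSeq_mem_degSub k (ih (sSeq_mem_degSub k hv)))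

theorem ofV_monVec_mem (p : (Fin lam.card → ℕ) × SYT lam) :
    ofV lam (V.monVec p) ∈ degSub lam (∑ i, p.1 i) := by
  obtain ⟨α, σ⟩ := p
  rw [V.monVec, map_smul, ofV_tmul, one_smul, spechtMap_vec]
  induction α using V.exponent_induction with
  | zero =>
    rw [V.mon_zero, one_smul]
    exact basis_mem_fiberSpan (by simp [PSYT.deg_toPSYT])
  | add i β ih =>
    rw [← V.X_mul_mon, mul_smul, X_smul]
    have hX : xOp i (V.mon β • e σ.toPSYT) ∈ degSub lam (∑ j, β j + 1) :=
      xSeq_mem_degSub i.pos i.1 ih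
    simpa [Finset.sum_add_distrib] using hX

/-- The map from the model to `V_λ` that sends the basis vectors to the vectors `X^α ⊗ σ`, with
`(α, σ)` encoded as a tableau by `PSYT.ofExponents`. -/
def toV (lam : YoungDiagram) : Model lam →ₗ[Kqt] V lam :=
  e.constr Kqt (Function.extend PSYT.ofExponents V.monVec 0)

theorem toV_e_ofExponents (p : (Fin lam.card → ℕ) × SYT lam) :
    toV lam (e (PSYT.ofExponents p)) = V.monVec p := by
  rw [toV, Module.Basis.constr_basis, PSYT.ofExponents_injective.extend_apply]

theorem toV_surjective : Function.Surjective (toV lam) := by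
  rw [← LinearMap.range_eq_top, eq_top_iff, ← V.monSpan_eq_top, V.monSpan, Submodule.span_le]
  rintro _ ⟨p, rfl⟩
  exact ⟨_, toV_e_ofExponents p⟩

theorem ofV_toV_mem_degSub {N : ℕ} {v : Model lam} (hv : v ∈ degSub lam N) :
    ofV lam (toV lam v) ∈ degSub lam N := by
  refine map_mem_of_mem_fiberSpan (f := (ofV lam).restrictScalars Kqt ∘ₗ toV lam) ?_ hv
  rintro τ rfl
  by_cases hτ : ∃ p, PSYT.ofExponents p = τ
  · obtain ⟨p, rfl⟩ := hτ
    rw [LinearMap.comp_apply, toV_e_ofExponents, PSYT.deg_ofExponents]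
    exact ofV_monVec_mem p
  · rw [LinearMap.comp_apply, toV, Module.Basis.constr_basis, Function.extend_apply' _ _ _ hτ,
      Pi.zero_apply, map_zero]
    exact zero_mem _

theorem ofV_injective : Function.Injective (ofV lam) := by
  have hcomp : Function.Injective ((ofV lam).restrictScalars Kqt ∘ₗ toV lam) :=
    injective_of_surjective_of_isInternal isInternal_fiberSpan (ofV_surjective.comp toV_surjective)
      fun _ _ => ofV_toV_mem_degSub
  exact .of_comp_right hcomp toV_surjective

end Model

/-- The induced module `V_λ` is isomorphic to the model. -/
def equivModel (lam : YoungDiagram) : V lam ≃ₗ[Daha lam.card] Model lam :=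
  LinearEquiv.ofBijective (Model.ofV lam) ⟨Model.ofV_injective, Model.ofV_surjective⟩

/-! ## The basis and the irreducible blocks -/

theorem exists_toRYT_eq {lam : YoungDiagram} (T : RYT lam) : ∃ τ : PSYT lam, τ.toRYT = T := by
  let ε : Box lam ≃ Fin lam.card := Fintype.equivFinOfCardEq (Fintype.card_coe _)
  let key (b : Box lam) : ℕᵒᵈ ×ₗ ℕ := toLex (OrderDual.toDual (T.toFun b), b.1.1 + b.1.2)
  let σ := Tuple.sort (key ∘ ε.symm)
  have hlt (b b' : Box lam) (h : key b < key b') : σ.symm (ε b) < σ.symm (ε b') := by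
    by_contra! hle
    have hkey := Tuple.monotone_sort (key ∘ ε.symm) hle
    simp only [Function.comp_apply, σ, Equiv.apply_symm_apply, Equiv.symm_apply_apply] at hkey
    exact h.not_ge hkey
  refine ⟨⟨fun b => (σ.symm (ε b), T.toFun b), σ.symm.bijective.comp ε.bijective,
    fun b b' h => (T.anti b b' h).lt_or_eq.imp_right fun heq => ⟨heq.symm, hlt b b' ?_⟩⟩, rfl⟩
  rw [Prod.Lex.toLex_lt_toLex]
  refine Or.inr ⟨by rw [heq], ?_⟩
  rcases h with h | h <;> simp only <;> omega

theorem PSYT.weight_injective {lam : YoungDiagram} :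
    Function.Injective (PSYT.weight (lam := lam)) := fun _ _ h =>
  PSYT.datum_injective (funext fun i => wt_injective (congrFun h i))

namespace Model

variable {lam : YoungDiagram}

theorem isUnit_thetaOp (i : Fin lam.card) : IsUnit (thetaOp (lam := lam) i) := by
  refine ⟨⟨thetaOp i, e.constr Kqt fun τ => (wt (τ.datum i))⁻¹ • e τ, ?_, ?_⟩, rfl⟩
  all_goals
    refine e.ext fun τ => ?_
    rw [Module.End.mul_apply]
    simp only [Module.Basis.constr_basis, map_smul, thetaOp_e, smul_smul]
    simp [wt_ne_zero]

theorem isUnit_sSeq {i : ℕ} (hi : i < lam.card - 1) : IsUnit (sSeq lam i) := by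
  have h := intertwinerData lam
  refine ⟨⟨sSeq lam i, t⁻¹ • heckeGen (sSeq lam i), ?_, ?_⟩, rfl⟩
  · rw [mul_smul_comm, h.s_mul_heckeGen hi, inv_smul_smul₀ t_ne_zero]
  · rw [smul_mul_assoc, h.heckeGen_mul_s hi, inv_smul_smul₀ t_ne_zero]

theorem isUnit_upProd_sSeq {k : ℕ} (hk : k ≤ lam.card - 1) : IsUnit (upProd (sSeq lam) k) := by
  induction k with
  | zero => exact isUnit_one
  | succ k ih => exact (ih (by omega)).mul (isUnit_sSeq hk)

theorem act_pi (h : 0 < lam.card) : act lam (piElt Daha.T Daha.θ) =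
    IntertwinerData.pi (lam.card - 1) (sSeq lam) (thetaSeq lam) := by
  rw [map_piElt, ← IntertwinerData.piElt_eq h]
  congr 1
  · exact funext fun i => act_mk (.T i)
  · exact funext fun i => act_mk (.θ i)

theorem isUnit_act_pi : IsUnit (act lam (piElt Daha.T Daha.θ)) := by
  by_cases h : 0 < lam.card
  · rw [act_pi h, IntertwinerData.pi, thetaSeq_of_lt h]
    exact (isUnit_thetaOp _).mul (isUnit_upProd_sSeq le_rfl)
  · rw [piElt, dif_neg h, map_one]
    exact isUnit_one

end Model

open Model

section MacdonaldBasis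

variable {lam : YoungDiagram}

theorem equivModel_aff_smul (a : Aff lam.card) (v : V lam) :
    equivModel lam (a • v) = incl lam.card a • equivModel lam v :=
  (equivModel lam).map_smul (incl lam.card a) v

theorem equivModel_K_smul (k : Kqt) (v : V lam) :
    equivModel lam (k • v) = k • equivModel lam v :=
  ((equivModel lam).restrictScalars Kqt).map_smul k v

theorem equivModel_tmul_vec (σ : SYT lam) :
    equivModel lam (V.tmul 1 (Specht.vec σ)) = e σ.toPSYT := by
  refine (ofV_tmul 1 (Specht.vec σ)).trans ?_
  rw [spechtMap_vec, one_smul]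

theorem equivModel_pi_smul (v : V lam) :
    equivModel lam (Aff.pi lam.card • v) = act lam (piElt Daha.T Daha.θ) (equivModel lam v) := by
  rw [equivModel_aff_smul, V.incl_pi, smul_def]

theorem pi_bijective (lam : YoungDiagram) :
    Function.Bijective fun v : V lam => Aff.pi lam.card • v := by
  have hact := (Module.End.isUnit_iff _).mp (isUnit_act_pi (lam := lam))
  rw [← Function.Bijective.of_comp_iff' (equivModel lam).bijective]
  exact (funext equivModel_pi_smul : equivModel lam ∘ _ = _) ▸ hact.comp (equivModel lam).bijective

/-- The basis of `V_λ` that corresponds to the basis of the model. -/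
def macdonaldBasis (lam : YoungDiagram) : Module.Basis (PSYT lam) Kqt (V lam) :=
  e.map ((equivModel lam).restrictScalars Kqt).symm

theorem equivModel_macdonaldBasis (τ : PSYT lam) :
    equivModel lam (macdonaldBasis lam τ) = e τ :=
  (equivModel lam).apply_symm_apply (e τ)

theorem theta_smul_macdonaldBasis (τ : PSYT lam) (i : Fin lam.card) :
    (Aff.θ i : Aff lam.card) • macdonaldBasis lam τ = τ.weight i • macdonaldBasis lam τ := by
  apply (equivModel lam).injective
  rw [equivModel_aff_smul, equivModel_K_smul, equivModel_macdonaldBasis, incl_θ, theta_smul,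
    thetaOp_e]
  rfl

theorem tinv_T_smul_macdonaldBasis (τ : PSYT lam) (i : Fin (lam.card - 1)) :
    (t • tinv (Aff.T i : Aff lam.card)) • macdonaldBasis lam τ =
      swapCoeff (τ.datum (lo i)) (τ.datum (hi i)) • macdonaldBasis lam (τ.swap i) -
        diagCoeff (τ.datum (lo i)) (τ.datum (hi i)) • macdonaldBasis lam τ := by
  apply (equivModel lam).injective
  rw [smul_tinv, add_smul, smul_assoc, one_smul, map_add, map_sub, equivModel_aff_smul, incl_T]
  simp only [equivModel_K_smul, equivModel_macdonaldBasis]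
  rw [T_smul, sub_add_cancel, sOp_e]

theorem macdonaldBasis_psi {τ : PSYT lam} {i j : Fin lam.card} (hi : i.1 = 0)
    (hj : j.1 + 1 = lam.card) {v : V lam} (hv : Aff.pi lam.card • v = macdonaldBasis lam τ) :
    macdonaldBasis lam τ.psi = q ^ τ.w i • (Daha.X j : Daha lam.card) • v := by
  have hpi : IntertwinerData.pi (lam.card - 1) (sSeq lam) (thetaSeq lam) (equivModel lam v) =
      e τ := by
    rw [← act_pi i.pos, ← equivModel_pi_smul, hv, equivModel_macdonaldBasis]
  have hX : xOp j = qOp * IntertwinerData.pi (lam.card - 1) (sSeq lam) (thetaSeq lam) := by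
    rw [xOp, show j.1 = lam.card - 1 by omega, (intertwinerData lam).xSeq_last_eq]
  apply (equivModel lam).injective
  rw [equivModel_K_smul, map_smul, X_smul, hX, Module.End.mul_apply, hpi, qOp_e,
    equivModel_macdonaldBasis, firstExp_eq _ hi]
  exact (smul_inv_smul₀ (pow_ne_zero _ q_ne_zero) _).symm

theorem isMacdonaldBasis_macdonaldBasis (lam : YoungDiagram) :
    IsMacdonaldBasis (macdonaldBasis lam) where
  weight := theta_smul_macdonaldBasis
  weight_injective := PSYT.weight_injective
  standard σ := by
    apply (equivModel lam).injective
    rw [equivModel_macdonaldBasis, equivModel_tmul_vec]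
  swap i τ τ' h := by
    obtain ⟨hup, rfl⟩ := PSYT.swapUp_iff.mp h
    rw [tinv_T_smul_macdonaldBasis, swapCoeff_of_up hup, one_smul]
    exact (sub_add_cancel _ _).symm
  psi _ _ _ hi hj _ hv := macdonaldBasis_psi hi hj hv

theorem IsMacdonaldBasis.exists_eq_smul {F G : Module.Basis (PSYT lam) Kqt (V lam)}
    (hF : IsMacdonaldBasis F) (hG : IsMacdonaldBasis G) (τ : PSYT lam) :
    ∃ k : Kqt, F τ = k • G τ :=
  ⟨_, eq_repr_smul_of_forall_diagonal (f := fun i => Algebra.lsmul Kqt Kqt (V lam) (Aff.θ i))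
    PSYT.weight_injective (fun i σ => hG.weight σ i) (hF.weight τ)⟩

theorem IsMacdonaldBasis.fiberSpan_eq {F G : Module.Basis (PSYT lam) Kqt (V lam)}
    (hF : IsMacdonaldBasis F) (hG : IsMacdonaldBasis G) (T : RYT lam) :
    fiberSpan F PSYT.toRYT T = fiberSpan G PSYT.toRYT T :=
  le_antisymm (fiberSpan_le_fiberSpan (hF.exists_eq_smul hG) T)
    (fiberSpan_le_fiberSpan (hG.exists_eq_smul hF) T)

end MacdonaldBasis

section Block

variable {lam : YoungDiagram}

theorem T_mem_smulStabilizer (T : RYT lam) (i : Fin (lam.card - 1)) :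
    Aff.T i ∈ smulStabilizer (Aff lam.card) (fiberSpan (macdonaldBasis lam) PSYT.toRYT T) := by
  refine mem_smulStabilizer_span ?_
  rintro _ ⟨τ, hτ, rfl⟩
  have hT : (Aff.T i : Aff lam.card) = t • tinv (Aff.T i) - (t - 1) • 1 := by
    rw [smul_tinv, add_sub_cancel_right]
  rw [hT, sub_smul, tinv_T_smul_macdonaldBasis, smul_assoc, one_smul]
  have hmem (σ : PSYT lam) (hσ : σ.toRYT = T) (k : Kqt) :
      k • macdonaldBasis lam σ ∈ fiberSpan (macdonaldBasis lam) PSYT.toRYT T :=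
    Submodule.smul_mem _ k (basis_mem_fiberSpan hσ)
  exact sub_mem (sub_mem (hmem _ ((PSYT.toRYT_swap i τ).trans hτ) _) (hmem _ hτ _)) (hmem _ hτ _)

theorem theta_mem_smulStabilizer (T : RYT lam) (i : Fin lam.card) :
    Aff.θ i ∈ smulStabilizer (Aff lam.card) (fiberSpan (macdonaldBasis lam) PSYT.toRYT T) := by
  refine mem_smulStabilizer_span ?_
  rintro _ ⟨τ, hτ, rfl⟩
  rw [theta_smul_macdonaldBasis]
  exact Submodule.smul_mem _ _ (basis_mem_fiberSpan hτ)

/-- The `𝒜_n`-submodule `U_T` of `V_λ`. -/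
def block (T : RYT lam) : Submodule (Aff lam.card) (V lam) where
  __ := fiberSpan (macdonaldBasis lam) PSYT.toRYT T
  smul_mem' a v hv := by
    suffices ha : a ∈ smulStabilizer (Aff lam.card) (fiberSpan (macdonaldBasis lam) PSYT.toRYT T)
      from ha v hv
    exact Aff.induction (algebraMap_mem _) (T_mem_smulStabilizer T) (theta_mem_smulStabilizer T)
      (fun _ _ => mul_mem) (fun _ _ => add_mem) a

theorem isInternal_block (lam : YoungDiagram) :
    DirectSum.IsInternal (block : RYT lam → Submodule (Aff lam.card) (V lam)) :=
  isInternal_fiberSpan (b := macdonaldBasis lam) (p := PSYT.toRYT)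

theorem IsMacdonaldBasis.restrictScalars_block {F : Module.Basis (PSYT lam) Kqt (V lam)}
    (hF : IsMacdonaldBasis F) (T : RYT lam) :
    (block T).restrictScalars Kqt = Submodule.span Kqt (F '' {τ | τ.toRYT = T}) :=
  (isMacdonaldBasis_macdonaldBasis lam).fiberSpan_eq hF T

section Submodule

variable {N : Submodule (Aff lam.card) (V lam)}

theorem macdonaldBasis_swap_mem {τ : PSYT lam} (hτ : macdonaldBasis lam τ ∈ N)
    (i : Fin (lam.card - 1)) : macdonaldBasis lam (τ.swap i) ∈ N := by
  let N' : Submodule Kqt (Model lam) :=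
    (N.restrictScalars Kqt).comap ((equivModel lam).restrictScalars Kqt).symm.toLinearMap
  have hT : (Daha.T i : Daha lam.card) • e τ ∈ N' := by
    change (equivModel lam).symm _ ∈ N
    rw [map_smul, ← incl_T]
    exact N.smul_mem _ hτ
  exact e_swap_mem (N := N') hτ (sOp_mem_of_T_smul_mem hτ hT)

theorem macdonaldBasis_mem_of_repr_ne_zero {v : V lam} (hv : v ∈ N) {τ : PSYT lam}
    (hτ : (macdonaldBasis lam).repr v τ ≠ 0) : macdonaldBasis lam τ ∈ N :=
  basis_mem_of_forall_diagonal (N := N.restrictScalars Kqt)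
    (f := fun i => Algebra.lsmul Kqt Kqt (V lam) (Aff.θ i)) PSYT.weight_injective
    (fun i σ => theta_smul_macdonaldBasis σ i) (fun i _ => N.smul_mem (Aff.θ i)) hv hτ

theorem block_le {T : RYT lam} {v : V lam} (hvN : v ∈ N) (hvT : v ∈ block T) (hv : v ≠ 0) :
    block T ≤ N := by
  obtain ⟨τ, hτ⟩ : ∃ τ, (macdonaldBasis lam).repr v τ ≠ 0 := by
    by_contra! h
    exact hv ((macdonaldBasis lam).ext_elem fun τ => by rw [h, map_zero, Finsupp.zero_apply])
  have hτT : τ.toRYT = T := by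
    by_contra h
    exact hτ (repr_eq_zero_of_mem_fiberSpan hvT h)
  suffices hle : fiberSpan (macdonaldBasis lam) PSYT.toRYT T ≤ N.restrictScalars Kqt from hle
  refine fiberSpan_le_iff.mpr fun σ hσ => ?_
  exact PSYT.induction_swap (P := fun σ => macdonaldBasis lam σ ∈ N) (hτT.trans hσ.symm)
    (fun i _ h => macdonaldBasis_swap_mem h i) (macdonaldBasis_mem_of_repr_ne_zero hvN hτ)

end Submodule

theorem isSimpleModule_block (T : RYT lam) : IsSimpleModule (Aff lam.card) (block T) := by
  rw [isSimpleModule_iff_isAtom]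
  refine ⟨fun hbot => ?_, fun N hN => ?_⟩
  · obtain ⟨τ, rfl⟩ := exists_toRYT_eq T
    have hτ : macdonaldBasis lam τ ∈ block τ.toRYT :=
      basis_mem_fiberSpan (b := macdonaldBasis lam) rfl
    rw [hbot, Submodule.mem_bot] at hτ
    exact (macdonaldBasis lam).ne_zero τ hτ
  · by_contra hne
    obtain ⟨v, hv, hv0⟩ := N.ne_bot_iff.mp hne
    exact hN.not_ge (block_le hv (hN.le hv) hv0)

end Block

end MackeyDAHA

end

theorem mainTheorem11 (lam : YoungDiagram) :
    Function.Bijective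
      (fun v : MackeyDAHA.V lam => MackeyDAHA.Aff.pi lam.card • v) ∧
    (∃ F : Module.Basis (MackeyDAHA.PSYT lam) MackeyDAHA.Kqt (MackeyDAHA.V lam),
      MackeyDAHA.IsMacdonaldBasis F) ∧
    ∀ F : Module.Basis (MackeyDAHA.PSYT lam) MackeyDAHA.Kqt (MackeyDAHA.V lam),
      MackeyDAHA.IsMacdonaldBasis F →
      ∃ U : MackeyDAHA.RYT lam →
          Submodule (MackeyDAHA.Aff lam.card) (MackeyDAHA.V lam),
        (∀ T, (U T).restrictScalars MackeyDAHA.Kqt =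
          Submodule.span MackeyDAHA.Kqt (F '' {τ | τ.toRYT = T})) ∧
        DirectSum.IsInternal U ∧
        ∀ T, IsSimpleModule (MackeyDAHA.Aff lam.card) (U T) :=
  ⟨MackeyDAHA.pi_bijective lam,
    ⟨MackeyDAHA.macdonaldBasis lam, MackeyDAHA.isMacdonaldBasis_macdonaldBasis lam⟩,
    fun _ hF => ⟨MackeyDAHA.block, hF.restrictScalars_block,
      MackeyDAHA.isInternal_block lam, MackeyDAHA.isSimpleModule_block⟩⟩
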